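/- **Notation.** Let $\alpha_1>\dots>\alpha_N\ge 1$ be integers and $\mu=(m_1,\dots,m_N)$ nonnegative integers; put $\widetilde m_r=m_r$ if $\alpha_r$ is odd, $\widetilde m_r=2m_r$ if $\alpha_r$ is even, and $\widetilde\mu=(\widetilde m_1,\dots,\widetilde m_N)$. For a square complex matrix $M$ let $\Sigma_M=\{Q : Q^TQ=I,\ Q^TMQ=M\}$ (complex orthogonal $Q$). "Conjugate" means conjugate by an invertible complex matrix; dimensions are dimensions of complex Lie groups. *Toeplitz groups.* $\mathbb T^{\alpha,\mu}$ is the set of nonsingular block matrices $\mathcal X=[\mathcal X_{rs}]_{r,s=1}^N$, where $\mathcal X_{rs}$ is an $\alpha_r\times\alpha_s$ block matrix with blocks of size $m_r\times m_s$, equal to $[\,0\ \ \mathcal T_{rs}]$ if $\alpha_r<\alpha_s$, to $\begin{bmatrix}\mathcal T_{rs}\\0\end{bmatrix}$ if $\alpha_r>\alpha_s$ and to $\mathcal T_{rs}$ if $r=s$, with $\mathcal T_{rs}=T(A^{rs}_0,\dots,A^{rs}_{b_{rs}-1})$, $b_{rs}=\min\{\alpha_r,\alpha_s\}$, the upper triangular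 block Toeplitz matrix having $A_j^{rs}$ on its $j$-th super-diagonal, and with all $A^{rr}_0$ invertible. *Normal forms.* $K_m(\lambda)=\begin{bmatrix}M_m&N_m(\lambda)\\-N_m(\lambda)&-M_m\end{bmatrix}$, where $M_m$ has $\tfrac12$ on the first upper and $-\tfrac12$ on the first lower diagonal and zeros elsewhere, and $N_m(\lambda)$ has $i\lambda$ on the anti-diagonal, $\tfrac i2$ on the two neighbouring anti-diagonals and zeros elsewhere ($m\times m$). For $n=2m-1$, $L_n$ is the skew-symmetric $n\times n$ matrix which is the sum of: the tridiagonal skew-symmetric matrix whose first upper diagonal has its first $m-1$ entries equal to $\tfrac12$ and its last $m-1$ entries equal to $-\tfrac12$; and the skew-symmetric matrix supported on the two anti-diagonals next to the main anti-diagonal, with entries $\tfrac i2$ above and $-\tfrac i2$ below the main diagonal. **(1)** Let $\lambda\in\mathbb C\setminus\{0\}$, $\mathcal K_\lambda=\bigoplus_{r=1}^N\bigoplus_{j=1}^{m_r}K_{\alpha_r}(\lambda)$ and $\mathcal O_\lambda=e^{\mathcal K_\lambda}$. Then $\Sigma_{\mathcal K_\lambda}$ is conjugate to $\{\mathcal X\oplus(\mathcal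 X^{-1})^T : \mathcal X\in\mathbb T^{\alpha,\mu}\}$; the set $\mathbb T^{\alpha,\mu}$ is a group, $\Sigma_{\mathcal K_\lambda}$ is isomorphic to it, and $$\dim\Sigma_{\mathcal K_\lambda}=\sum_{r=1}^N m_r\Big(\alpha_rm_r+2\sum_{s=1}^{r-1}\alpha_r m_s\Big).$$ If moreover $\lambda\notin\{k\pi i : k\in\mathbb Z\}$, then $\Sigma_{\mathcal O_\lambda}=\Sigma_{\mathcal K_\lambda}$. **(2)** Let $\widetilde K_r=K_{\alpha_r}(0)$ for $\alpha_r$ even, $\widetilde K_r=L_{\alpha_r}$ for $\alpha_r$ odd, $\mathcal K_0=\bigoplus_{r=1}^N\bigoplus_{j=1}^{m_r}\widetilde K_r$ and $\mathcal O_0=\varepsilon e^{\mathcal K_0}$ with $\varepsilon\in\{1,-1\}$. Let $B_r=\bigoplus_{j=1}^{m_r}\begin{bmatrix}0&-1\\1&0\end{bmatrix}$ for $\alpha_r$ even and $B_r=(-1)^{(\alpha_r-1)/2}I_{m_r}$ for $\alpha_r$ odd. Then $\Sigma_{\mathcal O_0}=\Sigma_{\mathcal K_0}$, $$\dim\Sigma_{\mathcal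 K_0}=\sum_{r=1}^N\Big(\tfrac12\widetilde m_r^2\alpha_r+\sum_{s=1}^{r-1}\alpha_r\widetilde m_r\widetilde m_s\Big)-\sum_{\alpha_r\text{ odd}}\tfrac12m_r ,$$ and $\Sigma_{\mathcal K_0}$ is conjugate to a subgroup $\mathbb X\subset\mathbb T^{\alpha,\widetilde\mu}$ with the following properties. There are polynomials $D_j^r$ and $E^{rs}_j$ such that a block Toeplitz matrix with coefficients $A_j^{rs}\in\mathbb C^{\widetilde m_r\times\widetilde m_s}$ belongs to $\mathbb X$ if and only if * (I) $(A_0^{rr})^TB_rA_0^{rr}=B_r$ for all $r$ (while the $A_j^{rs}$ with $r>s$ are free); * (II) for all $r$ and $1\le j<\alpha_r$, $A_j^{rr}=A_0^{rr}B_r^{-1}Z_j^r+D_j^r$ for some (arbitrary) matrix $Z_j^r=(-1)^{\alpha_r+j}(Z_j^r)^T$, where $D_j^r$ depends only on the $A_{j'}^{r'r'}$ with $j'<j$, $r'\le r$, and on the entries of the blocks $\mathcal X_{r's'}$ with $r'>s'$; * (III) for all $r<s$ and $0\le j<\alpha_s$, $A_j^{rs}=E_j^{rs}$, where $E_j^{rs}$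 depends only on the entries of the blocks $\mathcal X_{r's'}$ with $r'\ge s'$. Moreover $\mathbb X=\mathbb O\ltimes\mathbb V$ (internal semidirect product, $\mathbb V$ normal), where $\mathbb O$ consists of all $\bigoplus_{r=1}^N\bigoplus_{j=1}^{\alpha_r}Q_r$ with $Q_r^TB_rQ_r=B_r$, and $\mathbb V$ consists of unipotent matrices and is generated by the following matrices: * $\bigoplus_{r=1}^NT(I,W_1^r,\dots,W^r_{\alpha_r-1})$ with $W_j^r=B_r^{-1}\big(Z_j^r-\tfrac12\sum_{k=1}^{j-1}(-1)^k(W_k^r)^TB_rW_{j-k}^r\big)$ and arbitrary $Z_j^r=(-1)^{\alpha_r+j}(Z_j^r)^T$; * for $1\le p<t\le N$, $0\le k\le\alpha_t-1$ and $F\in\mathbb C^{\widetilde m_t\times\widetilde m_p}$, the block Toeplitz matrix that agrees with the identity except in the blocks with both indices in $\{p,t\}$, where: $\mathcal T_{tp}$ has $F$ on its $k$-th super-diagonal and zeros elsewhere; $\mathcal T_{pt}$ has $(-1)^{k+1}B_p^{-1}F^TB_t$ on its $k$-th super-diagonal and zeros elsewhere; $\mathcal T_{rr}=T(I,V_1^r,\dots,V_{\alpha_r-1}^r)$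 for $r\in\{p,t\}$ with, for $j=n(2k+\alpha_p-\alpha_t)$ and $n\ge1$, $$V_j^p=(-1)^{kn}a_{n-1}B_p^{-1}(F^TB_tFB_p^{-1})^nB_p,\qquad V_j^t=(-1)^{kn}a_{n-1}B_t^{-1}(B_tFB_p^{-1}F^T)^nB_t,$$ $a_n=-\frac1{2^{2n+1}(n+1)}\binom{2n}n$, and $V_j^p=V_j^t=0$ for all other $j\ge1$. -/

import Mathlib

open Matrix

noncomputable section

/-- The isotropy group `Σ_M` of orthogonal similarity: all complex orthogonal `Q` (that is,
`Qᵀ Q = 1`; no complex conjugation) with `Qᵀ M Q = M`. -/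
def isotropyGroup {n : Type*} [Fintype n] [DecidableEq n] (M : Matrix n n ℂ) :
    Subgroup (GL n ℂ) where
  carrier := {Q | (Q : Matrix n n ℂ)ᵀ * (Q : Matrix n n ℂ) = 1 ∧
    (Q : Matrix n n ℂ)ᵀ * M * (Q : Matrix n n ℂ) = M}
  one_mem' := by simp
  mul_mem' := by
    rintro P Q ⟨hP, hP'⟩ ⟨hQ, hQ'⟩
    refine ⟨?_, ?_⟩
    · calc ((P * Q : GL n ℂ) : Matrix n n ℂ)ᵀ * ((P * Q : GL n ℂ) : Matrix n n ℂ)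
          = (Q : Matrix n n ℂ)ᵀ * ((P : Matrix n n ℂ)ᵀ * (P : Matrix n n ℂ)) * Q := by
            simp [Matrix.transpose_mul, Matrix.mul_assoc]
        _ = 1 := by rw [hP, Matrix.mul_one, hQ]
    · calc ((P * Q : GL n ℂ) : Matrix n n ℂ)ᵀ * M * ((P * Q : GL n ℂ) : Matrix n n ℂ)
          = (Q : Matrix n n ℂ)ᵀ * ((P : Matrix n n ℂ)ᵀ * M * (P : Matrix n n ℂ)) * Q := by
            simp [Matrix.transpose_mul, Matrix.mul_assoc]
        _ = M := by rw [hP', hQ']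
  inv_mem' := by
    rintro Q ⟨hQ, hQ'⟩
    have h1 : (Q : Matrix n n ℂ) * ((Q⁻¹ : GL n ℂ) : Matrix n n ℂ) = 1 := Q.mul_inv
    have h2 : ((Q⁻¹ : GL n ℂ) : Matrix n n ℂ)ᵀ * (Q : Matrix n n ℂ)ᵀ = 1 := by
      rw [← Matrix.transpose_mul, h1, Matrix.transpose_one]
    refine ⟨?_, ?_⟩
    · calc ((Q⁻¹ : GL n ℂ) : Matrix n n ℂ)ᵀ * ((Q⁻¹ : GL n ℂ) : Matrix n n ℂ)
          = ((Q⁻¹ : GL n ℂ) : Matrix n n ℂ)ᵀ * ((Q : Matrix n n ℂ)ᵀ * (Q : Matrix n n ℂ)) *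
              ((Q⁻¹ : GL n ℂ) : Matrix n n ℂ) := by rw [hQ, Matrix.mul_one]
        _ = (((Q⁻¹ : GL n ℂ) : Matrix n n ℂ)ᵀ * (Q : Matrix n n ℂ)ᵀ) *
              ((Q : Matrix n n ℂ) * ((Q⁻¹ : GL n ℂ) : Matrix n n ℂ)) := by
            simp only [Matrix.mul_assoc]
        _ = 1 := by rw [h1, h2, Matrix.mul_one]
    · calc ((Q⁻¹ : GL n ℂ) : Matrix n n ℂ)ᵀ * M * ((Q⁻¹ : GL n ℂ) : Matrix n n ℂ)
          = ((Q⁻¹ : GL n ℂ) : Matrix n n ℂ)ᵀ * ((Q : Matrix n n ℂ)ᵀ * M * (Q : Matrix n n ℂ)) *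
              ((Q⁻¹ : GL n ℂ) : Matrix n n ℂ) := by rw [hQ']
        _ = (((Q⁻¹ : GL n ℂ) : Matrix n n ℂ)ᵀ * (Q : Matrix n n ℂ)ᵀ) * M *
              ((Q : Matrix n n ℂ) * ((Q⁻¹ : GL n ℂ) : Matrix n n ℂ)) := by
            simp only [Matrix.mul_assoc]
        _ = M := by rw [h1, h2, Matrix.mul_one, Matrix.one_mul]

/-- Conjugacy of two sets of invertible matrices (indexed by possibly different index sets of the
same size) by an invertible matrix: `G = P H P⁻¹`, with `P' = P⁻¹`. -/
def AreConjugate {I J : Type*} [Fintype I] [DecidableEq I] [Fintype J] [DecidableEq J]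
    (G : Set (GL I ℂ)) (H : Set (GL J ℂ)) : Prop :=
  ∃ (P : Matrix I J ℂ) (P' : Matrix J I ℂ), P * P' = 1 ∧ P' * P = 1 ∧
    ∀ Q : GL I ℂ, Q ∈ G ↔ ∃ Y ∈ H, (Q : Matrix I I ℂ) = P * (Y : Matrix J J ℂ) * P'

/-- `G` is a complex matrix Lie group of complex dimension `d`: it is closed in `GL`, and its Lie
algebra `{A | exp (t A) ∈ G for all real t}` is a complex subspace of dimension `d`. -/
def HasComplexLieDim {n : Type*} [Fintype n] [DecidableEq n] (G : Subgroup (GL n ℂ)) (d : ℕ) :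
    Prop :=
  IsClosed (G : Set (GL n ℂ)) ∧
    ∃ 𝔤 : Submodule ℂ (Matrix n n ℂ),
      (∀ A : Matrix n n ℂ, A ∈ 𝔤 ↔
        ∀ t : ℝ, ∃ Q ∈ G, (Q : Matrix n n ℂ) = NormedSpace.exp ((t : ℂ) • A)) ∧
      Module.finrank ℂ 𝔤 = d

/-! ### The canonical blocks (all indices start at `0`) -/

/-- `M_m`: one half on the first upper diagonal, minus one half on the first lower diagonal. -/
def blockM (m : ℕ) : Matrix (Fin m) (Fin m) ℂ :=
  Matrix.of fun i j =>
    if i.val + 1 = j.val then 1 / 2 else if j.val + 1 = i.val then -1 / 2 else 0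

/-- `N_m(z)`: `(i/2) * 2z` on the anti-diagonal and `i/2` on the two neighbouring
anti-diagonals. -/
def blockN (m : ℕ) (z : ℂ) : Matrix (Fin m) (Fin m) ℂ :=
  Matrix.of fun i j =>
    if i.val + j.val + 1 = m then Complex.I / 2 * (2 * z)
    else if i.val + j.val + 2 = m ∨ i.val + j.val = m then Complex.I / 2 else 0

/-- `K_m(z)`, a skew-symmetric matrix of size `2m` with Jordan form `J_m(z) ⊕ J_m(-z)`. -/
def blockK (m : ℕ) (z : ℂ) : Matrix (Fin m ⊕ Fin m) (Fin m ⊕ Fin m) ℂ :=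
  Matrix.fromBlocks (blockM m) (blockN m z) (-(blockN m z)) (-(blockM m))

/-- `L_n` for odd `n = 2m - 1`, a skew-symmetric matrix with Jordan form `J_n(0)`. The real part has
entries `1/2` at the first `m - 1 = n / 2` places of the first upper diagonal and `-1/2` at the
other ones, continued skew-symmetrically; the imaginary part has, on the two anti-diagonals next to
the main anti-diagonal, `1/2` strictly above the main diagonal and `-1/2` strictly below it. -/
def blockL (n : ℕ) : Matrix (Fin n) (Fin n) ℂ :=
  Matrix.of fun i j =>
    (if i.val + 1 = j.val then (if i.val < n / 2 then 1 / 2 else -1 / 2)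
      else if j.val + 1 = i.val then (if j.val < n / 2 then -1 / 2 else 1 / 2) else 0) +
    Complex.I * (if i.val + j.val + 2 = n ∨ i.val + j.val = n then
      (if i.val < j.val then 1 / 2 else -1 / 2) else 0)

/-- The size of `K̃_a`: it is `2a` for even `a` and `a` for odd `a`. -/
def sizeKt (a : ℕ) : ℕ := if Even a then a + a else a

theorem sizeKt_even {a : ℕ} (h : Even a) : sizeKt a = a + a := by simp [sizeKt, h]

theorem sizeKt_odd {a : ℕ} (h : ¬ Even a) : sizeKt a = a := by simp [sizeKt, h]

/-- `K̃_a` is `K_a(0)` for even `a` and `L_a` for odd `a`. -/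
def blockKt (a : ℕ) : Matrix (Fin (sizeKt a)) (Fin (sizeKt a)) ℂ :=
  if h : Even a then
    (blockK a 0).submatrix (fun i => finSumFinEquiv.symm (Fin.cast (sizeKt_even h) i))
      (fun i => finSumFinEquiv.symm (Fin.cast (sizeKt_even h) i))
  else (blockL a).submatrix (Fin.cast (sizeKt_odd h)) (Fin.cast (sizeKt_odd h))

/-- Index set of `𝒦_z`, `z ≠ 0`: the block `r`, the position in a copy of `K_{α_r}(z)`, and the
number of the copy. -/
abbrev FormIdx {N : ℕ} (α m : Fin N → ℕ) : Type :=
  (r : Fin N) × ((Fin (α r) ⊕ Fin (α r)) × Fin (m r))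

/-- `𝒦_z`, the direct sum over `r` of `m_r` copies of `K_{α_r}(z)`. -/
def formK {N : ℕ} (α m : Fin N → ℕ) (z : ℂ) : Matrix (FormIdx α m) (FormIdx α m) ℂ :=
  Matrix.blockDiagonal' fun r => Matrix.blockDiagonal fun _ : Fin (m r) => blockK (α r) z

/-- Index set of `𝒦_0`. -/
abbrev FormZeroIdx {N : ℕ} (α m : Fin N → ℕ) : Type :=
  (r : Fin N) × (Fin (sizeKt (α r)) × Fin (m r))

/-- `𝒦_0`, the direct sum over `r` of `m_r` copies of `K̃_{α_r}`. -/
def formKZero {N : ℕ} (α m : Fin N → ℕ) : Matrix (FormZeroIdx α m) (FormZeroIdx α m) ℂ :=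
  Matrix.blockDiagonal' fun r => Matrix.blockDiagonal fun _ : Fin (m r) => blockKt (α r)

/-! ### Block rectangular Toeplitz matrices -/

/-- Index set of the block matrices: the block `r`, the position `i < α_r` in the block, and the
position in the `m_r`-dimensional inner block. -/
abbrev BlockIdx {N : ℕ} (α m : Fin N → ℕ) : Type := (r : Fin N) × (Fin (α r) × Fin (m r))

/-- The `a`-by-`b` block matrix with `p`-by-`q` blocks which equals `[0 T]` for `a < b`, `T` stacked
on top of `0` for `a > b`, and `T` for `a = b`, where `T = T(A 0, …, A (min a b - 1))` is upper
triangular Toeplitz: `A l` stands on the `l`-th upper diagonal of `T`. -/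
def rectToeplitz (a b : ℕ) {p q : ℕ} (A : ℕ → Matrix (Fin p) (Fin q) ℂ) :
    Matrix (Fin a × Fin p) (Fin b × Fin q) ℂ :=
  Matrix.of fun x y =>
    if x.1.val + (b - a) ≤ y.1.val then A (y.1.val - (x.1.val + (b - a))) x.2 y.2 else 0

/-- Families of coefficients `A r s j = A_j^{rs}`; only those with `j < min (α r) (α s)` matter. -/
abbrev Coeffs {N : ℕ} (m : Fin N → ℕ) : Type :=
  (r s : Fin N) → ℕ → Matrix (Fin (m r)) (Fin (m s)) ℂ

/-- The `N`-by-`N` block matrix with rectangular Toeplitz blocks built from the coefficients. -/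
def blockToeplitz {N : ℕ} (α : Fin N → ℕ) {m : Fin N → ℕ} (A : Coeffs m) :
    Matrix (BlockIdx α m) (BlockIdx α m) ℂ :=
  Matrix.of fun x y => rectToeplitz (α x.1) (α y.1) (A x.1 y.1) x.2 y.2

/-- `𝕋^{α,m}`: the nonsingular block rectangular Toeplitz matrices with nonsingular `A_0^{rr}`. -/
def toeplitzSet {N : ℕ} (α m : Fin N → ℕ) : Set (GL (BlockIdx α m) ℂ) :=
  {X | ∃ A : Coeffs m, (∀ r, IsUnit (A r r 0)) ∧
    (X : Matrix (BlockIdx α m) (BlockIdx α m) ℂ) = blockToeplitz α A}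

/-- The set of all `X ⊕ (X⁻¹)ᵀ` with `X ∈ 𝕋^{α,m}`. -/
def doubledToeplitzSet {N : ℕ} (α m : Fin N → ℕ) :
    Set (GL (BlockIdx α m ⊕ BlockIdx α m) ℂ) :=
  {Y | ∃ X ∈ toeplitzSet α m,
    (Y : Matrix (BlockIdx α m ⊕ BlockIdx α m) (BlockIdx α m ⊕ BlockIdx α m) ℂ) =
      Matrix.fromBlocks (X : Matrix (BlockIdx α m) (BlockIdx α m) ℂ) 0 0
        ((X⁻¹ : GL (BlockIdx α m) ℂ) : Matrix (BlockIdx α m) (BlockIdx α m) ℂ)ᵀ}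

/-- `m̃_r`: it is `2 m_r` for even `α_r` and `m_r` for odd `α_r`. -/
def mTilde {N : ℕ} (α m : Fin N → ℕ) : Fin N → ℕ :=
  fun r => if Even (α r) then 2 * m r else m r

/-- `B_r` for `a = α_r` and `n = m̃_r`: the direct sum of 2-by-2 blocks with rows `(0, -1)` and
`(1, 0)` for even `a`, and `(-1)^((a-1)/2)` times the identity for odd `a`. -/
def matB (a n : ℕ) : Matrix (Fin n) (Fin n) ℂ :=
  if Even a then
    Matrix.of fun i j =>
      if i.val + 1 = j.val ∧ Even i.val then -1
      else if j.val + 1 = i.val ∧ Even j.val then 1 else 0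
  else (-1 : ℂ) ^ ((a - 1) / 2) • (1 : Matrix (Fin n) (Fin n) ℂ)

/-! ### The conditions (I), (II), (III)

They are formulated for a set `𝕏` of block Toeplitz matrices and given matrices `B_r`. -/

/-- The variables of polynomials in the entries of the coefficients `A_j^{rs}`: the variable
`⟨r, s, j, a, b⟩` stands for the entry `(a, b)` of `A_j^{rs}`. -/
abbrev CoeffVar {N : ℕ} (m : Fin N → ℕ) : Type :=
  (r : Fin N) × (s : Fin N) × (ℕ × Fin (m r) × Fin (m s))

/-- The point at which the polynomials in the entries of the coefficients are evaluated. -/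
def coeffPoint {N : ℕ} {m : Fin N → ℕ} (A : Coeffs m) : CoeffVar m → ℂ :=
  fun v => A v.1 v.2.1 v.2.2.1 v.2.2.2.1 v.2.2.2.2

/-- The entries of the blocks strictly below the block diagonal: `A_j^{rs}`, `r > s`, `j < α_r`. -/
def belowVars {N : ℕ} (α m : Fin N → ℕ) : Set (CoeffVar m) :=
  {v | v.2.1 < v.1 ∧ v.2.2.1 < α v.1}

/-- The entries of the diagonal blocks: `A_j^{rr}`, `j < α_r`. -/
def diagVars {N : ℕ} (α m : Fin N → ℕ) : Set (CoeffVar m) :=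
  {v | v.1 = v.2.1 ∧ v.2.2.1 < α v.1}

/-- The entries of `A_{j'}^{r'r'}` with `j' < j` and `r' ≤ r`. -/
def diagVarsBefore {N : ℕ} (α m : Fin N → ℕ) (r : Fin N) (j : ℕ) : Set (CoeffVar m) :=
  {v | v ∈ diagVars α m ∧ v.1 ≤ r ∧ v.2.2.1 < j}

/-- The conditions (I)–(III). The coefficients `A_j^{rs}` with `r > s` are free, `A_0^{rr}` runs over
all `B_r`-pseudo-orthogonal matrices, the matrices `Z_j^r` of the prescribed symmetry are arbitrary,
and everything else is obtained recursively: `A_j^{rr} = A_0^{rr} B_r⁻¹ Z_j^r + D_j^r` for `j ≥ 1`,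
with `D_j^r` polynomial in the entries of `A_{j'}^{r'r'}`, `j' < j`, `r' ≤ r`, and of the blocks below
the diagonal, and `A_j^{rs} = E_j^{rs}` for `r < s`, with `E_j^{rs}` polynomial in the entries of the
blocks on and below the diagonal. The equivalence says that all block Toeplitz matrices obtained in
this way, and no other ones, belong to `𝕏`. -/
def SatisfiesConditions {N : ℕ} (α : Fin N → ℕ) {m : Fin N → ℕ}
    (B : (r : Fin N) → Matrix (Fin (m r)) (Fin (m r)) ℂ) (𝕏 : Set (GL (BlockIdx α m) ℂ)) : Prop :=
  ∃ (D : (r : Fin N) → ℕ → Fin (m r) → Fin (m r) → MvPolynomial (CoeffVar m) ℂ)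
    (E : (r s : Fin N) → ℕ → Fin (m r) → Fin (m s) → MvPolynomial (CoeffVar m) ℂ),
    (∀ r j a b, D r j a b ∈
      MvPolynomial.supported ℂ (belowVars α m ∪ diagVarsBefore α m r j)) ∧
    (∀ r s j a b, E r s j a b ∈
      MvPolynomial.supported ℂ (belowVars α m ∪ diagVars α m)) ∧
    ∀ A : Coeffs m,
      (∃ X ∈ 𝕏, (X : Matrix (BlockIdx α m) (BlockIdx α m) ℂ) = blockToeplitz α A) ↔
        (∀ r, (A r r 0)ᵀ * B r * A r r 0 = B r) ∧
        (∀ r j, 1 ≤ j → j < α r →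
          ∃ Z : Matrix (Fin (m r)) (Fin (m r)) ℂ, Z = (-1 : ℂ) ^ (α r + j) • Zᵀ ∧
            A r r j = A r r 0 * (B r)⁻¹ * Z +
              Matrix.of fun a b => MvPolynomial.eval (coeffPoint A) (D r j a b)) ∧
        (∀ r s, r < s → ∀ j, j < α s →
          A r s j = Matrix.of fun a b => MvPolynomial.eval (coeffPoint A) (E r s j a b))

/-! ### The subgroups `𝕆` and `𝕍` -/

/-- All matrices `⊕_r (Q_r ⊕ ⋯ ⊕ Q_r)` (`α_r` summands `Q_r`) with `Q_r` pseudo-orthogonal with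
respect to `B_r`. -/
def pseudoOrthogonalSet {N : ℕ} (α : Fin N → ℕ) {m : Fin N → ℕ}
    (B : (r : Fin N) → Matrix (Fin (m r)) (Fin (m r)) ℂ) : Set (GL (BlockIdx α m) ℂ) :=
  {X | ∃ Q : (r : Fin N) → Matrix (Fin (m r)) (Fin (m r)) ℂ,
    (∀ r, (Q r)ᵀ * B r * Q r = B r) ∧
    (X : Matrix (BlockIdx α m) (BlockIdx α m) ℂ) =
      Matrix.blockDiagonal' fun r => Matrix.kronecker (1 : Matrix (Fin (α r)) (Fin (α r)) ℂ) (Q r)}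

/-- The generators `𝒲 = ⊕_r T(1, W_1^r, …, W_{α_r-1}^r)`. -/
def diagonalGenerators {N : ℕ} (α : Fin N → ℕ) {m : Fin N → ℕ}
    (B : (r : Fin N) → Matrix (Fin (m r)) (Fin (m r)) ℂ) : Set (GL (BlockIdx α m) ℂ) :=
  {X | ∃ Z W : (r : Fin N) → ℕ → Matrix (Fin (m r)) (Fin (m r)) ℂ,
    (∀ r j, 1 ≤ j → j < α r → Z r j = (-1 : ℂ) ^ (α r + j) • (Z r j)ᵀ) ∧
    (∀ r, W r 0 = 1) ∧
    (∀ r j, 1 ≤ j → j < α r →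
      W r j = (B r)⁻¹ * (Z r j - (1 / 2 : ℂ) •
        ∑ k ∈ Finset.Ico 1 j, (-1 : ℂ) ^ k • ((W r k)ᵀ * B r * W r (j - k)))) ∧
    (X : Matrix (BlockIdx α m) (BlockIdx α m) ℂ) =
      Matrix.blockDiagonal' fun r => rectToeplitz (α r) (α r) (W r)}

/-- The numbers `a_n = - binom(2n, n) / (2^(2n+1) (n+1))`, for which
`√(1 - y) = 1 + ∑_{n ≥ 1} a_{n-1} y^n`. -/
def sqrtCoeff (n : ℕ) : ℂ := -((Nat.choose (2 * n) n : ℂ) / (2 ^ (2 * n + 1) * ((n : ℂ) + 1)))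

/-- The generators which differ from the identity only in the blocks with both indices in `{p, t}`,
where `p < t`: the Toeplitz block at `(t, p)` has `F` on its `k`-th upper diagonal and zeros
otherwise, and the other three blocks are determined by `F`. -/
def offDiagonalGenerators {N : ℕ} (α : Fin N → ℕ) {m : Fin N → ℕ}
    (B : (r : Fin N) → Matrix (Fin (m r)) (Fin (m r)) ℂ) : Set (GL (BlockIdx α m) ℂ) :=
  {X | ∃ (p t : Fin N) (k : ℕ) (F : Matrix (Fin (m t)) (Fin (m p)) ℂ) (A : Coeffs m),
    p < t ∧ k < α t ∧
    (∀ r s, ¬ ((r = p ∨ r = t) ∧ (s = p ∨ s = t)) → r ≠ s → ∀ j, A r s j = 0) ∧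
    (∀ r, r ≠ p → r ≠ t → A r r 0 = 1 ∧ ∀ j, 1 ≤ j → A r r j = 0) ∧
    (∀ j, A t p j = if j = k then F else 0) ∧
    (∀ j, A p t j = if j = k then (-1 : ℂ) ^ (k + 1) • ((B p)⁻¹ * Fᵀ * B t) else 0) ∧
    A p p 0 = 1 ∧ A t t 0 = 1 ∧
    (∀ n, 1 ≤ n → A p p (n * (2 * k + (α p - α t))) =
      ((-1 : ℂ) ^ (k * n) * sqrtCoeff (n - 1)) •
        ((B p)⁻¹ * (Fᵀ * B t * F * (B p)⁻¹) ^ n * B p)) ∧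
    (∀ n, 1 ≤ n → A t t (n * (2 * k + (α p - α t))) =
      ((-1 : ℂ) ^ (k * n) * sqrtCoeff (n - 1)) •
        ((B t)⁻¹ * (B t * F * (B p)⁻¹ * Fᵀ) ^ n * B t)) ∧
    (∀ j, (¬ ∃ n, j = n * (2 * k + (α p - α t))) → A p p j = 0 ∧ A t t j = 0) ∧
    (X : Matrix (BlockIdx α m) (BlockIdx α m) ℂ) = blockToeplitz α A}

/-- `𝕏 = 𝕆 ⋉ 𝕍` as an internal semidirect product: `𝕆` and `𝕍` are subgroups of `𝕏`, `𝕍` is normal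
in `𝕏`, and every element of `𝕏` is in a unique way a product of elements of `𝕆` and `𝕍`. -/
def IsInternalSemidirect {G : Type*} [Group G] (𝕏 𝕆 𝕍 : Subgroup G) : Prop :=
  𝕆 ≤ 𝕏 ∧ 𝕍 ≤ 𝕏 ∧ (𝕍.subgroupOf 𝕏).Normal ∧
    (𝕆.subgroupOf 𝕏).IsComplement' (𝕍.subgroupOf 𝕏)

end

/-! In bases adapted to the nilpotent part of the normal form, everything reduces to matrices that
commute with the nilpotent matrix `blockShift`; these are exactly the block Toeplitz matrices
(`commute_blockShift_iff`).

Nonzero eigenvalue. The generalized eigenspaces of `K_a(z)` for `z` and `-z` are isotropic and dual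
to each other under the standard bilinear form (`isIsotropicPair_blockK`). An orthogonal matrix
commuting with the direct sum cannot mix them, because `z ≠ -z` (Sylvester), so it has the form `X ⊕
X⁻ᵀ` with `X` in the commutant of the shift. The same argument applies to the exponential when `exp
z ≠ exp (-z)`. Passing to the exponential does not enlarge the commutant of a nilpotent matrix
(`commute_of_commute_exp`), so nothing is gained or lost.

Zero eigenvalue. There is a basis in which the normal form acts by the shift `J` and the standard
bilinear form has Gram matrix `H = ⊕ F_{α_r} ⊗ B_r`, where `F` is an alternating anti-diagonal
matrix (`exists_isAdaptedBasis_formKZero`). The isotropy group becomes the group of block Toeplitz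
`X` with `Xᵀ H X = H`. Since `J` is skew for `H`, the matrix `G = Xᵀ H X` satisfies `Jᵀ G = -G J`;
it is also symmetric. Hence only the last row of each block on or above the block diagonal carries
information (`blockToeplitz_form_eq_iff`). In the equation at position `(r, s, q)` with `r < s` the
unknown `A_q^{rs}` occurs linearly, with the invertible factor `(A_0^{rr})ᵀ B_r`. For `r = s` and `q
> 0` it occurs together with its transpose, which leaves a matrix of prescribed symmetry free. The
remaining unknowns come earlier when ordered by `q` and then by `s - r`, so the equations are solved
recursively by polynomials; this gives (I)–(III).

Semidirect product. With the weight `2i - α_r` on the basis, `A_j^{rs}` has degree `2j + |α_r -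
α_s|`. As the sizes are distinct, only the `A_0^{rr}` have degree zero: they give `𝕆`, and `𝕍`
consists of the `X` for which `X - 1` has positive degree. The lowest degree part of such an `X - 1`
solves the linearized form equation (`leading_lie_eq`). Its solutions split into diagonal blocks and
pairs `(p, t)`, and each summand is the leading part of a generator. Dividing by generators raises
the degree, which is bounded, so the process ends. That the off-diagonal generators preserve the
form rests on `(√(1 - y))² = 1 - y`.

Dimensions. The Lie algebra is given by linear equations in the same coordinates: blocks below the
diagonal are free, those above are determined, and `B_r A_q^{rr}` is symmetric or skew depending on
parity. -/

noncomputable section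

/-! ### The shift, the alternating flip and block Kronecker products -/

/-- The nilpotent upper shift. -/
def shiftMat (a : ℕ) : Matrix (Fin a) (Fin a) ℂ :=
  Matrix.of fun i j => if i.val + 1 = j.val then 1 else 0

/-- The anti-diagonal matrix with alternating signs; the sign is `+` in the bottom row. -/
def signedFlip (a : ℕ) : Matrix (Fin a) (Fin a) ℂ :=
  Matrix.of fun i j => if i.val + j.val + 1 = a then (-1) ^ j.val else 0

/-- The block diagonal matrix whose `r`-th block is `K r ⊗ G r`. -/
def blockKron {N : ℕ} {α m : Fin N → ℕ} (K : (r : Fin N) → Matrix (Fin (α r)) (Fin (α r)) ℂ)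
    (G : (r : Fin N) → Matrix (Fin (m r)) (Fin (m r)) ℂ) :
    Matrix (BlockIdx α m) (BlockIdx α m) ℂ :=
  Matrix.blockDiagonal' fun r => Matrix.kronecker (K r) (G r)

section blockKron

variable {N : ℕ} {α m : Fin N → ℕ} (K K' : (r : Fin N) → Matrix (Fin (α r)) (Fin (α r)) ℂ)
  (G G' : (r : Fin N) → Matrix (Fin (m r)) (Fin (m r)) ℂ)

theorem blockKron_mul :
    blockKron K G * blockKron K' G' = blockKron (fun r => K r * K' r) (fun r => G r * G' r) := by
  simp only [blockKron, ← Matrix.blockDiagonal'_mul]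
  congr 1; funext r
  exact (Matrix.mul_kronecker_mul _ _ _ _).symm

theorem blockKron_transpose :
    (blockKron K G)ᵀ = blockKron (fun r => (K r)ᵀ) (fun r => (G r)ᵀ) := by
  simp only [blockKron, Matrix.blockDiagonal'_transpose]
  congr 1

theorem blockKron_one :
    blockKron (fun r => (1 : Matrix (Fin (α r)) (Fin (α r)) ℂ))
      (fun r => (1 : Matrix (Fin (m r)) (Fin (m r)) ℂ)) = 1 := by
  simp only [blockKron, Matrix.kronecker]
  rw [← Matrix.blockDiagonal'_one]
  congr 1; funext r
  exact Matrix.one_kronecker_one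

theorem blockKron_mul_apply {I : Type*} (X : Matrix (BlockIdx α m) I ℂ) (r : Fin N)
    (i : Fin (α r)) (c : Fin (m r)) (z : I) :
    (blockKron K G * X) ⟨r, i, c⟩ z = ∑ l, K r i l * ∑ d, G r c d * X ⟨r, l, d⟩ z := by
  rw [Matrix.mul_apply, Fintype.sum_sigma, Finset.sum_eq_single r]
  · rw [Fintype.sum_prod_type]
    refine Finset.sum_congr rfl fun l _ => ?_
    rw [Finset.mul_sum]
    refine Finset.sum_congr rfl fun d _ => ?_
    simp [blockKron, Matrix.blockDiagonal'_apply_eq, Matrix.kroneckerMap_apply, mul_assoc]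
  · intro s _ hs
    refine Finset.sum_eq_zero fun l _ => ?_
    simp [blockKron, Matrix.blockDiagonal'_apply_ne _ _ _ (Ne.symm hs)]
  · simp

theorem mul_blockKron_apply {I : Type*} (X : Matrix I (BlockIdx α m) ℂ) (r : Fin N)
    (i : Fin (α r)) (c : Fin (m r)) (z : I) :
    (X * blockKron K G) z ⟨r, i, c⟩ = ∑ l, K r l i * ∑ d, X z ⟨r, l, d⟩ * G r d c := by
  rw [Matrix.mul_apply, Fintype.sum_sigma, Finset.sum_eq_single r]
  · rw [Fintype.sum_prod_type]
    refine Finset.sum_congr rfl fun l _ => ?_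
    rw [Finset.mul_sum]
    refine Finset.sum_congr rfl fun d _ => ?_
    simp [blockKron, Matrix.blockDiagonal'_apply_eq, Matrix.kroneckerMap_apply]; ring
  · intro s _ hs
    refine Finset.sum_eq_zero fun l _ => ?_
    simp [blockKron, Matrix.blockDiagonal'_apply_ne _ _ _ hs]
  · simp

end blockKron

/-- The nilpotent matrix which acts as the shift on every block. -/
def blockShift {N : ℕ} (α m : Fin N → ℕ) : Matrix (BlockIdx α m) (BlockIdx α m) ℂ :=
  blockKron (fun r => shiftMat (α r)) fun _ => 1

/-- The Gram matrix of the bilinear form on the block space determined by the `B r`. -/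
def formMat {N : ℕ} (α : Fin N → ℕ) {m : Fin N → ℕ}
    (B : (r : Fin N) → Matrix (Fin (m r)) (Fin (m r)) ℂ) :
    Matrix (BlockIdx α m) (BlockIdx α m) ℂ :=
  blockKron (fun r => signedFlip (α r)) B

theorem shiftMat_apply {a : ℕ} (i j : Fin a) :
    shiftMat a i j = if i.val + 1 = j.val then 1 else 0 := rfl

theorem signedFlip_apply {a : ℕ} (i j : Fin a) :
    signedFlip a i j = if i.val + j.val + 1 = a then (-1) ^ j.val else 0 := rfl

section shift

variable {N : ℕ} {α m : Fin N → ℕ} {I : Type*}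

theorem blockShift_mul_apply_succ (X : Matrix (BlockIdx α m) I ℂ) (r : Fin N) (i : ℕ)
    (hi : i + 1 < α r) (c : Fin (m r)) (z : I) :
    (blockShift α m * X) ⟨r, ⟨i, by omega⟩, c⟩ z = X ⟨r, ⟨i + 1, hi⟩, c⟩ z := by
  rw [blockShift, blockKron_mul_apply, Finset.sum_eq_single ⟨i + 1, hi⟩]
  · simp [shiftMat_apply, Matrix.one_apply]
  · intro l _ hl
    rw [shiftMat_apply, if_neg, zero_mul]
    intro h; exact hl (Fin.ext h.symm)
  · simp

theorem blockShift_mul_apply_last (X : Matrix (BlockIdx α m) I ℂ) (r : Fin N) (i : ℕ)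
    (hi : i + 1 = α r) (c : Fin (m r)) (z : I) :
    (blockShift α m * X) ⟨r, ⟨i, by omega⟩, c⟩ z = 0 := by
  rw [blockShift, blockKron_mul_apply]
  refine Finset.sum_eq_zero fun l _ => ?_
  rw [shiftMat_apply, if_neg, zero_mul]
  have := l.2
  simp only; omega

theorem mul_blockShift_apply_succ (X : Matrix I (BlockIdx α m) ℂ) (r : Fin N) (i : ℕ)
    (hi : i + 1 < α r) (c : Fin (m r)) (z : I) :
    (X * blockShift α m) z ⟨r, ⟨i + 1, hi⟩, c⟩ = X z ⟨r, ⟨i, by omega⟩, c⟩ := by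
  rw [blockShift, mul_blockKron_apply, Finset.sum_eq_single ⟨i, by omega⟩]
  · simp [shiftMat_apply, Matrix.one_apply]
  · intro l _ hl
    rw [shiftMat_apply, if_neg, zero_mul]
    intro h; exact hl (Fin.ext (by simpa using h))
  · simp

theorem mul_blockShift_apply_zero (X : Matrix I (BlockIdx α m) ℂ) (r : Fin N)
    (hi : 0 < α r) (c : Fin (m r)) (z : I) :
    (X * blockShift α m) z ⟨r, ⟨0, hi⟩, c⟩ = 0 := by
  rw [blockShift, mul_blockKron_apply]
  refine Finset.sum_eq_zero fun l _ => ?_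
  rw [shiftMat_apply, if_neg, zero_mul]
  simp

end shift

/-! ### The commutant of the shift: block Toeplitz matrices -/

section blockToeplitz

variable {N : ℕ} {α m : Fin N → ℕ}

theorem blockToeplitz_apply (A : Coeffs m) (r s : Fin N) (i : Fin (α r)) (j : Fin (α s))
    (c : Fin (m r)) (d : Fin (m s)) :
    blockToeplitz α A ⟨r, i, c⟩ ⟨s, j, d⟩ =
      if i.val + (α s - α r) ≤ j.val then A r s (j.val - (i.val + (α s - α r))) c d else 0 := rfl

theorem blockToeplitz_commute_blockShift (A : Coeffs m) :
    blockToeplitz α A * blockShift α m = blockShift α m * blockToeplitz α A := by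
  ext ⟨r, ⟨i, hi⟩, c⟩ ⟨s, ⟨j, hj⟩, d⟩
  rcases j with _ | j
  · rw [mul_blockShift_apply_zero]
    by_cases h : i + 1 < α r
    · rw [blockShift_mul_apply_succ _ _ _ h, blockToeplitz_apply, if_neg]
      simp
    · rw [blockShift_mul_apply_last _ _ _ (by omega)]
  · rw [mul_blockShift_apply_succ]
    by_cases h : i + 1 < α r
    · rw [blockShift_mul_apply_succ _ _ _ h, blockToeplitz_apply, blockToeplitz_apply]
      simp only
      congr 1
      · simp; omega
      · congr 1; omega
    · rw [blockShift_mul_apply_last _ _ _ (by omega), blockToeplitz_apply, if_neg]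
      simp only; omega

/-- The coefficients of a matrix commuting with the shift, read off the first rows. -/
def coeffsOf (X : Matrix (BlockIdx α m) (BlockIdx α m) ℂ) : Coeffs m := fun r s j =>
  Matrix.of fun c d => if h : 0 < α r ∧ j + (α s - α r) < α s then
    X ⟨r, ⟨0, h.1⟩, c⟩ ⟨s, ⟨j + (α s - α r), h.2⟩, d⟩ else 0

/-- Comparing entries of the two products shows that each block is constant along its diagonals,
vanishes in the first column below the top row, and vanishes in the last row to the left of the last
column. Every entry can be slid along its diagonal to one of these borders. -/
theorem eq_blockToeplitz_coeffsOf {X : Matrix (BlockIdx α m) (BlockIdx α m) ℂ}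
    (h : X * blockShift α m = blockShift α m * X) : X = blockToeplitz α (coeffsOf X) := by
  have hstep : ∀ (r s : Fin N) (i j : ℕ) (hi : i + 1 < α r) (hj : j + 1 < α s) (c : Fin (m r))
      (d : Fin (m s)), X ⟨r, ⟨i + 1, hi⟩, c⟩ ⟨s, ⟨j + 1, hj⟩, d⟩ =
        X ⟨r, ⟨i, by omega⟩, c⟩ ⟨s, ⟨j, by omega⟩, d⟩ := by
    intro r s i j hi hj c d
    rw [← mul_blockShift_apply_succ X s j hj, h, blockShift_mul_apply_succ _ _ _ hi]
  have hzero : ∀ (r s : Fin N) (i : ℕ) (hi : i + 1 < α r) (hj : 0 < α s) (c : Fin (m r))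
      (d : Fin (m s)), X ⟨r, ⟨i + 1, hi⟩, c⟩ ⟨s, ⟨0, hj⟩, d⟩ = 0 := by
    intro r s i hi hj c d
    rw [← blockShift_mul_apply_succ X r i hi, ← h, mul_blockShift_apply_zero]
  have hlast : ∀ (r s : Fin N) (i j : ℕ) (hi : i + 1 = α r) (hj : j + 1 < α s) (c : Fin (m r))
      (d : Fin (m s)), X ⟨r, ⟨i, by omega⟩, c⟩ ⟨s, ⟨j, by omega⟩, d⟩ = 0 := by
    intro r s i j hi hj c d
    rw [← mul_blockShift_apply_succ X s j hj, h, blockShift_mul_apply_last _ _ _ hi]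
  have hdiag : ∀ (k : ℕ) (r s : Fin N) (i j : ℕ) (hi : i + k < α r) (hj : j + k < α s)
      (c : Fin (m r)) (d : Fin (m s)), X ⟨r, ⟨i + k, hi⟩, c⟩ ⟨s, ⟨j + k, hj⟩, d⟩ =
        X ⟨r, ⟨i, by omega⟩, c⟩ ⟨s, ⟨j, by omega⟩, d⟩ := by
    intro k
    induction k with
    | zero => intros; rfl
    | succ k ih =>
      intro r s i j hi hj c d
      exact (hstep r s (i + k) (j + k) hi hj c d).trans (ih r s i j _ _ c d)
  ext ⟨r, ⟨i, hi⟩, c⟩ ⟨s, ⟨j, hj⟩, d⟩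
  rw [blockToeplitz_apply]
  simp only
  split_ifs with hij
  -- Inside the Toeplitz triangle: slide up to the first row, where the coefficients are read off.
  · have h1 : j - (i + (α s - α r)) + (α s - α r) + i = j := by omega
    have := hdiag i r s 0 (j - (i + (α s - α r)) + (α s - α r)) (by omega) (by omega) c d
    simp only [coeffsOf, Matrix.of_apply]
    rw [dif_pos ⟨by omega, by omega⟩, ← this]
    simp only [h1, zero_add]
  -- Outside the triangle: slide up to the first column if `j < i`; otherwise slide down to the last
  -- row, which is reached before the last column.
  · by_cases hji : j < i
    · have := hdiag j r s (i - j - 1 + 1) 0 (by omega) (by omega) c d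
      rw [hzero] at this
      have h1 : i - j - 1 + 1 + j = i := by omega
      simpa only [h1, zero_add] using this
    · have := hdiag (α r - 1 - i) r s i j (by omega) (by omega) c d
      rw [← this]
      have h1 : i + (α r - 1 - i) = α r - 1 := by omega
      simp only [h1]
      exact hlast r s _ _ (by omega) (by omega) c d

theorem commute_blockShift_iff {X : Matrix (BlockIdx α m) (BlockIdx α m) ℂ} :
    X * blockShift α m = blockShift α m * X ↔ ∃ A, X = blockToeplitz α A :=
  ⟨fun h => ⟨_, eq_blockToeplitz_coeffsOf h⟩, by
    rintro ⟨A, rfl⟩; exact blockToeplitz_commute_blockShift A⟩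

theorem coeffsOf_blockToeplitz (A : Coeffs m) (hpos : ∀ r, 0 < α r) (r s : Fin N) (j : ℕ)
    (hr : j < α r) (hs : j < α s) : coeffsOf (blockToeplitz α A) r s j = A r s j := by
  ext c d
  simp only [coeffsOf, Matrix.of_apply]
  rw [dif_pos ⟨hpos r, by omega⟩, blockToeplitz_apply]
  simp

theorem blockToeplitz_eq_iff (hpos : ∀ r, 0 < α r) {A A' : Coeffs m} :
    blockToeplitz α A = blockToeplitz α A' ↔
      ∀ r s j, j < α r → j < α s → A r s j = A' r s j := by
  constructor
  · intro h r s j hr hs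
    rw [← coeffsOf_blockToeplitz A hpos r s j hr hs, h, coeffsOf_blockToeplitz A' hpos r s j hr hs]
  · intro h
    ext ⟨r, ⟨i, hi⟩, c⟩ ⟨s, ⟨j, hj⟩, d⟩
    rw [blockToeplitz_apply, blockToeplitz_apply]
    simp only
    split_ifs with hij
    · rw [h] <;> omega
    · rfl

theorem blockToeplitz_add (A A' : Coeffs m) :
    blockToeplitz α (A + A') = blockToeplitz α A + blockToeplitz α A' := by
  ext ⟨r, i, c⟩ ⟨s, j, d⟩
  simp only [Matrix.add_apply, blockToeplitz_apply, Pi.add_apply]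
  split_ifs <;> simp

theorem blockToeplitz_zero : blockToeplitz α (0 : Coeffs m) = 0 := by
  ext ⟨r, i, c⟩ ⟨s, j, d⟩
  simp [blockToeplitz_apply]

theorem blockToeplitz_sub (A A' : Coeffs m) :
    blockToeplitz α (A - A') = blockToeplitz α A - blockToeplitz α A' := by
  ext ⟨r, i, c⟩ ⟨s, j, d⟩
  simp only [Matrix.sub_apply, blockToeplitz_apply, Pi.sub_apply]
  split_ifs <;> simp

theorem blockToeplitz_sum {ι : Type*} (S : Finset ι) (A : ι → Coeffs m) :
    blockToeplitz α (∑ i ∈ S, A i) = ∑ i ∈ S, blockToeplitz α (A i) := by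
  classical
  induction S using Finset.induction_on with
  | empty => simp [blockToeplitz_zero]
  | insert a S ha ih => rw [Finset.sum_insert ha, Finset.sum_insert ha, blockToeplitz_add, ih]

/-- Coefficients of a block diagonal block Toeplitz matrix. -/
def diagCoeffs (W : (r : Fin N) → ℕ → Matrix (Fin (m r)) (Fin (m r)) ℂ) : Coeffs m :=
  fun r s j => if h : r = s then h ▸ W r j else 0

@[simp] theorem diagCoeffs_self (W : (r : Fin N) → ℕ → Matrix (Fin (m r)) (Fin (m r)) ℂ)
    (r : Fin N) (j : ℕ) : diagCoeffs W r r j = W r j := by simp [diagCoeffs]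

theorem diagCoeffs_ne (W : (r : Fin N) → ℕ → Matrix (Fin (m r)) (Fin (m r)) ℂ)
    {r s : Fin N} (h : r ≠ s) (j : ℕ) : diagCoeffs W r s j = 0 := by simp [diagCoeffs, h]

theorem blockToeplitz_diagCoeffs (W : (r : Fin N) → ℕ → Matrix (Fin (m r)) (Fin (m r)) ℂ) :
    blockToeplitz α (diagCoeffs W) =
      Matrix.blockDiagonal' fun r => rectToeplitz (α r) (α r) (W r) := by
  ext ⟨r, i, c⟩ ⟨s, j, d⟩
  rw [blockToeplitz_apply]
  by_cases h : r = s
  · subst h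
    rw [Matrix.blockDiagonal'_apply_eq]
    simp [rectToeplitz]
  · rw [Matrix.blockDiagonal'_apply_ne _ _ _ h, diagCoeffs_ne _ h]
    simp

theorem rectToeplitz_const (a : ℕ) {p : ℕ} (Q : Matrix (Fin p) (Fin p) ℂ) :
    rectToeplitz a a (fun j => if j = 0 then Q else 0) =
      Matrix.kronecker (1 : Matrix (Fin a) (Fin a) ℂ) Q := by
  ext ⟨i, c⟩ ⟨j, d⟩
  simp only [rectToeplitz, Matrix.of_apply, Nat.sub_self, add_zero, Matrix.kronecker,
    Matrix.kroneckerMap_apply, Matrix.one_apply]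
  by_cases h : i = j
  · subst h; simp
  · rw [if_neg h]
    have h' : (i : ℕ) ≠ j := fun e => h (Fin.ext e)
    split_ifs with h1 h2
    · omega
    · simp
    · simp

theorem blockToeplitz_diagCoeffs_const (Q : (r : Fin N) → Matrix (Fin (m r)) (Fin (m r)) ℂ) :
    blockToeplitz α (diagCoeffs fun r j => if j = 0 then Q r else 0) =
      Matrix.blockDiagonal' fun r =>
        Matrix.kronecker (1 : Matrix (Fin (α r)) (Fin (α r)) ℂ) (Q r) := by
  rw [blockToeplitz_diagCoeffs]
  congr 1; funext r; exact rectToeplitz_const _ _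

theorem blockToeplitz_diagCoeffs_one :
    blockToeplitz α (diagCoeffs (m := m) fun _ j => if j = 0 then 1 else 0) = 1 := by
  rw [blockToeplitz_diagCoeffs_const]; exact blockKron_one

end blockToeplitz

/-! ### The weight filtration -/

section filtration

variable {N : ℕ} {α m : Fin N → ℕ}

/-- The weight of a basis vector: the position in its block, centred and doubled. -/
def blockWeight (x : BlockIdx α m) : ℤ := 2 * (x.2.1.val : ℤ) - α x.1

/-- The matrix raises the weight by at least `d`. -/
def HasDegree (d : ℤ) (M : Matrix (BlockIdx α m) (BlockIdx α m) ℂ) : Prop :=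
  ∀ x y, M x y ≠ 0 → d ≤ blockWeight y - blockWeight x

namespace HasDegree

variable {d e : ℤ} {M M' : Matrix (BlockIdx α m) (BlockIdx α m) ℂ}

theorem zero : HasDegree d (0 : Matrix (BlockIdx α m) (BlockIdx α m) ℂ) := by
  intro x y h; simp at h

theorem one : HasDegree 0 (1 : Matrix (BlockIdx α m) (BlockIdx α m) ℂ) := by
  intro x y h
  have : x = y := by by_contra hne; exact h (Matrix.one_apply_ne hne)
  simp [this]

theorem add (h : HasDegree d M) (h' : HasDegree d M') : HasDegree d (M + M') := by
  intro x y hxy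
  by_cases h1 : M x y = 0
  · exact h' x y (by simpa [h1] using hxy)
  · exact h x y h1

theorem neg (h : HasDegree d M) : HasDegree d (-M) := by
  intro x y hxy
  exact h x y (by simpa using hxy)

theorem sub (h : HasDegree d M) (h' : HasDegree d M') : HasDegree d (M - M') := by
  rw [sub_eq_add_neg]; exact h.add h'.neg

theorem mono (h : HasDegree d M) (hde : e ≤ d) : HasDegree e M :=
  fun x y hxy => hde.trans (h x y hxy)

theorem mul (h : HasDegree d M) (h' : HasDegree e M') : HasDegree (d + e) (M * M') := by
  intro x z hxz
  rw [Matrix.mul_apply] at hxz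
  obtain ⟨y, -, hy⟩ := Finset.exists_ne_zero_of_sum_ne_zero hxz
  have h1 := h x y (left_ne_zero_of_mul hy)
  have h2 := h' y z (right_ne_zero_of_mul hy)
  linarith

theorem pow (h : HasDegree d M) (n : ℕ) : HasDegree (n * d) (M ^ n) := by
  induction n with
  | zero => simpa using one
  | succ n ih =>
    rw [pow_succ]
    have := ih.mul h
    push_cast
    rwa [add_mul, one_mul]

-- Only finitely many weights occur. This bound terminates all arguments that raise the degree step
-- by step.
variable (α m) in
theorem exists_eq_zero : ∃ n : ℕ, ∀ M : Matrix (BlockIdx α m) (BlockIdx α m) ℂ,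
    HasDegree n M → M = 0 := by
  obtain ⟨C, hC⟩ := (Set.finite_range fun p : BlockIdx α m × BlockIdx α m =>
    blockWeight p.2 - blockWeight p.1).bddAbove
  refine ⟨(C + 1).toNat, fun M hM => ?_⟩
  ext x y
  by_contra hxy
  have h1 := hM x y hxy
  have h2 : blockWeight y - blockWeight x ≤ C := hC ⟨(x, y), rfl⟩
  have := Int.self_le_toNat (C + 1)
  omega

theorem isNilpotent (h : HasDegree 1 M) : IsNilpotent M := by
  obtain ⟨n, hn⟩ := exists_eq_zero α m
  exact ⟨n, hn _ (by simpa using h.pow n)⟩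

end HasDegree

/-- The degree of the coefficient `A_j^{rs}`. -/
def coeffDegree (α : Fin N → ℕ) (r s : Fin N) (j : ℕ) : ℤ := 2 * (j : ℤ) + |(α r : ℤ) - α s|

/-- Every entry coming from `A_j^{rs}` raises the weight by exactly `coeffDegree α r s j`, whichever
of `α r`, `α s` is larger; the absolute value absorbs the offset of the rectangular blocks. The
degree of a block Toeplitz matrix is thus visible on its coefficients. -/
theorem hasDegree_blockToeplitz {A : Coeffs m} {d : ℤ}
    (h : ∀ r s j, j < α r → j < α s → coeffDegree α r s j < d → A r s j = 0) :
    HasDegree d (blockToeplitz α A) := by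
  rintro ⟨r, ⟨i, hi⟩, c⟩ ⟨s, ⟨j, hj⟩, e⟩ hne
  rw [blockToeplitz_apply] at hne
  simp only at hne
  split_ifs at hne with hij
  · by_contra hlt
    apply hne
    rw [h r s _ (by omega) (by omega)]
    · rfl
    · simp only [blockWeight] at hlt
      simp only [coeffDegree]
      rcases le_total (α r) (α s) with hrs | hrs
      · rw [abs_of_nonpos (by omega)]; omega
      · rw [abs_of_nonneg (by omega)]; omega
  · exact absurd rfl hne

theorem HasDegree.coeff_eq_zero {A : Coeffs m} {d : ℤ} (h : HasDegree d (blockToeplitz α A))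
    (r s : Fin N) (j : ℕ) (hr : j < α r) (hs : j < α s) (hd : coeffDegree α r s j < d) :
    A r s j = 0 := by
  ext c e
  by_contra hne
  have := h ⟨r, ⟨0, by omega⟩, c⟩ ⟨s, ⟨j + (α s - α r), by omega⟩, e⟩ (by
    rw [blockToeplitz_apply]; simpa using hne)
  simp only [blockWeight] at this
  simp only [coeffDegree] at hd
  rcases le_total (α r) (α s) with hrs | hrs
  · rw [abs_of_nonpos (by omega)] at hd; omega
  · rw [abs_of_nonneg (by omega)] at hd; omega

theorem hasDegree_zero_blockToeplitz (A : Coeffs m) : HasDegree 0 (blockToeplitz α A) :=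
  hasDegree_blockToeplitz fun r s j _ _ h => by
    simp only [coeffDegree] at h
    have := abs_nonneg ((α r : ℤ) - α s)
    omega

/-- The sizes `α r` are pairwise distinct, so `A_0^{rr}` are the only coefficients of degree zero.
-/
theorem hasDegree_one_blockToeplitz (hα : StrictAnti α) {A : Coeffs m}
    (h : ∀ r, A r r 0 = 0) : HasDegree 1 (blockToeplitz α A) :=
  hasDegree_blockToeplitz fun r s j _ _ hd => by
    simp only [coeffDegree] at hd
    have h0 := abs_nonneg ((α r : ℤ) - α s)
    have hj : j = 0 := by omega
    have h1 : |(α r : ℤ) - α s| = 0 := by omega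
    have hrs : r = s := hα.injective (by have := abs_eq_zero.mp h1; omega)
    subst hj hrs
    exact h r

end filtration

/-! ### The bilinear form and its automorphisms -/

section form

variable {N : ℕ} {α m : Fin N → ℕ} (B : (r : Fin N) → Matrix (Fin (m r)) (Fin (m r)) ℂ)

theorem formMat_mul_apply {I : Type*} (X : Matrix (BlockIdx α m) I ℂ) (r : Fin N)
    (i : Fin (α r)) (c : Fin (m r)) (z : I) :
    (formMat α B * X) ⟨r, i, c⟩ z = (-1) ^ i.rev.val * ∑ d, B r c d * X ⟨r, i.rev, d⟩ z := by
  rw [formMat, blockKron_mul_apply, Finset.sum_eq_single i.rev]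
  · rw [signedFlip_apply, if_pos]
    have := i.2
    simp only [Fin.val_rev]; omega
  · intro l _ hl
    rw [signedFlip_apply, if_neg, zero_mul]
    intro h; apply hl; apply Fin.ext
    simp only [Fin.val_rev]; omega
  · simp

theorem signedFlip_mul_transpose (a : ℕ) : signedFlip a * (signedFlip a)ᵀ = 1 := by
  ext i j
  rw [Matrix.mul_apply, Finset.sum_eq_single i.rev]
  · simp only [signedFlip_apply, Matrix.transpose_apply, Fin.val_rev, Matrix.one_apply, Fin.ext_iff]
    have := i.2
    have := j.2
    rw [if_pos (by omega)]
    split_ifs with h1 h2 h2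
    · rw [← pow_add, ← two_mul]; simp
    · omega
    · omega
    · simp
  · intro l _ hl
    rw [signedFlip_apply, if_neg, zero_mul]
    intro h; apply hl; apply Fin.ext
    simp only [Fin.val_rev]; omega
  · simp

/-- The signs alternate along the anti-diagonal, so moving by one row or by one column gives
opposite signs. This is skewness of the shift for the form, the counterpart of the skew symmetry of
the normal form. -/
theorem shiftMat_transpose_mul_signedFlip (a : ℕ) :
    (shiftMat a)ᵀ * signedFlip a = -(signedFlip a * shiftMat a) := by
  ext ⟨i, hi⟩ ⟨j, hj⟩
  rw [Matrix.mul_apply, Matrix.neg_apply, Matrix.mul_apply,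
    Finset.sum_eq_single (⟨a - 1 - j, by omega⟩ : Fin a),
    Finset.sum_eq_single (⟨a - 1 - i, by omega⟩ : Fin a)]
  · simp only [shiftMat_apply, signedFlip_apply, Matrix.transpose_apply]
    rw [if_pos (show a - 1 - j + j + 1 = a by omega), if_pos (show i + (a - 1 - i) + 1 = a by omega)]
    by_cases h : a - 1 - j + 1 = i
    · rw [if_pos h, if_pos (by omega), show j = a - 1 - i + 1 by omega]
      ring
    · rw [if_neg h, if_neg (by omega)]; simp
  · intro l _ hl
    rw [signedFlip_apply, if_neg, zero_mul]
    intro h; apply hl; apply Fin.ext; simp only at h ⊢; omega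
  · simp
  · intro l _ hl
    rw [signedFlip_apply, if_neg, mul_zero]
    intro h; apply hl; apply Fin.ext; simp only at h ⊢; omega
  · simp

theorem signedFlip_transpose (a : ℕ) : (signedFlip a)ᵀ = (-1 : ℂ) ^ (a + 1) • signedFlip a := by
  ext i j
  simp only [signedFlip_apply, Matrix.transpose_apply, Matrix.smul_apply, smul_eq_mul]
  by_cases h : j.val + i.val + 1 = a
  · rw [if_pos h, if_pos (by omega), ← pow_add,
      show a + 1 + j.val = i.val + 2 * (j.val + 1) by omega, pow_add, pow_mul]
    simp
  · rw [if_neg h, if_neg (by omega), mul_zero]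

theorem blockShift_transpose_mul_formMat :
    (blockShift α m)ᵀ * formMat α B = -(formMat α B * blockShift α m) := by
  rw [blockShift, formMat, blockKron_transpose, blockKron_mul, blockKron_mul]
  ext ⟨r, i, c⟩ ⟨s, j, d⟩
  by_cases h : r = s
  · subst h
    simp [blockKron, shiftMat_transpose_mul_signedFlip]
  · simp [blockKron, Matrix.blockDiagonal'_apply_ne _ _ _ h]

/-- The sign `(-1)^(α r + 1)` occurs once from the flip and once from `B r`, and cancels. -/
theorem formMat_transpose (hB : ∀ r, (B r)ᵀ = (-1 : ℂ) ^ (α r + 1) • B r) :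
    (formMat α B)ᵀ = formMat α B := by
  rw [formMat, blockKron_transpose]
  simp only [blockKron]
  congr 1; funext r
  rw [signedFlip_transpose, hB]
  ext ⟨i, c⟩ ⟨j, d⟩
  simp only [Matrix.kronecker, Matrix.kroneckerMap_apply, Matrix.smul_apply, smul_eq_mul]
  have : (-1 : ℂ) ^ (α r + 1) * (-1) ^ (α r + 1) = 1 := by
    rw [← mul_pow]; simp
  linear_combination signedFlip (α r) i j * B r c d * this

theorem formMat_mul_inv (hB : ∀ r, IsUnit (B r)) :
    formMat α B * blockKron (fun r => (signedFlip (α r))ᵀ) (fun r => (B r)⁻¹) = 1 := by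
  rw [formMat, blockKron_mul, ← blockKron_one]
  congr 1
  · funext r; exact signedFlip_mul_transpose _
  · funext r
    exact Matrix.mul_nonsing_inv _ ((Matrix.isUnit_iff_isUnit_det _).mp (hB r))

theorem isUnit_formMat (hB : ∀ r, IsUnit (B r)) : IsUnit (formMat α B) :=
  isUnit_iff_exists_inv.mpr ⟨_, formMat_mul_inv B hB⟩

/-- The group of automorphisms of the form given by `G` which commute with `J`. -/
def autGroup {I : Type*} [Fintype I] [DecidableEq I] (J G : Matrix I I ℂ) :
    Subgroup (GL I ℂ) where
  carrier := {X | (X : Matrix I I ℂ) * J = J * X ∧ (X : Matrix I I ℂ)ᵀ * G * X = G}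
  one_mem' := by simp
  mul_mem' := by
    rintro X Y ⟨hX, hX'⟩ ⟨hY, hY'⟩
    refine ⟨?_, ?_⟩
    · rw [Units.val_mul, Matrix.mul_assoc, hY, ← Matrix.mul_assoc, hX, Matrix.mul_assoc]
    · rw [Units.val_mul, Matrix.transpose_mul]
      calc _ = (Y : Matrix I I ℂ)ᵀ * ((X : Matrix I I ℂ)ᵀ * G * X) * Y := by
            simp only [Matrix.mul_assoc]
        _ = G := by rw [hX', hY']
  inv_mem' := by
    rintro X ⟨hX, hX'⟩
    have h1 : (X : Matrix I I ℂ) * ((X⁻¹ : GL I ℂ) : Matrix I I ℂ) = 1 := X.mul_inv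
    have h1' : ((X⁻¹ : GL I ℂ) : Matrix I I ℂ) * (X : Matrix I I ℂ) = 1 := X.inv_mul
    have h2 : ((X⁻¹ : GL I ℂ) : Matrix I I ℂ)ᵀ * (X : Matrix I I ℂ)ᵀ = 1 := by
      rw [← Matrix.transpose_mul, h1, Matrix.transpose_one]
    refine ⟨?_, ?_⟩
    · calc ((X⁻¹ : GL I ℂ) : Matrix I I ℂ) * J
          = ((X⁻¹ : GL I ℂ) : Matrix I I ℂ) * (J * X) * ((X⁻¹ : GL I ℂ) : Matrix I I ℂ) := by
            rw [Matrix.mul_assoc, Matrix.mul_assoc, h1, Matrix.mul_one]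
        _ = (((X⁻¹ : GL I ℂ) : Matrix I I ℂ) * X) * J * ((X⁻¹ : GL I ℂ) : Matrix I I ℂ) := by
            rw [← hX]; simp only [Matrix.mul_assoc]
        _ = _ := by rw [h1', Matrix.one_mul]
    · calc ((X⁻¹ : GL I ℂ) : Matrix I I ℂ)ᵀ * G * ((X⁻¹ : GL I ℂ) : Matrix I I ℂ)
          = (((X⁻¹ : GL I ℂ) : Matrix I I ℂ)ᵀ * (X : Matrix I I ℂ)ᵀ) * G *
              ((X : Matrix I I ℂ) * ((X⁻¹ : GL I ℂ) : Matrix I I ℂ)) := by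
            conv_lhs => rw [← hX']
            simp only [Matrix.mul_assoc]
        _ = G := by rw [h1, h2, Matrix.mul_one, Matrix.one_mul]

end form

/-! ### The Gram equations in terms of the Toeplitz coefficients -/

section formCoeff

variable {N : ℕ} {m : Fin N → ℕ}

/-- The `k`-th and `l`-th contribution to `formCoeff`. -/
def formTerm {S : Type*} [CommRing S] (α : Fin N → ℕ)
    (B : (r : Fin N) → Matrix (Fin (m r)) (Fin (m r)) S)
    (A : (r s : Fin N) → ℕ → Matrix (Fin (m r)) (Fin (m s)) S) (r s : Fin N) (q : ℕ)
    (k : Fin N) (l : ℕ) : Matrix (Fin (m r)) (Fin (m s)) S :=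
  (-1 : S) ^ l • ((if α k - α r ≤ l then A k r (l - (α k - α r)) else 0)ᵀ * B k *
    (if l + (α s - α k) ≤ q then A k s (q - (l + (α s - α k))) else 0))

/-- The block in the last row of block `r` and in column `q` of block `s` of `Xᵀ H X`, where `X` is
the block Toeplitz matrix with the coefficients `A`. -/
def formCoeff {S : Type*} [CommRing S] (α : Fin N → ℕ)
    (B : (r : Fin N) → Matrix (Fin (m r)) (Fin (m r)) S)
    (A : (r s : Fin N) → ℕ → Matrix (Fin (m r)) (Fin (m s)) S) (r s : Fin N) (q : ℕ) :
    Matrix (Fin (m r)) (Fin (m s)) S :=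
  ∑ k, ∑ l ∈ Finset.range (α k), formTerm α B A r s q k l

variable {α : Fin N → ℕ} (B : (r : Fin N) → Matrix (Fin (m r)) (Fin (m r)) ℂ)

theorem transpose_mul_formMat_mul_apply (A : Coeffs m) (r s : Fin N) (hr : 0 < α r) (q : Fin (α s))
    (a : Fin (m r)) (b : Fin (m s)) :
    ((blockToeplitz α A)ᵀ * (formMat α B * blockToeplitz α A))
      ⟨r, ⟨α r - 1, by omega⟩, a⟩ ⟨s, q, b⟩ = formCoeff α B A r s q a b := by
  rw [Matrix.mul_apply, Fintype.sum_sigma, formCoeff, Matrix.sum_apply]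
  refine Finset.sum_congr rfl fun k _ => ?_
  -- The form pairs position `l.rev` with position `l`; after the reversal, `l` indexes the row of
  -- the right factor and is the exponent of the sign.
  rw [Fintype.sum_prod_type, Matrix.sum_apply, Finset.sum_range, ← Equiv.sum_comp Fin.revPerm]
  refine Finset.sum_congr rfl fun l _ => ?_
  simp only [formMat_mul_apply, Fin.revPerm_apply, Fin.rev_rev, formTerm]
  rw [Matrix.smul_apply, smul_eq_mul, Matrix.mul_assoc, Matrix.mul_apply, Finset.mul_sum]
  refine Finset.sum_congr rfl fun c _ => ?_
  have hl := l.2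
  have e1 : (blockToeplitz α A)ᵀ ⟨r, ⟨α r - 1, by omega⟩, a⟩ ⟨k, l.rev, c⟩ =
      (if α k - α r ≤ l.val then A k r (l.val - (α k - α r)) else 0)ᵀ a c := by
    rw [Matrix.transpose_apply, Matrix.transpose_apply, blockToeplitz_apply]
    simp only [Fin.val_rev]
    by_cases h : α k - α r ≤ l.val
    · rw [if_pos (by omega), if_pos h]
      congr 1; omega
    · rw [if_neg (by omega), if_neg h]; rfl
  rw [e1, Matrix.mul_apply]
  have e2 : ∀ d, blockToeplitz α A ⟨k, l, d⟩ ⟨s, q, b⟩ =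
      (if l.val + (α s - α k) ≤ q.val then A k s (q - (l.val + (α s - α k))) else 0) d b := by
    intro d
    rw [blockToeplitz_apply]
    split_ifs <;> rfl
  simp only [e2]
  ring

/-- A matrix anti-intertwining the shift with its transpose is determined by the last rows. -/
theorem block_eq_zero_of_anti {Δ : Matrix (BlockIdx α m) (BlockIdx α m) ℂ}
    (h : (blockShift α m)ᵀ * Δ = -(Δ * blockShift α m)) (r s : Fin N) 
    (h0 : ∀ (hr : 0 < α r) (q : Fin (α s)) a b, Δ ⟨r, ⟨α r - 1, by omega⟩, a⟩ ⟨s, q, b⟩ = 0) 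
    (i : Fin (α r)) (j : Fin (α s)) (a : Fin (m r)) (b : Fin (m s)) : Δ ⟨r, i, a⟩ ⟨s, j, b⟩ = 0 := by
  have hT : ∀ x y, ((blockShift α m)ᵀ * Δ) x y = (Δᵀ * blockShift α m) y x := by
    intro x y
    rw [← Matrix.transpose_apply (Δᵀ * _), Matrix.transpose_mul, Matrix.transpose_transpose]
  have key : ∀ (n i : ℕ) (hi : i + n + 1 = α r) (j : Fin (α s)) (a : Fin (m r)) (b : Fin (m s)),
      Δ ⟨r, ⟨i, by omega⟩, a⟩ ⟨s, j, b⟩ = 0 := by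
    intro n
    induction n with
    | zero =>
      intro i hi j a b
      have := h0 (by omega) j a b
      have e : i = α r - 1 := by omega
      subst e; exact this
    | succ n ih =>
      rintro i hi ⟨j, hj⟩ a b
      have h1 := congrFun (congrFun h ⟨r, ⟨i + 1, by omega⟩, a⟩) ⟨s, ⟨j, hj⟩, b⟩
      rw [hT, mul_blockShift_apply_succ Δᵀ r i (by omega), Matrix.transpose_apply] at h1
      rw [h1, Matrix.neg_apply, neg_eq_zero]
      rcases j with _ | j
      · exact mul_blockShift_apply_zero _ _ _ _ _
      · rw [mul_blockShift_apply_succ]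
        exact ih (i + 1) (by omega) _ _ _
  exact key (α r - 1 - i) i (by omega) j a b

/-- The defect `Δ = Xᵀ H X - H` inherits both the symmetry of `H` and the relation `Jᵀ Δ = -Δ J`. By
the second, a block vanishes once its last row does; by the first, blocks with `r ≤ s` suffice. -/
theorem blockToeplitz_form_eq_iff (hpos : ∀ r, 0 < α r)
    (hB : ∀ r, (B r)ᵀ = (-1 : ℂ) ^ (α r + 1) • B r) (A : Coeffs m) :
    (blockToeplitz α A)ᵀ * formMat α B * blockToeplitz α A = formMat α B ↔
      (∀ r, formCoeff α B A r r 0 = B r) ∧ (∀ r q, 0 < q → q < α r → formCoeff α B A r r q = 0) ∧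
      ∀ r s, r < s → ∀ q, q < α s → formCoeff α B A r s q = 0 := by
  have hH : ∀ (r s : Fin N) (q : Fin (α s)) a b,
      formMat α B ⟨r, ⟨α r - 1, by have := hpos r; omega⟩, a⟩ ⟨s, q, b⟩ =
        if h : r = s then (if q.val = 0 then B r a (h ▸ b) else 0) else 0 := by
    intro r s q a b
    by_cases h : r = s
    · subst h
      rw [dif_pos rfl, formMat, blockKron, Matrix.blockDiagonal'_apply_eq]
      simp only [Matrix.kronecker, Matrix.kroneckerMap_apply, signedFlip_apply]
      have := hpos r
      by_cases hq : q.val = 0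
      · rw [if_pos (by omega), if_pos hq, hq]; simp
      · rw [if_neg (by omega), if_neg hq]; simp
    · rw [dif_neg h, formMat, blockKron, Matrix.blockDiagonal'_apply_ne _ _ _ h]
  constructor
  · intro h
    have key : ∀ (r s : Fin N) (q : Fin (α s)) a b, formCoeff α B A r s q a b =
        if h : r = s then (if q.val = 0 then B r a (h ▸ b) else 0) else 0 := by
      intro r s q a b
      rw [← hH, ← transpose_mul_formMat_mul_apply B A r s (hpos r), ← Matrix.mul_assoc, h]
    refine ⟨fun r => ?_, fun r q hq hqr => ?_, fun r s hrs q hq => ?_⟩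
    · ext a b; simpa using key r r ⟨0, hpos r⟩ a b
    · ext a b; simpa [hq.ne'] using key r r ⟨q, hqr⟩ a b
    · ext a b; simpa [hrs.ne] using key r s ⟨q, hq⟩ a b
  · rintro ⟨h1, h2, h3⟩
    set Δ := (blockToeplitz α A)ᵀ * formMat α B * blockToeplitz α A - formMat α B with hΔ
    have hanti : (blockShift α m)ᵀ * Δ = -(Δ * blockShift α m) := by
      have hc := blockToeplitz_commute_blockShift (α := α) A
      have hc' : (blockShift α m)ᵀ * (blockToeplitz α A)ᵀ =
          (blockToeplitz α A)ᵀ * (blockShift α m)ᵀ := by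
        rw [← Matrix.transpose_mul, hc, Matrix.transpose_mul]
      have hJ := blockShift_transpose_mul_formMat (α := α) B
      calc (blockShift α m)ᵀ * Δ
          = ((blockShift α m)ᵀ * (blockToeplitz α A)ᵀ) * formMat α B * blockToeplitz α A -
              (blockShift α m)ᵀ * formMat α B := by
            rw [hΔ, Matrix.mul_sub]; simp only [Matrix.mul_assoc]
        _ = (blockToeplitz α A)ᵀ * ((blockShift α m)ᵀ * formMat α B) * blockToeplitz α A -
              (blockShift α m)ᵀ * formMat α B := by
            rw [hc']; simp only [Matrix.mul_assoc]
        _ = -((blockToeplitz α A)ᵀ * formMat α B * (blockShift α m * blockToeplitz α A)) +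
              formMat α B * blockShift α m := by
            rw [hJ]; simp only [Matrix.mul_neg, Matrix.neg_mul, Matrix.mul_assoc, sub_neg_eq_add]
        _ = -(Δ * blockShift α m) := by
            rw [← hc, hΔ, Matrix.sub_mul]; simp only [Matrix.mul_assoc]; abel
    have hsymm : Δᵀ = Δ := by
      rw [hΔ, Matrix.transpose_sub, Matrix.transpose_mul, Matrix.transpose_mul,
        formMat_transpose B hB, Matrix.transpose_transpose, Matrix.mul_assoc]
    have hle : ∀ r s : Fin N, r ≤ s → ∀ i j a b, Δ ⟨r, i, a⟩ ⟨s, j, b⟩ = 0 := by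
      intro r s hrs i j a b
      refine block_eq_zero_of_anti hanti r s ?_ i j a b
      intro hr q a b
      rw [hΔ, Matrix.sub_apply, Matrix.mul_assoc, transpose_mul_formMat_mul_apply B A r s hr, hH,
        sub_eq_zero]
      rcases hrs.eq_or_lt with rfl | hlt
      · rw [dif_pos rfl]
        split_ifs with hq
        · rw [hq, h1]
        · rw [h2 r q (by omega) q.2]; rfl
      · rw [dif_neg hlt.ne, h3 r s hlt q q.2]; rfl
    rw [← sub_eq_zero]
    ext ⟨r, i, a⟩ ⟨s, j, b⟩
    rcases le_total r s with hrs | hrs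
    · exact hle r s hrs i j a b
    · rw [← hΔ, ← hsymm, Matrix.transpose_apply]
      exact hle s r hrs j i b a

end formCoeff

/-! ### Separating the leading terms of the Gram equations -/

section formRest

variable {N : ℕ} {m : Fin N → ℕ} {S : Type*} [CommRing S]

/-- `formCoeff` without the contributions of the factors `A_0^{rr}`. -/
def formRest (α : Fin N → ℕ)
    (B : (r : Fin N) → Matrix (Fin (m r)) (Fin (m r)) S)
    (A : (r s : Fin N) → ℕ → Matrix (Fin (m r)) (Fin (m s)) S) (r s : Fin N) (q : ℕ) :
    Matrix (Fin (m r)) (Fin (m s)) S :=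
  ∑ k, ∑ l ∈ Finset.range (α k),
    if k = r ∧ (l = 0 ∨ r = s ∧ l = q) then 0 else formTerm α B A r s q k l

variable {α : Fin N → ℕ} (B : (r : Fin N) → Matrix (Fin (m r)) (Fin (m r)) S)
  (A : (r s : Fin N) → ℕ → Matrix (Fin (m r)) (Fin (m s)) S)

theorem formCoeff_eq_add_formRest (r s : Fin N) (q : ℕ) :
    formCoeff α B A r s q = (∑ l ∈ Finset.range (α r),
      if l = 0 ∨ r = s ∧ l = q then formTerm α B A r s q r l else 0) + formRest α B A r s q := by
  have h1 : ∑ l ∈ Finset.range (α r),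
      (if l = 0 ∨ r = s ∧ l = q then formTerm α B A r s q r l else 0) =
      ∑ k, ∑ l ∈ Finset.range (α k),
        if k = r ∧ (l = 0 ∨ r = s ∧ l = q) then formTerm α B A r s q k l else 0 := by
    rw [Finset.sum_eq_single r]
    · simp
    · intro k _ hk
      simp [hk]
    · simp
  rw [h1, formRest, formCoeff, ← Finset.sum_add_distrib]
  refine Finset.sum_congr rfl fun k _ => ?_
  rw [← Finset.sum_add_distrib]
  refine Finset.sum_congr rfl fun l _ => ?_
  split_ifs <;> simp

theorem formTerm_zero {r s : Fin N} (hrs : α s ≤ α r) (q : ℕ) :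
    formTerm α B A r s q r 0 = (A r r 0)ᵀ * B r * A r s q := by
  simp [formTerm, Nat.sub_eq_zero_of_le hrs]

theorem formTerm_self (r : Fin N) (q : ℕ) :
    formTerm α B A r r q r q = (-1 : S) ^ q • ((A r r q)ᵀ * B r * A r r 0) := by
  simp [formTerm]

/-- The split-off term is the only one containing `A_q^{rs}`, so the equation can be solved for it.
-/
theorem formCoeff_above (hα : StrictAnti α) {r s : Fin N} (hrs : r < s) (q : ℕ) :
    formCoeff α B A r s q = (A r r 0)ᵀ * B r * A r s q + formRest α B A r s q := by
  rw [formCoeff_eq_add_formRest, Finset.sum_eq_single 0]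
  · rw [if_pos (Or.inl rfl), formTerm_zero B A (hα hrs).le]
  · intro l _ hl
    rw [if_neg]
    rintro (h | ⟨h, -⟩)
    · exact hl h
    · exact hrs.ne h
  · have := hα hrs
    intro h; simp at h; omega

/-- Here `A_q^{rr}` occurs twice, in the terms `l = 0` and `l = q`, which are transposes of each
other up to a sign when `B` has the required symmetry. -/
theorem formCoeff_diag (r : Fin N) {q : ℕ} (hq : 0 < q) (hqr : q < α r) :
    formCoeff α B A r r q = (A r r 0)ᵀ * B r * A r r q +
      (-1 : S) ^ q • ((A r r q)ᵀ * B r * A r r 0) + formRest α B A r r q := by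
  rw [formCoeff_eq_add_formRest, Finset.sum_eq_add_of_mem 0 q (by simp; omega) (by simpa) hq.ne]
  · rw [if_pos (Or.inl rfl), if_pos (Or.inr ⟨rfl, rfl⟩), formTerm_zero B A le_rfl, formTerm_self]
  · rintro l - ⟨h1, h2⟩
    rw [if_neg]
    rintro (h | ⟨-, h⟩)
    · exact h1 h
    · exact h2 h

/-- A detour through a block of different size costs a positive offset in one of the two factors,
which is impossible for `q = 0`. -/
theorem formCoeff_diag_zero (hα : StrictAnti α) (hpos : ∀ r, 0 < α r) (r : Fin N) :
    formCoeff α B A r r 0 = (A r r 0)ᵀ * B r * A r r 0 := by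
  rw [formCoeff, Finset.sum_eq_single r, Finset.sum_eq_single 0]
  · exact formTerm_zero B A le_rfl 0
  · intro l _ hl
    rw [formTerm, if_neg (show ¬ l + (α r - α r) ≤ 0 by omega)]; simp
  · have := hpos r; intro h; simp at h; omega
  · intro k _ hk
    refine Finset.sum_eq_zero fun l _ => ?_
    rcases lt_or_gt_of_ne hk with h | h
    · have := hα h
      by_cases hl : α k - α r ≤ l
      · rw [formTerm, if_neg (show ¬ l + (α r - α k) ≤ 0 by omega)]; simp
      · rw [formTerm, if_neg hl]; simp
    · have := hα h
      rw [formTerm, if_neg (show ¬ l + (α r - α k) ≤ 0 by omega)]; simp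
  · simp

/-- The index triples of the coefficients which contribute to `formRest α B A r s q`. -/
theorem formRest_congr {A A' : (r s : Fin N) → ℕ → Matrix (Fin (m r)) (Fin (m s)) S}
    {r s : Fin N} {q : ℕ}
    (h : ∀ k l, l < α k → ¬ (k = r ∧ (l = 0 ∨ r = s ∧ l = q)) → α k - α r ≤ l →
      l + (α s - α k) ≤ q → A k r (l - (α k - α r)) = A' k r (l - (α k - α r)) ∧
        A k s (q - (l + (α s - α k))) = A' k s (q - (l + (α s - α k)))) :
    formRest α B A r s q = formRest α B A' r s q := by
  refine Finset.sum_congr rfl fun k _ => Finset.sum_congr rfl fun l hl => ?_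
  split_ifs with hc
  · rfl
  · simp only [formTerm]
    by_cases h1 : α k - α r ≤ l
    · by_cases h2 : l + (α s - α k) ≤ q
      · obtain ⟨e1, e2⟩ := h k l (by simpa using hl) hc h1 h2
        rw [e1, e2]
      · simp [h2]
    · simp [h1]

/-- Applied to the subalgebras `MvPolynomial.supported`, this bounds the variables of the
recursively defined polynomials. -/
theorem formRest_mem {R : Type*} [CommRing R] [Algebra R S] (T : Subalgebra R S)
    (hB : ∀ k a b, B k a b ∈ T)
    {A : (r s : Fin N) → ℕ → Matrix (Fin (m r)) (Fin (m s)) S} {r s : Fin N} {q : ℕ}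
    (h : ∀ k l, l < α k → ¬ (k = r ∧ (l = 0 ∨ r = s ∧ l = q)) → α k - α r ≤ l →
      l + (α s - α k) ≤ q → (∀ a b, A k r (l - (α k - α r)) a b ∈ T) ∧
        ∀ a b, A k s (q - (l + (α s - α k))) a b ∈ T) (a : Fin (m r)) (b : Fin (m s)) :
    formRest α B A r s q a b ∈ T := by
  rw [formRest, Matrix.sum_apply]
  refine Subalgebra.sum_mem _ fun k _ => ?_
  rw [Matrix.sum_apply]
  refine Subalgebra.sum_mem _ fun l hl => ?_
  split_ifs with hc
  · exact T.zero_mem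
  · simp only [formTerm]
    by_cases h1 : α k - α r ≤ l
    · by_cases h2 : l + (α s - α k) ≤ q
      · obtain ⟨e1, e2⟩ := h k l (by simpa using hl) hc h1 h2
        rw [if_pos h1, if_pos h2, Matrix.smul_apply, smul_eq_mul, Matrix.mul_apply]
        refine T.mul_mem (T.pow_mem (T.neg_mem T.one_mem) _) (Subalgebra.sum_mem _ fun c _ => ?_)
        rw [Matrix.mul_apply]
        exact T.mul_mem (Subalgebra.sum_mem _ fun d _ => T.mul_mem (e1 _ _) (hB _ _ _)) (e2 _ _)
      · simp [h2]
    · simp [h1]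

theorem formRest_map {S' : Type*} [CommRing S'] (f : S →+* S') (r s : Fin N) (q : ℕ) :
    (formRest α B A r s q).map f =
      formRest α (fun r => (B r).map f) (fun r s j => (A r s j).map f) r s q := by
  ext a b
  rw [Matrix.map_apply, formRest, formRest, Matrix.sum_apply, Matrix.sum_apply, map_sum]
  refine Finset.sum_congr rfl fun k _ => ?_
  rw [Matrix.sum_apply, Matrix.sum_apply, map_sum]
  refine Finset.sum_congr rfl fun l _ => ?_
  split_ifs with hc
  · simp
  · simp only [formTerm, Matrix.smul_apply, smul_eq_mul, map_mul, map_pow, map_neg, map_one]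
    by_cases h1 : α k - α r ≤ l <;> by_cases h2 : l + (α s - α k) ≤ q <;>
      simp [h1, h2, Matrix.mul_apply, map_sum]

end formRest

section symmetry

variable {N : ℕ} {α m : Fin N → ℕ} (B : (r : Fin N) → Matrix (Fin (m r)) (Fin (m r)) ℂ)

theorem anti_apply_add {Δ : Matrix (BlockIdx α m) (BlockIdx α m) ℂ}
    (h : (blockShift α m)ᵀ * Δ = -(Δ * blockShift α m)) (r s : Fin N) (n i j : ℕ)
    (hi : i + n < α r) (hj : j + n < α s) (a : Fin (m r)) (b : Fin (m s)) :
    Δ ⟨r, ⟨i + n, hi⟩, a⟩ ⟨s, ⟨j, by omega⟩, b⟩ =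
      (-1) ^ n * Δ ⟨r, ⟨i, by omega⟩, a⟩ ⟨s, ⟨j + n, hj⟩, b⟩ := by
  have hT : ∀ x y, ((blockShift α m)ᵀ * Δ) x y = (Δᵀ * blockShift α m) y x := by
    intro x y
    rw [← Matrix.transpose_apply (Δᵀ * _), Matrix.transpose_mul, Matrix.transpose_transpose]
  have hstep : ∀ (i j : ℕ) (hi : i + 1 < α r) (hj : j + 1 < α s),
      Δ ⟨r, ⟨i + 1, hi⟩, a⟩ ⟨s, ⟨j, Nat.lt_of_succ_lt hj⟩, b⟩ =
        - Δ ⟨r, ⟨i, Nat.lt_of_succ_lt hi⟩, a⟩ ⟨s, ⟨j + 1, hj⟩, b⟩ := by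
    intro i j hi hj
    have h1 := congrFun (congrFun h ⟨r, ⟨i + 1, hi⟩, a⟩) ⟨s, ⟨j + 1, hj⟩, b⟩
    rw [hT, mul_blockShift_apply_succ, Matrix.transpose_apply, Matrix.neg_apply,
      mul_blockShift_apply_succ] at h1
    rw [h1, neg_neg]
  induction n generalizing j with
  | zero => simp
  | succ n ih =>
    have h1 := hstep (i + n) j hi (by omega)
    have h2 := ih (j + 1) (by omega) (by omega)
    have e1 : i + (n + 1) = i + n + 1 := by ring
    have e2 : j + (n + 1) = j + 1 + n := by ring
    simp only [e1, e2]
    rw [h1, h2]; ring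

/-- `J` can be moved past the Toeplitz factors, which commute with it, and changes sign at `H`. -/
theorem blockToeplitz_form_anti (A : Coeffs m) :
    (blockShift α m)ᵀ * ((blockToeplitz α A)ᵀ * (formMat α B * blockToeplitz α A)) =
      -((blockToeplitz α A)ᵀ * (formMat α B * blockToeplitz α A) * blockShift α m) := by
  have hc := blockToeplitz_commute_blockShift (α := α) A
  have hc' : (blockShift α m)ᵀ * (blockToeplitz α A)ᵀ =
      (blockToeplitz α A)ᵀ * (blockShift α m)ᵀ := by
    rw [← Matrix.transpose_mul, hc, Matrix.transpose_mul]
  have hJ := blockShift_transpose_mul_formMat (α := α) B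
  calc _ = ((blockShift α m)ᵀ * (blockToeplitz α A)ᵀ) * (formMat α B * blockToeplitz α A) := by
        simp only [Matrix.mul_assoc]
    _ = (blockToeplitz α A)ᵀ * ((blockShift α m)ᵀ * formMat α B) * blockToeplitz α A := by
        rw [hc']; simp only [Matrix.mul_assoc]
    _ = -((blockToeplitz α A)ᵀ * formMat α B * (blockShift α m * blockToeplitz α A)) := by
        rw [hJ]; simp only [Matrix.mul_neg, Matrix.neg_mul, Matrix.mul_assoc]
    _ = _ := by rw [← hc]; simp only [Matrix.mul_assoc]

/-- Transposing the symmetric Gram matrix sends the position `(last, q)` to `(q, last)`; sliding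
along the anti-diagonal back to the last row takes `α r - 1 - q` steps, each with a sign. The
symmetry of `formRest` is deduced from this one, as it is not visible term by term. -/
theorem formCoeff_diag_symm (hB : ∀ r, (B r)ᵀ = (-1 : ℂ) ^ (α r + 1) • B r) (A : Coeffs m)
    (r : Fin N) {q : ℕ} (hq : q < α r) :
    formCoeff α B A r r q = (-1 : ℂ) ^ (α r + q + 1) • (formCoeff α B A r r q)ᵀ := by
  ext a b
  rw [Matrix.smul_apply, Matrix.transpose_apply, smul_eq_mul,
    ← transpose_mul_formMat_mul_apply B A r r (Nat.zero_lt_of_lt hq) ⟨q, hq⟩,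
    ← transpose_mul_formMat_mul_apply B A r r (Nat.zero_lt_of_lt hq) ⟨q, hq⟩]
  have hsymm : ((blockToeplitz α A)ᵀ * (formMat α B * blockToeplitz α A))ᵀ =
      (blockToeplitz α A)ᵀ * (formMat α B * blockToeplitz α A) := by
    rw [Matrix.transpose_mul, Matrix.transpose_mul, formMat_transpose B hB,
      Matrix.transpose_transpose, Matrix.mul_assoc]
  have h := anti_apply_add (blockToeplitz_form_anti (α := α) B A) r r (α r - 1 - q) q q (by omega)
    (by omega) a b
  have e : q + (α r - 1 - q) = α r - 1 := by omega
  simp only [e] at h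
  rw [h]
  conv_lhs => rw [← hsymm, Matrix.transpose_apply]
  rw [show α r + q + 1 = (α r - 1 - q) + 2 * (q + 1) by omega, pow_add, pow_mul]
  simp

end symmetry

/-! ### Recursive solution by polynomials: conditions (I)–(III) -/

section conditions

variable {N : ℕ} {α m : Fin N → ℕ} (B : (r : Fin N) → Matrix (Fin (m r)) (Fin (m r)) ℂ)

/-- The generic coefficients, where those above the block diagonal are prescribed. -/
def genericCoeffs
    (U : (r s : Fin N) → ℕ → Matrix (Fin (m r)) (Fin (m s)) (MvPolynomial (CoeffVar m) ℂ)) :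
    (r s : Fin N) → ℕ → Matrix (Fin (m r)) (Fin (m s)) (MvPolynomial (CoeffVar m) ℂ) :=
  fun r s j => if r < s then U r s j else
    Matrix.of fun a b => MvPolynomial.X ⟨r, s, j, a, b⟩

/-- The matrices `B r` over the polynomial ring. -/
def polyB (r : Fin N) : Matrix (Fin (m r)) (Fin (m r)) (MvPolynomial (CoeffVar m) ℂ) :=
  (B r).map MvPolynomial.C

/-- Iterative solution of the equations above the block diagonal. -/
def upperPoly (α : Fin N → ℕ) (B : (r : Fin N) → Matrix (Fin (m r)) (Fin (m r)) ℂ) :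
    ℕ → (r s : Fin N) → ℕ → Matrix (Fin (m r)) (Fin (m s)) (MvPolynomial (CoeffVar m) ℂ)
  | 0 => fun _ _ _ => 0
  | n + 1 => fun r s q => if r < s ∧ q < α s then
      -(genericCoeffs (upperPoly α B n) r r 0 * (B r)⁻¹.map MvPolynomial.C *
        formRest α (polyB B) (genericCoeffs (upperPoly α B n)) r s q) else 0

theorem upperPoly_succ (n : ℕ) (r s : Fin N) (q : ℕ) :
    upperPoly α B (n + 1) r s q = if r < s ∧ q < α s then
      -(genericCoeffs (upperPoly α B n) r r 0 * (B r)⁻¹.map MvPolynomial.C *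
        formRest α (polyB B) (genericCoeffs (upperPoly α B n)) r s q) else 0 := rfl

/-- The unknowns are ordered by `q` and then by `s - r`, encoded as `q * N + (s - r)`. The
right-hand side for `(r, s, q)` uses only earlier unknowns above the diagonal, so an iteration
started anywhere becomes stationary at `(r, s, q)` after that many steps. -/
theorem upperPoly_stable (hα : StrictAnti α) (n : ℕ) (r s : Fin N) (q : ℕ) (hrs : r < s)
    (hq : q < α s) (hn : q * N + (s.val - r.val) ≤ n) :
    upperPoly α B (n + 1) r s q = upperPoly α B n r s q := by
  induction n generalizing r s q with
  | zero => have : r.val < s.val := hrs; omega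
  | succ n ih =>
    rw [upperPoly_succ, upperPoly_succ, if_pos ⟨hrs, hq⟩, if_pos ⟨hrs, hq⟩]
    have h0 : ∀ U, genericCoeffs (m := m) U r r 0 =
        Matrix.of fun a b => MvPolynomial.X ⟨r, r, 0, a, b⟩ := by
      intro U; simp [genericCoeffs]
    rw [h0, h0]
    refine congrArg (fun T => -(_ * T)) ?_
    have hlt : ∀ k t : Fin N, ∀ u, k < t → u < α t → u * N + (t.val - k.val) ≤ n →
        genericCoeffs (upperPoly α B (n + 1)) k t u = genericCoeffs (upperPoly α B n) k t u := by
      intro k t u hkt hu hle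
      simp only [genericCoeffs, if_pos hkt]
      exact ih k t u hkt hu hle
    have hge : ∀ k t : Fin N, ∀ u, ¬ k < t →
        genericCoeffs (upperPoly α B (n + 1)) k t u = genericCoeffs (upperPoly α B n) k t u := by
      intro k t u hkt
      simp only [genericCoeffs, if_neg hkt]
    have hNq : ∀ u, u < q → ∀ k t : Fin N, u * N + (t.val - k.val) ≤ n := by
      intro u hu k t
      have h1 : (u + 1) * N ≤ q * N := Nat.mul_le_mul_right _ hu
      have := t.2
      have : r.val < s.val := hrs
      rw [add_mul] at h1; omega
    refine formRest_congr _ fun k l hl hc h1 h2 => ⟨?_, ?_⟩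
    · by_cases hkr : k < r
      · have hkα := hα hkr
        have hrα := hα hrs
        exact hlt _ _ _ hkr (by omega) (hNq _ (by omega) _ _)
      · exact hge _ _ _ hkr
    · by_cases hks : k < s
      · by_cases hlt' : q - (l + (α s - α k)) < q
        · exact hlt _ _ _ hks (by omega) (hNq _ hlt' _ _)
        -- The index does not drop only if `l = 0`. Then `k < r` is excluded by the offset `α k - α
        -- r ≤ l` and `k = r` is the split-off term, so `r < k < s` and the distance to `s` has
        -- decreased.
        · have hq' : q - (l + (α s - α k)) = q := by omega
          rw [hq']
          have hkr : r < k := by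
            rcases lt_trichotomy k r with h | h | h
            · have := hα h; omega
            · exfalso; apply hc; refine ⟨h, ?_⟩; omega
            · exact h
          refine hlt _ _ _ hks hq ?_
          have h3 : r.val < k.val := hkr
          have h4 : k.val < s.val := hks
          omega
      · exact hge _ _ _ hks

theorem genericCoeffs_mem {U} {V : Set (CoeffVar m)} {k t : Fin N} {u : ℕ}
    (h1 : k < t → ∀ a b, U k t u a b ∈ MvPolynomial.supported ℂ V)
    (h2 : ¬ k < t → ∀ a b, (⟨k, t, u, a, b⟩ : CoeffVar m) ∈ V) (a : Fin (m k)) (b : Fin (m t)) :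
    genericCoeffs U k t u a b ∈ MvPolynomial.supported ℂ V := by
  unfold genericCoeffs
  split_ifs with h
  · exact h1 h a b
  · exact MvPolynomial.X_mem_supported.mpr (h2 h a b)

/-- Condition (III) needs only a bound by all diagonal variables. The finer bound, with rows up to
`s` and indices up to `q`, is kept because these polynomials are substituted into the `D_j^r`, whose
dependence is more restricted. -/
theorem upperPoly_mem (hα : StrictAnti α) (hpos : ∀ r, 0 < α r) (n : ℕ) (r s : Fin N) (q : ℕ)
    (a : Fin (m r)) (b : Fin (m s)) : upperPoly α B n r s q a b ∈
      MvPolynomial.supported ℂ (belowVars α m ∪ diagVarsBefore α m s (q + 1)) := by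
  induction n generalizing r s q with
  | zero => exact Subalgebra.zero_mem _
  | succ n ih =>
    rw [upperPoly_succ]
    split_ifs with hcond
    swap
    · exact Subalgebra.zero_mem _
    obtain ⟨hrs, hq⟩ := hcond
    have hmono : ∀ (t : Fin N) (u : ℕ), t ≤ s → u ≤ q →
        MvPolynomial.supported ℂ (belowVars α m ∪ diagVarsBefore α m t (u + 1)) ≤
          MvPolynomial.supported ℂ (belowVars α m ∪ diagVarsBefore α m s (q + 1)) := by
      intro t u ht hu
      refine MvPolynomial.supported_mono (Set.union_subset_union_right _ ?_)
      rintro v ⟨hv1, hv2, hv3⟩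
      exact ⟨hv1, hv2.trans ht, by omega⟩
    have hgen : ∀ (k t : Fin N) (u : ℕ), t ≤ s → u ≤ q → u < α k → ∀ a b,
        genericCoeffs (upperPoly α B n) k t u a b ∈
          MvPolynomial.supported ℂ (belowVars α m ∪ diagVarsBefore α m s (q + 1)) := by
      intro k t u ht hu huk
      refine genericCoeffs_mem (fun _ a b => hmono t u ht hu (ih k t u a b)) fun hkt a b => ?_
      rcases (not_lt.mp hkt).eq_or_lt with h | h
      · subst h
        exact Or.inr ⟨⟨rfl, huk⟩, ht, by simp only; omega⟩
      · exact Or.inl ⟨h, huk⟩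
    rw [Matrix.neg_apply]
    refine Subalgebra.neg_mem _ ?_
    rw [Matrix.mul_apply]
    refine Subalgebra.sum_mem _ fun c _ => Subalgebra.mul_mem _ ?_ ?_
    · rw [Matrix.mul_apply]
      refine Subalgebra.sum_mem _ fun d _ => Subalgebra.mul_mem _ ?_ ?_
      · exact hgen r r 0 hrs.le (Nat.zero_le _) (hpos r) _ _
      · exact Subalgebra.algebraMap_mem _ _
    · refine formRest_mem _ _ (fun k a b => Subalgebra.algebraMap_mem _ _) ?_ _ _
      intro k l hl hc h1 h2
      have hrα := hα hrs
      refine ⟨hgen _ _ _ hrs.le (by omega) (by omega), hgen _ _ _ le_rfl (by omega) ?_⟩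
      omega

theorem map_genericCoeffs (U) (A : Coeffs m) (r s : Fin N) (j : ℕ) :
    (genericCoeffs U r s j).map (MvPolynomial.eval (coeffPoint A)) =
      if r < s then (U r s j).map (MvPolynomial.eval (coeffPoint A)) else A r s j := by
  unfold genericCoeffs
  split_ifs
  · rfl
  · ext a b; simp [coeffPoint]

/-- The polynomials `D_j^r`. -/
def diagPoly (α : Fin N → ℕ) (B : (r : Fin N) → Matrix (Fin (m r)) (Fin (m r)) ℂ) (n : ℕ)
    (r : Fin N) (q : ℕ) : Matrix (Fin (m r)) (Fin (m r)) (MvPolynomial (CoeffVar m) ℂ) :=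
  if 0 < q ∧ q < α r then
    (MvPolynomial.C (σ := CoeffVar m) (-1 / 2 : ℂ)) • (genericCoeffs (upperPoly α B n) r r 0 *
      (B r)⁻¹.map MvPolynomial.C *
        formRest α (polyB B) (genericCoeffs (upperPoly α B n)) r r q) else 0

/-- In rows `k ≤ r` all surviving indices are below `q`: for `k = r` because `l = 0` and `l = q`
were split off, for `k < r` because the offset `α k - α r` is positive. Rows `k > r` involve only
blocks below the diagonal. -/
theorem diagPoly_mem (hα : StrictAnti α) (hpos : ∀ r, 0 < α r) (n : ℕ) (r : Fin N) (q : ℕ)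
    (a b : Fin (m r)) : diagPoly α B n r q a b ∈
      MvPolynomial.supported ℂ (belowVars α m ∪ diagVarsBefore α m r q) := by
  rw [diagPoly]
  split_ifs with hcond
  swap
  · exact Subalgebra.zero_mem _
  obtain ⟨hq0, hq⟩ := hcond
  have hmono : ∀ (t : Fin N) (u : ℕ), t ≤ r → u < q →
      MvPolynomial.supported ℂ (belowVars α m ∪ diagVarsBefore α m t (u + 1)) ≤
        MvPolynomial.supported ℂ (belowVars α m ∪ diagVarsBefore α m r q) := by
    intro t u ht hu
    refine MvPolynomial.supported_mono (Set.union_subset_union_right _ ?_)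
    rintro v ⟨hv1, hv2, hv3⟩
    exact ⟨hv1, hv2.trans ht, by omega⟩
  have hgen : ∀ (k : Fin N) (u : ℕ), (k ≤ r → u < q) → u < α k → ∀ a b,
      genericCoeffs (upperPoly α B n) k r u a b ∈
        MvPolynomial.supported ℂ (belowVars α m ∪ diagVarsBefore α m r q) := by
    intro k u hu huk
    refine genericCoeffs_mem
      (fun h a b => hmono r u le_rfl (hu h.le) (upperPoly_mem B hα hpos n k r u a b))
      fun hkt a b => ?_
    rcases (not_lt.mp hkt).eq_or_lt with h | h
    · subst h
      exact Or.inr ⟨⟨rfl, huk⟩, le_rfl, hu le_rfl⟩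
    · exact Or.inl ⟨h, huk⟩
  rw [Matrix.smul_apply, smul_eq_mul]
  refine Subalgebra.mul_mem _ (Subalgebra.algebraMap_mem _ _) ?_
  rw [Matrix.mul_apply]
  refine Subalgebra.sum_mem _ fun c _ => Subalgebra.mul_mem _ ?_ ?_
  · rw [Matrix.mul_apply]
    refine Subalgebra.sum_mem _ fun d _ => Subalgebra.mul_mem _ ?_ ?_
    · exact hgen r 0 (fun _ => hq0) (hpos r) _ _
    · exact Subalgebra.algebraMap_mem _ _
  · refine formRest_mem _ _ (fun k a b => Subalgebra.algebraMap_mem _ _) ?_ _ _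
    intro k l hl hc h1 h2
    have hk : k ≤ r → k = r ∨ α r < α k := fun h =>
      h.eq_or_lt.imp id fun h => hα h
    have hc' : k = r → l ≠ 0 ∧ l ≠ q := fun h =>
      ⟨fun h' => hc ⟨h, Or.inl h'⟩, fun h' => hc ⟨h, Or.inr ⟨rfl, h'⟩⟩⟩
    refine ⟨hgen _ _ (fun h => ?_) (by omega), hgen _ _ (fun h => ?_) (by omega)⟩
    · rcases hk h with h3 | h3
      · have := hc' h3; omega
      · omega
    · rcases hk h with h3 | h3
      · have := hc' h3; omega
      · omega

/-- The equations for the blocks above the block diagonal can be solved for these blocks. -/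
theorem above_eq_iff (hBu : ∀ r, IsUnit (B r)) (hα : StrictAnti α) (A : Coeffs m)
    (h0 : ∀ r, (A r r 0)ᵀ * B r * A r r 0 = B r) (r s : Fin N) (hrs : r < s) (q : ℕ) :
    formCoeff α B A r s q = 0 ↔ A r s q = -(A r r 0 * (B r)⁻¹ * formRest α B A r s q) := by
  have hB := (Matrix.isUnit_iff_isUnit_det _).mp (hBu r)
  have h1 : (A r r 0 * (B r)⁻¹) * ((A r r 0)ᵀ * B r) = 1 := by
    rw [mul_eq_one_comm]
    rw [← Matrix.mul_assoc, h0, Matrix.mul_nonsing_inv _ hB]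
  have h2 := mul_eq_one_comm.mp h1
  rw [formCoeff_above B A hα hrs]
  constructor
  · intro h
    rw [← Matrix.mul_neg, ← eq_neg_of_add_eq_zero_left h, ← Matrix.mul_assoc, h1, Matrix.one_mul]
  · intro h
    conv_lhs => lhs; rw [h]
    rw [Matrix.mul_neg, ← Matrix.mul_assoc _ (A r r 0 * (B r)⁻¹), h2, Matrix.one_mul,
      neg_add_cancel]

/-- With `Y = A_0ᵀ B A_q` and the sign `δ` the equation reads `Y + δ Yᵀ + R = 0`, where `R = δ Rᵀ`.
Its solutions are `Y = Z - R / 2` with `Z = -δ Zᵀ`, and `A_0 B⁻¹` inverts `A_0ᵀ B`. -/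
theorem diag_eq_iff (hBu : ∀ r, IsUnit (B r))
    (hB : ∀ r, (B r)ᵀ = (-1 : ℂ) ^ (α r + 1) • B r) (A : Coeffs m)
    (h0 : ∀ r, (A r r 0)ᵀ * B r * A r r 0 = B r) (r : Fin N) {q : ℕ} (hq : 0 < q)
    (hqr : q < α r) :
    formCoeff α B A r r q = 0 ↔
      ∃ Z : Matrix (Fin (m r)) (Fin (m r)) ℂ, Z = (-1 : ℂ) ^ (α r + q) • Zᵀ ∧
        A r r q = A r r 0 * (B r)⁻¹ * Z +
          (-1 / 2 : ℂ) • (A r r 0 * (B r)⁻¹ * formRest α B A r r q) := by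
  have hBd := (Matrix.isUnit_iff_isUnit_det _).mp (hBu r)
  have h1 : (A r r 0 * (B r)⁻¹) * ((A r r 0)ᵀ * B r) = 1 := by
    rw [mul_eq_one_comm]
    rw [← Matrix.mul_assoc, h0, Matrix.mul_nonsing_inv _ hBd]
  have h2 := mul_eq_one_comm.mp h1
  set R := formRest α B A r r q with hR
  set Y := (A r r 0)ᵀ * B r * A r r q with hY
  set δ : ℂ := (-1) ^ (α r + q + 1) with hδ
  have hδδ : δ * δ = 1 := by rw [hδ, ← mul_pow]; simp
  have hδ' : (-1 : ℂ) ^ (α r + q) = -δ := by rw [hδ, pow_succ]; ring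
  have hYt : (-1 : ℂ) ^ q • ((A r r q)ᵀ * B r * A r r 0) = δ • Yᵀ := by
    rw [hY, Matrix.transpose_mul, Matrix.transpose_mul, hB, Matrix.transpose_transpose,
      Matrix.smul_mul, Matrix.mul_smul, smul_smul, Matrix.mul_assoc, hδ, ← pow_add,
      show α r + q + 1 + (α r + 1) = q + 2 * (α r + 1) by ring, pow_add, pow_mul]
    simp
  have hΦ : formCoeff α B A r r q = Y + δ • Yᵀ + R := by
    rw [formCoeff_diag B A r hq hqr, hYt]
  -- The whole coefficient has this symmetry and so does `Y + δ Yᵀ`, hence also the difference.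
  have hRs : R = δ • Rᵀ := by
    have h3 := formCoeff_diag_symm B hB A r hqr
    rw [hΦ, ← hδ, Matrix.transpose_add, Matrix.transpose_add, Matrix.transpose_smul,
      Matrix.transpose_transpose, smul_add, smul_add, smul_smul, hδδ, one_smul] at h3
    rw [add_comm (δ • Yᵀ) Y] at h3
    exact add_left_cancel h3
  rw [hΦ, hδ']
  constructor
  · intro h
    refine ⟨Y + (1 / 2 : ℂ) • R, ?_, ?_⟩
    · rw [Matrix.transpose_add, Matrix.transpose_smul, smul_add, smul_comm, neg_smul, neg_smul,
        ← hRs]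
      have h3 : Y = -(δ • Yᵀ) - R := by
        rw [← sub_eq_zero, ← h]; abel
      conv_lhs => rw [h3]
      module
    · rw [Matrix.mul_add, Matrix.mul_smul, hY, ← Matrix.mul_assoc _ _ (A r r q), h1,
        Matrix.one_mul]
      module
  · rintro ⟨Z, hZ, hA⟩
    have hYZ : Y = Z - (1 / 2 : ℂ) • R := by
      rw [hY, hA, Matrix.mul_add, Matrix.mul_smul, ← Matrix.mul_assoc _ (A r r 0 * (B r)⁻¹),
        ← Matrix.mul_assoc _ (A r r 0 * (B r)⁻¹), h2, Matrix.one_mul, Matrix.one_mul]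
      module
    have h5 : δ • Yᵀ = -Z - (1 / 2 : ℂ) • R := by
      rw [hYZ, Matrix.transpose_sub, Matrix.transpose_smul, smul_sub, smul_comm, ← hRs]
      conv_rhs => rw [hZ]
      module
    rw [h5, hYZ]
    module

/-- The polynomials are those of the `M`-th iterate, with `M` beyond the order of every unknown;
they are then exact solutions, and by uniqueness of the recursion the only ones. -/
theorem satisfiesConditions_autGroup (hα : StrictAnti α) (hpos : ∀ r, 0 < α r)
    (hBu : ∀ r, IsUnit (B r)) (hB : ∀ r, (B r)ᵀ = (-1 : ℂ) ^ (α r + 1) • B r) :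
    SatisfiesConditions α B
      (autGroup (blockShift α m) (formMat α B) : Set (GL (BlockIdx α m) ℂ)) := by
  set M := (∑ r, α r) * N + N with hM
  have hαM : ∀ r, α r ≤ ∑ r, α r := fun r => Finset.single_le_sum (fun _ _ => Nat.zero_le _)
    (Finset.mem_univ r)
  have hord : ∀ (r s : Fin N) (q : ℕ), q < α s → q * N + (s.val - r.val) ≤ M := by
    intro r s q hq
    have h1 := hαM s
    have h2 : q * N ≤ (∑ r, α r) * N := Nat.mul_le_mul_right _ (by omega)
    have := s.2
    omega
  have hmemX : ∀ A : Coeffs m, (∃ X ∈ (autGroup (blockShift α m) (formMat α B) :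
      Set (GL (BlockIdx α m) ℂ)), (X : Matrix (BlockIdx α m) (BlockIdx α m) ℂ) =
        blockToeplitz α A) ↔
      (blockToeplitz α A)ᵀ * formMat α B * blockToeplitz α A = formMat α B := by
    intro A
    constructor
    · rintro ⟨X, hX, hXA⟩
      rw [← hXA]; exact hX.2
    · intro h
      have hu : IsUnit (blockToeplitz α A) := by
        obtain ⟨G, hG⟩ := (isUnit_formMat (α := α) B hBu).exists_left_inv
        refine (isUnit_iff_exists_inv'.mpr ⟨G * ((blockToeplitz α A)ᵀ * formMat α B), ?_⟩)
        rw [Matrix.mul_assoc, h, hG]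
      exact ⟨hu.unit, ⟨blockToeplitz_commute_blockShift A, h⟩, rfl⟩
  have hpolyB : ∀ A : Coeffs m, (fun r => (polyB B r).map (MvPolynomial.eval (coeffPoint A))) =
      B := by
    intro A; funext r; ext a b; simp [polyB]
  have hmapR : ∀ (A : Coeffs m) n (r s : Fin N) q,
      (formRest α (polyB B) (genericCoeffs (upperPoly α B n)) r s q).map
        (MvPolynomial.eval (coeffPoint A)) = formRest α B (fun r s j => if r < s then
          (upperPoly α B n r s j).map (MvPolynomial.eval (coeffPoint A)) else A r s j) r s q := by
    intro A n r s q
    rw [formRest_map, hpolyB]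
    simp only [map_genericCoeffs]
  have hBinv : ∀ (A : Coeffs m) r, ((B r)⁻¹.map (MvPolynomial.C (σ := CoeffVar m))).map
      (MvPolynomial.eval (coeffPoint A)) = (B r)⁻¹ := by
    intro A r; ext a b; simp
  have hmapU : ∀ (A : Coeffs m) n (r s : Fin N) q, r < s → q < α s →
      (upperPoly α B (n + 1) r s q).map (MvPolynomial.eval (coeffPoint A)) =
        -(A r r 0 * (B r)⁻¹ * formRest α B (fun r s j => if r < s then
          (upperPoly α B n r s j).map (MvPolynomial.eval (coeffPoint A)) else A r s j) r s q) := by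
    intro A n r s q hrs hq
    rw [upperPoly_succ, if_pos ⟨hrs, hq⟩, Matrix.map_neg _ (fun a => map_neg _ a), Matrix.map_mul,
      Matrix.map_mul, hmapR, hBinv, map_genericCoeffs]
    simp
  have hmapD : ∀ (A : Coeffs m) n (r : Fin N) q, 0 < q → q < α r →
      (diagPoly α B n r q).map (MvPolynomial.eval (coeffPoint A)) =
        (-1 / 2 : ℂ) • (A r r 0 * (B r)⁻¹ * formRest α B (fun r s j => if r < s then
          (upperPoly α B n r s j).map (MvPolynomial.eval (coeffPoint A)) else A r s j) r r q) := by
    intro A n r q h1 h2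
    rw [diagPoly, if_pos ⟨h1, h2⟩]
    have : ∀ (c : ℂ) (T : Matrix (Fin (m r)) (Fin (m r)) (MvPolynomial (CoeffVar m) ℂ)),
        (MvPolynomial.C (σ := CoeffVar m) c • T).map (MvPolynomial.eval (coeffPoint A)) =
          c • T.map (MvPolynomial.eval (coeffPoint A)) := by
      intro c T; ext a b; simp
    rw [this, Matrix.map_mul, Matrix.map_mul, hmapR, hBinv, map_genericCoeffs]
    simp
  -- Once the coefficients above the diagonal equal the values of the polynomials, substituting
  -- these values into the rest changes nothing.
  have hreplace : ∀ A : Coeffs m, (∀ r s, r < s → ∀ q, q < α s → A r s q =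
      (upperPoly α B M r s q).map (MvPolynomial.eval (coeffPoint A))) → ∀ (r s : Fin N), r ≤ s →
      ∀ q, q < α s → formRest α B (fun r s j => if r < s then
        (upperPoly α B M r s j).map (MvPolynomial.eval (coeffPoint A)) else A r s j) r s q =
        formRest α B A r s q := by
    intro A h r s hrs q hq
    have hrα := hα.antitone hrs
    refine formRest_congr _ fun k l hl hc h1 h2 => ⟨?_, ?_⟩
    · split_ifs with hk
      · exact (h _ _ hk _ (by omega)).symm
      · rfl
    · split_ifs with hk
      · exact (h _ _ hk _ (by omega)).symm
      · rfl
  refine ⟨fun r q a b => diagPoly α B M r q a b, fun r s q a b => upperPoly α B M r s q a b,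
    fun r q a b => diagPoly_mem B hα hpos M r q a b, fun r s q a b => ?_, fun A => ?_⟩
  · refine MvPolynomial.supported_mono (Set.union_subset_union_right _ ?_)
      (upperPoly_mem B hα hpos M r s q a b)
    rintro v ⟨hv, -⟩
    exact hv
  · rw [hmemX, blockToeplitz_form_eq_iff B hpos hB]
    simp only [formCoeff_diag_zero B A hα hpos]
    refine and_congr_right fun h0 => ?_
    have hupper : (∀ r s, r < s → ∀ q, q < α s → formCoeff α B A r s q = 0) ↔
        ∀ r s, r < s → ∀ q, q < α s → A r s q =
          (upperPoly α B M r s q).map (MvPolynomial.eval (coeffPoint A)) := by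
      constructor
      · intro h
        -- Uniqueness: a solution agrees with the `n`-th iterate at all positions of order at most
        -- `n`, by the same descent as in `upperPoly_stable`.
        have key : ∀ n (r s : Fin N) q, r < s → q < α s → q * N + (s.val - r.val) ≤ n →
            A r s q = (upperPoly α B n r s q).map (MvPolynomial.eval (coeffPoint A)) := by
          intro n
          induction n with
          | zero =>
            intro r s q hrs _ h
            have : r.val < s.val := hrs
            omega
          | succ n ih =>
            intro r s q hrs hq hn
            rw [hmapU A n r s q hrs hq, (above_eq_iff B hBu hα A h0 r s hrs q).mp (h r s hrs q hq)]
            congr 2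
            have hNq : ∀ u, u < q → ∀ k t : Fin N, u * N + (t.val - k.val) ≤ n := by
              intro u hu k t
              have h1 : (u + 1) * N ≤ q * N := Nat.mul_le_mul_right _ hu
              have := t.2
              have : r.val < s.val := hrs
              rw [add_mul] at h1; omega
            have hrα := hα hrs
            refine formRest_congr _ fun k l hl hc h1 h2 => ⟨?_, ?_⟩
            · split_ifs with hk
              · have hkα := hα hk
                exact ih _ _ _ hk (by omega) (hNq _ (by omega) _ _)
              · rfl
            · split_ifs with hk
              · by_cases hlt' : q - (l + (α s - α k)) < q
                · exact ih _ _ _ hk (by omega) (hNq _ hlt' _ _)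
                · have hq' : q - (l + (α s - α k)) = q := by omega
                  rw [hq']
                  have hkr : r < k := by
                    rcases lt_trichotomy k r with h | h | h
                    · have := hα h; omega
                    · exfalso; apply hc; refine ⟨h, ?_⟩; omega
                    · exact h
                  refine ih _ _ _ hk hq ?_
                  have h3 : r.val < k.val := hkr
                  have h4 : k.val < s.val := hk
                  omega
              · rfl
        intro r s hrs q hq
        exact key M r s q hrs hq (hord r s q hq)
      · intro h r s hrs q hq
        rw [above_eq_iff B hBu hα A h0 r s hrs q]
        conv_lhs => rw [h r s hrs q hq,
          ← upperPoly_stable B hα M r s q hrs hq (hord r s q hq), hmapU A M r s q hrs hq]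
        rw [hreplace A h r s hrs.le q hq]
    rw [hupper]
    have hE : (∀ r s, r < s → ∀ q, q < α s → A r s q = Matrix.of fun a b =>
        MvPolynomial.eval (coeffPoint A) (upperPoly α B M r s q a b)) ↔
        ∀ r s, r < s → ∀ q, q < α s → A r s q =
          (upperPoly α B M r s q).map (MvPolynomial.eval (coeffPoint A)) := Iff.rfl
    rw [hE]
    refine and_congr_left fun hU => ?_
    refine forall_congr' fun r => forall_congr' fun q => ?_
    refine forall_congr' fun hq => forall_congr' fun hqr => ?_
    rw [diag_eq_iff B hBu hB A h0 r hq hqr, ← hreplace A hU r r le_rfl q hqr,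
      ← hmapD A M r q hq hqr]
    rfl

end conditions

/-! ### The square root series -/

/-- The coefficients of the power series of `√(1 - y)`. -/
def sqrtSeries (n : ℕ) : ℂ := if n = 0 then 1 else sqrtCoeff (n - 1)

theorem sqrtCoeff_eq_catalan (n : ℕ) : sqrtCoeff n = -((catalan n : ℂ) / 2 ^ (2 * n + 1)) := by
  have h := succ_mul_catalan_eq_centralBinom n
  rw [Nat.centralBinom] at h
  have h' : ((n : ℂ) + 1) * catalan n = (Nat.choose (2 * n) n : ℂ) := by exact_mod_cast h
  have : (n : ℂ) + 1 ≠ 0 := Nat.cast_add_one_ne_zero n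
  rw [sqrtCoeff, ← h']
  field_simp

/-- This is `(√(1 - y))² = 1 - y`. Up to sign and powers of two the coefficients are Catalan
numbers, whose convolution recurrence cancels against the two boundary terms. -/
theorem sum_sqrtSeries_mul (n : ℕ) :
    ∑ ij ∈ Finset.HasAntidiagonal.antidiagonal n, sqrtSeries ij.1 * sqrtSeries ij.2 =
      if n = 0 then 1 else if n = 1 then -1 else 0 := by
  rcases n with _ | _ | n
  · simp [sqrtSeries]
  · simp [Finset.Nat.antidiagonal_succ, sqrtSeries, sqrtCoeff]; norm_num
  · rw [Finset.Nat.sum_antidiagonal_succ, Finset.Nat.sum_antidiagonal_succ']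
    have h : ∑ ij ∈ Finset.HasAntidiagonal.antidiagonal n, sqrtSeries (ij.1 + 1) * sqrtSeries (ij.2 + 1) =
        (catalan (n + 1) : ℂ) / 2 ^ (2 * n + 2) := by
      rw [catalan_succ', Nat.cast_sum, Finset.sum_div]
      refine Finset.sum_congr rfl fun ij hij => ?_
      have hn := Finset.HasAntidiagonal.mem_antidiagonal.mp hij
      simp only [sqrtSeries, Nat.add_eq_zero_iff, one_ne_zero, and_false, if_false,
        Nat.add_sub_cancel, sqrtCoeff_eq_catalan]
      rw [← hn, show 2 * (ij.1 + ij.2) + 2 = (2 * ij.1 + 1) + (2 * ij.2 + 1) by ring,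
        neg_mul_neg, div_mul_div_comm, ← pow_add]
      push_cast
      rfl
    simp only [h]
    simp only [sqrtSeries, Nat.add_eq_zero_iff, one_ne_zero, and_false, if_false, if_true,
      Nat.add_sub_cancel, sqrtCoeff_eq_catalan]
    simp only [Nat.reduceEqDiff, if_false]
    rw [show 2 * (n + 1) + 1 = (2 * n + 2) + 1 by ring, pow_succ]
    have : (2 : ℂ) ^ (2 * n + 2) ≠ 0 := pow_ne_zero _ two_ne_zero
    field_simp
    ring

section sparse

variable {n : ℕ} {d : ℕ} {V : ℕ → Matrix (Fin n) (Fin n) ℂ} {Y : Matrix (Fin n) (Fin n) ℂ}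

/-- The `V j` are the coefficients of `√(1 - Y x^d)` as a power series in `x`, and the sums are
those of its square. -/
theorem sum_sparse_mul (hd : 0 < d) (hV : ∀ i, V (i * d) = sqrtSeries i • Y ^ i)
    (hV' : ∀ j, ¬ d ∣ j → V j = 0) (q : ℕ) :
    ∑ u ∈ Finset.range (q + 1), V u * V (q - u) =
      if q = 0 then 1 else if q = d then -Y else 0 := by
  rw [← Finset.Nat.sum_antidiagonal_eq_sum_range_succ_mk (f := fun ij => V ij.1 * V ij.2)]
  by_cases hdq : d ∣ q
  · obtain ⟨i, rfl⟩ := hdq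
    have h1 : ∑ ij ∈ Finset.HasAntidiagonal.antidiagonal (d * i), V ij.1 * V ij.2 =
        ∑ ij ∈ Finset.HasAntidiagonal.antidiagonal i, V (ij.1 * d) * V (ij.2 * d) := by
      symm
      refine Finset.sum_of_injOn (fun ij => (ij.1 * d, ij.2 * d)) ?_ ?_ ?_ ?_
      · rintro ⟨a, b⟩ - ⟨a', b'⟩ - h
        simp only [Prod.mk.injEq] at h ⊢
        exact ⟨Nat.eq_of_mul_eq_mul_right hd h.1, Nat.eq_of_mul_eq_mul_right hd h.2⟩
      · rintro ⟨a, b⟩ h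
        simp only [Finset.mem_coe, Finset.HasAntidiagonal.mem_antidiagonal] at h ⊢
        rw [← h]; ring
      · rintro ⟨a, b⟩ h h'
        simp only [Finset.HasAntidiagonal.mem_antidiagonal] at h
        by_cases hda : d ∣ a
        · exfalso
          have hdb : d ∣ b := (Nat.dvd_add_right hda).mp (h ▸ Dvd.intro i rfl)
          obtain ⟨a', rfl⟩ := hda
          obtain ⟨b', rfl⟩ := hdb
          refine h' ⟨(a', b'), ?_, by simp [mul_comm]⟩
          simp only [Finset.mem_coe, Finset.HasAntidiagonal.mem_antidiagonal]
          rw [← mul_add] at h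
          exact Nat.eq_of_mul_eq_mul_left hd h
        · simp [hV' a hda]
      · intro _ _; rfl
    rw [h1]
    have h2 : ∑ ij ∈ Finset.HasAntidiagonal.antidiagonal i, V (ij.1 * d) * V (ij.2 * d) =
        (∑ ij ∈ Finset.HasAntidiagonal.antidiagonal i, sqrtSeries ij.1 * sqrtSeries ij.2) • Y ^ i := by
      rw [Finset.sum_smul]
      refine Finset.sum_congr rfl fun ij hij => ?_
      rw [hV, hV, smul_mul_smul_comm, ← pow_add, Finset.HasAntidiagonal.mem_antidiagonal.mp hij]
    rw [h2, sum_sqrtSeries_mul]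
    rcases i with _ | _ | i
    · simp
    · simp [hd.ne']
    · have e : d * (i + 1 + 1) ≠ d := by
        rw [mul_add, mul_add]; omega
      simp [hd.ne', e]
  · rw [if_neg (by rintro rfl; simp at hdq), if_neg (by rintro rfl; simp at hdq)]
    refine Finset.sum_eq_zero fun ij hij => ?_
    by_cases hda : d ∣ ij.1
    · have hdb : ¬ d ∣ ij.2 := fun h => hdq (Finset.HasAntidiagonal.mem_antidiagonal.mp hij ▸ dvd_add hda h)
      rw [hV' _ hdb, mul_zero]
    · rw [hV' _ hda, zero_mul]

/-- `V` is self-adjoint for `B` up to the twist by `(-1)^u`, since `Y` is. The twisted product of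
`V` with its adjoint thereby becomes `B` times the plain square of `V`. -/
theorem sparse_transpose_mul (hV : ∀ i, V (i * d) = sqrtSeries i • Y ^ i)
    (hV' : ∀ j, ¬ d ∣ j → V j = 0) {B : Matrix (Fin n) (Fin n) ℂ}
    (hY : (-1 : ℂ) ^ d • (Yᵀ * B) = B * Y) (u : ℕ) :
    (-1 : ℂ) ^ u • ((V u)ᵀ * B) = B * V u := by
  by_cases hdu : d ∣ u
  · obtain ⟨i, rfl⟩ := hdu
    rw [mul_comm d i, hV, Matrix.transpose_smul, Matrix.smul_mul, Matrix.mul_smul, smul_comm]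
    congr 1
    rw [Matrix.transpose_pow]
    induction i with
    | zero => simp
    | succ i ih =>
      calc (-1 : ℂ) ^ ((i + 1) * d) • (Yᵀ ^ (i + 1) * B)
          = (-1 : ℂ) ^ (i * d) • (Yᵀ ^ i * ((-1 : ℂ) ^ d • (Yᵀ * B))) := by
            rw [Matrix.mul_smul, smul_smul, ← pow_add, ← Matrix.mul_assoc, ← pow_succ, add_mul,
              one_mul]
        _ = ((-1 : ℂ) ^ (i * d) • (Yᵀ ^ i * B)) * Y := by
            rw [hY, Matrix.smul_mul, Matrix.mul_assoc]
        _ = B * Y ^ (i + 1) := by rw [ih, Matrix.mul_assoc, ← pow_succ]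
  · simp [hV' u hdu]

theorem conj_pow_eq {B : Matrix (Fin n) (Fin n) ℂ} (hB : IsUnit B) (M : Matrix (Fin n) (Fin n) ℂ)
    (i : ℕ) : B⁻¹ * M ^ i * B = (B⁻¹ * M * B) ^ i := by
  have hBd := (Matrix.isUnit_iff_isUnit_det _).mp hB
  induction i with
  | zero => simp [Matrix.nonsing_inv_mul _ hBd]
  | succ i ih =>
    rw [pow_succ, pow_succ, ← ih]
    calc B⁻¹ * (M ^ i * M) * B = B⁻¹ * M ^ i * 1 * M * B := by
          rw [Matrix.mul_one]; simp only [Matrix.mul_assoc]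
      _ = _ := by rw [← Matrix.mul_nonsing_inv _ hBd]; simp only [Matrix.mul_assoc]

end sparse

/-! ### The generators preserve the form -/

section generators

variable {N : ℕ} {α m : Fin N → ℕ} {B : (r : Fin N) → Matrix (Fin (m r)) (Fin (m r)) ℂ}

theorem sum_range_ite_le {M : Type*} [AddCommMonoid M] (f : ℕ → M) {q a : ℕ} (h : q < a) :
    ∑ l ∈ Finset.range a, (if l ≤ q then f l else 0) = ∑ l ∈ Finset.range (q + 1), f l := by
  rw [← Finset.sum_filter]
  refine Finset.sum_congr ?_ fun _ _ => rfl
  ext l; simp; omega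

/-- The diagonal contribution to the Gram matrix. -/
theorem sum_formTerm_self (A : Coeffs m) (r : Fin N) {q : ℕ} (hq : q < α r) :
    ∑ l ∈ Finset.range (α r), formTerm α B A r r q r l =
      ∑ l ∈ Finset.range (q + 1), (-1 : ℂ) ^ l • ((A r r l)ᵀ * B r) * A r r (q - l) := by
  rw [← sum_range_ite_le _ hq]
  refine Finset.sum_congr rfl fun l _ => ?_
  simp only [formTerm, Nat.sub_self, Nat.zero_le, if_true, add_zero, Nat.sub_zero]
  split_ifs
  · rw [Matrix.smul_mul]
  · simp

theorem formTerm_eq_zero_left {A : Coeffs m} {r s k : Fin N} (h : ∀ j, A k r j = 0) (q l : ℕ) :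
    formTerm α B A r s q k l = 0 := by
  simp only [formTerm, h, ite_self, Matrix.transpose_zero, Matrix.zero_mul, smul_zero]

theorem formTerm_eq_zero_right {A : Coeffs m} {r s k : Fin N} (h : ∀ j, A k s j = 0) (q l : ℕ) :
    formTerm α B A r s q k l = 0 := by
  simp only [formTerm, h, ite_self, Matrix.mul_zero, smul_zero]

theorem formCoeff_diagCoeffs_self (W : (r : Fin N) → ℕ → Matrix (Fin (m r)) (Fin (m r)) ℂ)
    (r : Fin N) {q : ℕ} (hq : q < α r) : formCoeff α B (diagCoeffs W) r r q =
      ∑ l ∈ Finset.range (q + 1), (-1 : ℂ) ^ l • ((W r l)ᵀ * B r) * W r (q - l) := by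
  rw [formCoeff, Finset.sum_eq_single r]
  · rw [sum_formTerm_self _ _ hq]; simp
  · intro k _ hk
    exact Finset.sum_eq_zero fun l _ => formTerm_eq_zero_left (fun j => diagCoeffs_ne W hk j) _ _
  · simp

theorem formCoeff_diagCoeffs_ne (W : (r : Fin N) → ℕ → Matrix (Fin (m r)) (Fin (m r)) ℂ)
    {r s : Fin N} (hrs : r ≠ s) (q : ℕ) : formCoeff α B (diagCoeffs W) r s q = 0 := by
  refine Finset.sum_eq_zero fun k _ => Finset.sum_eq_zero fun l _ => ?_
  by_cases hk : k = r
  · subst hk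
    exact formTerm_eq_zero_right (fun j => diagCoeffs_ne W hrs j) _ _
  · exact formTerm_eq_zero_left (fun j => diagCoeffs_ne W hk j) _ _

/-- The prescription `B W_q = Z - S / 2` makes the coefficient equal to `T = (S - δ Sᵀ) / 2`, so `δ
Tᵀ = -T`. The general symmetry `T = δ Tᵀ` then gives `T = 0`; no symmetry of the sum `S` itself has
to be proved. -/
theorem diagonalGenerator_form (hpos : ∀ r, 0 < α r)
    (hBu : ∀ r, IsUnit (B r)) (hB : ∀ r, (B r)ᵀ = (-1 : ℂ) ^ (α r + 1) • B r)
    {Z W : (r : Fin N) → ℕ → Matrix (Fin (m r)) (Fin (m r)) ℂ}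
    (hZ : ∀ r j, 1 ≤ j → j < α r → Z r j = (-1 : ℂ) ^ (α r + j) • (Z r j)ᵀ)
    (hW0 : ∀ r, W r 0 = 1)
    (hW : ∀ r j, 1 ≤ j → j < α r →
      W r j = (B r)⁻¹ * (Z r j - (1 / 2 : ℂ) •
        ∑ k ∈ Finset.Ico 1 j, (-1 : ℂ) ^ k • ((W r k)ᵀ * B r * W r (j - k)))) :
    (blockToeplitz α (diagCoeffs W))ᵀ * formMat α B * blockToeplitz α (diagCoeffs W) =
      formMat α B := by
  rw [blockToeplitz_form_eq_iff B hpos hB]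
  refine ⟨fun r => ?_, fun r q hq hqr => ?_, fun r s hrs q _ => formCoeff_diagCoeffs_ne W hrs.ne q⟩
  · rw [formCoeff_diagCoeffs_self W r (hpos r)]
    simp [hW0]
  · have hsymm := formCoeff_diag_symm B hB (diagCoeffs W) r hqr
    set T := formCoeff α B (diagCoeffs W) r r q with hT
    rw [formCoeff_diagCoeffs_self W r hqr, Finset.sum_range_succ, Finset.range_eq_Ico,
      Finset.sum_eq_sum_Ico_succ_bot hq] at hT
    set S := ∑ k ∈ Finset.Ico 1 q, (-1 : ℂ) ^ k • ((W r k)ᵀ * B r * W r (q - k)) with hS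
    have hS' : ∑ k ∈ Finset.Ico (0 + 1) q, (-1 : ℂ) ^ k • ((W r k)ᵀ * B r) * W r (q - k) = S := by
      rw [hS]
      refine Finset.sum_congr (by simp) fun k _ => ?_
      rw [Matrix.smul_mul]
    rw [hS'] at hT
    simp only [hW0, Nat.sub_self, Matrix.mul_one, pow_zero, one_smul, Matrix.transpose_one,
      Matrix.one_mul, Nat.sub_zero] at hT
    set δ : ℂ := (-1) ^ (α r + q + 1) with hδ
    have hδδ : δ * δ = 1 := by rw [hδ, ← mul_pow]; simp
    have hYt : (-1 : ℂ) ^ q • ((W r q)ᵀ * B r) = δ • (B r * W r q)ᵀ := by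
      rw [Matrix.transpose_mul, hB, Matrix.mul_smul, smul_smul, hδ, ← pow_add,
        show α r + q + 1 + (α r + 1) = q + 2 * (α r + 1) by ring, pow_add, pow_mul]
      simp
    have hBW : B r * W r q = Z r q - (1 / 2 : ℂ) • S := by
      rw [hW r q hq hqr, ← Matrix.mul_assoc,
        Matrix.mul_nonsing_inv _ ((Matrix.isUnit_iff_isUnit_det _).mp (hBu r)), Matrix.one_mul]
    have hZ' : δ • (Z r q)ᵀ = -Z r q := by
      conv_rhs => rw [hZ r q hq hqr]
      rw [hδ, pow_succ, mul_neg_one, neg_smul]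
    rw [hYt, hBW, Matrix.transpose_sub, Matrix.transpose_smul, smul_sub, hZ'] at hT
    have hT2 : T = (1 / 2 : ℂ) • (S - δ • Sᵀ) := by
      rw [hT]; module
    rw [hT2, Matrix.transpose_smul, Matrix.transpose_sub, Matrix.transpose_smul,
      Matrix.transpose_transpose, smul_comm, smul_sub δ, smul_smul δ δ, hδδ, one_smul] at hsymm
    rw [hT2]
    have h3 : (1 / 2 : ℂ) • (S - δ • Sᵀ) + (1 / 2 : ℂ) • (S - δ • Sᵀ) = 0 := by
      nth_rewrite 2 [hsymm]
      module
    rw [← two_smul ℂ] at h3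
    exact (smul_eq_zero.mp h3).resolve_left two_ne_zero

/-- The coefficients of an off-diagonal generator, with the powers in a simplified form. -/
structure IsOffDiagonal (α : Fin N → ℕ) (B : (r : Fin N) → Matrix (Fin (m r)) (Fin (m r)) ℂ)
    (p t : Fin N) (k : ℕ) (F : Matrix (Fin (m t)) (Fin (m p)) ℂ) (A : Coeffs m) : Prop where
  lt : p < t
  k_lt : k < α t
  off : ∀ r s, ¬ ((r = p ∨ r = t) ∧ (s = p ∨ s = t)) → r ≠ s → ∀ j, A r s j = 0
  other : ∀ r, r ≠ p → r ≠ t → A r r 0 = 1 ∧ ∀ j, 1 ≤ j → A r r j = 0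
  below : ∀ j, A t p j = if j = k then F else 0
  above : ∀ j, A p t j = if j = k then (-1 : ℂ) ^ (k + 1) • ((B p)⁻¹ * Fᵀ * B t) else 0
  pp : ∀ i, A p p (i * (2 * k + (α p - α t))) =
    sqrtSeries i • ((-1 : ℂ) ^ k • ((B p)⁻¹ * Fᵀ * B t * F)) ^ i
  tt : ∀ i, A t t (i * (2 * k + (α p - α t))) =
    sqrtSeries i • ((-1 : ℂ) ^ k • (F * (B p)⁻¹ * Fᵀ * B t)) ^ i
  zero : ∀ j, ¬ (2 * k + (α p - α t)) ∣ j → A p p j = 0 ∧ A t t j = 0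

theorem offDiagonal_powers (hBu : ∀ r, IsUnit (B r)) {p t : Fin N} (k : ℕ)
    (F : Matrix (Fin (m t)) (Fin (m p)) ℂ) {i : ℕ} (hi : 1 ≤ i) :
    ((-1 : ℂ) ^ (k * i) * sqrtCoeff (i - 1)) •
        ((B p)⁻¹ * (Fᵀ * B t * F * (B p)⁻¹) ^ i * B p) =
      sqrtSeries i • ((-1 : ℂ) ^ k • ((B p)⁻¹ * Fᵀ * B t * F)) ^ i ∧
    ((-1 : ℂ) ^ (k * i) * sqrtCoeff (i - 1)) •
        ((B t)⁻¹ * (B t * F * (B p)⁻¹ * Fᵀ) ^ i * B t) =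
      sqrtSeries i • ((-1 : ℂ) ^ k • (F * (B p)⁻¹ * Fᵀ * B t)) ^ i := by
  have hBp := Matrix.nonsing_inv_mul _ ((Matrix.isUnit_iff_isUnit_det _).mp (hBu p))
  have hBt := Matrix.nonsing_inv_mul _ ((Matrix.isUnit_iff_isUnit_det _).mp (hBu t))
  have hs : sqrtSeries i = sqrtCoeff (i - 1) := by rw [sqrtSeries, if_neg (by omega)]
  constructor
  · rw [conj_pow_eq (hBu p), smul_pow, smul_smul, ← pow_mul, hs, mul_comm (sqrtCoeff _)]
    congr 2
    calc (B p)⁻¹ * (Fᵀ * B t * F * (B p)⁻¹) * B p = (B p)⁻¹ * Fᵀ * B t * F * ((B p)⁻¹ * B p) := by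
          simp only [Matrix.mul_assoc]
      _ = _ := by rw [hBp, Matrix.mul_one]
  · rw [conj_pow_eq (hBu t), smul_pow, smul_smul, ← pow_mul, hs, mul_comm (sqrtCoeff _)]
    congr 2
    calc (B t)⁻¹ * (B t * F * (B p)⁻¹ * Fᵀ) * B t = ((B t)⁻¹ * B t) * F * (B p)⁻¹ * Fᵀ * B t := by
          simp only [Matrix.mul_assoc]
      _ = _ := by rw [hBt, Matrix.one_mul]

/-- Moving the conjugation by `B` and the sign inside the power makes the diagonal coefficients the
terms of a square root series, including the constant term. -/
theorem mem_offDiagonalGenerators_iff (hBu : ∀ r, IsUnit (B r))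
    (X : GL (BlockIdx α m) ℂ) : X ∈ offDiagonalGenerators α B ↔
      ∃ p t k F A, IsOffDiagonal α B p t k F A ∧
        (X : Matrix (BlockIdx α m) (BlockIdx α m) ℂ) = blockToeplitz α A := by
  have hdvd : ∀ d j : ℕ, (∃ n, j = n * d) ↔ d ∣ j := fun d j =>
    ⟨fun ⟨n, h⟩ => ⟨n, by rw [h, mul_comm]⟩, fun ⟨n, h⟩ => ⟨n, by rw [h, mul_comm]⟩⟩
  constructor
  · rintro ⟨p, t, k, F, A, hpt, hk, h1, h2, h3, h4, h5, h6, h7, h8, h9, hX⟩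
    refine ⟨p, t, k, F, A, ⟨hpt, hk, h1, h2, h3, h4, fun i => ?_, fun i => ?_, fun j hj => ?_⟩, hX⟩
    · rcases i with _ | i
      · simpa [sqrtSeries] using h5
      · rw [h7 _ (by omega), (offDiagonal_powers hBu k F (by omega)).1]
    · rcases i with _ | i
      · simpa [sqrtSeries] using h6
      · rw [h8 _ (by omega), (offDiagonal_powers hBu k F (by omega)).2]
    · exact h9 j (by rwa [hdvd])
  · rintro ⟨p, t, k, F, A, h, hX⟩
    refine ⟨p, t, k, F, A, h.lt, h.k_lt, h.off, h.other, h.below, h.above, ?_, ?_,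
      fun n hn => ?_, fun n hn => ?_, fun j hj => h.zero j (by rwa [hdvd] at hj), hX⟩
    · simpa [sqrtSeries] using h.pp 0
    · simpa [sqrtSeries] using h.tt 0
    · rw [h.pp, (offDiagonal_powers hBu k F hn).1]
    · rw [h.tt, (offDiagonal_powers hBu k F hn).2]

/-- Let `G = B_p⁻¹ Fᵀ B_t`. The diagonal blocks are the series `√(1 - Y x^d)` with `Y = (-1)^k G F`
at `p` and `Y = (-1)^k F G` at `t`. Their squares contribute `-B Y` at index `d`, exactly cancelled
by the product of the off-diagonal blocks. At `(p, t)` the two contributions cancel because `G`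
intertwines the two series. -/
theorem IsOffDiagonal.form_eq (hα : StrictAnti α) (hpos : ∀ r, 0 < α r)
    (hBu : ∀ r, IsUnit (B r)) (hB : ∀ r, (B r)ᵀ = (-1 : ℂ) ^ (α r + 1) • B r)
    {p t : Fin N} {k : ℕ} {F : Matrix (Fin (m t)) (Fin (m p)) ℂ} {A : Coeffs m}
    (h : IsOffDiagonal α B p t k F A) :
    (blockToeplitz α A)ᵀ * formMat α B * blockToeplitz α A = formMat α B := by
  have hαpt := hα h.lt
  have hkt := h.k_lt
  have hne : p ≠ t := h.lt.ne
  set d := 2 * k + (α p - α t) with hd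
  have hd0 : 0 < d := by omega
  obtain ⟨G, hG⟩ : ∃ G, G = (B p)⁻¹ * Fᵀ * B t := ⟨_, rfl⟩
  obtain ⟨Yp, hYp⟩ : ∃ Y, Y = (-1 : ℂ) ^ k • (G * F) := ⟨_, rfl⟩
  obtain ⟨Yt, hYt⟩ : ∃ Y, Y = (-1 : ℂ) ^ k • (F * G) := ⟨_, rfl⟩
  have hVp : ∀ i, A p p (i * d) = sqrtSeries i • Yp ^ i := by
    intro i
    rw [h.pp, hYp, hG]
  have hVt : ∀ i, A t t (i * d) = sqrtSeries i • Yt ^ i := by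
    intro i
    rw [h.tt, hYt, hG]; simp only [Matrix.mul_assoc]
  have hVp0 : ∀ j, ¬ d ∣ j → A p p j = 0 := fun j hj => (h.zero j hj).1
  have hVt0 : ∀ j, ¬ d ∣ j → A t t j = 0 := fun j hj => (h.zero j hj).2
  have hBp' := Matrix.mul_nonsing_inv _ ((Matrix.isUnit_iff_isUnit_det _).mp (hBu p))
  have hBG : B p * G = Fᵀ * B t := by
    rw [hG, Matrix.mul_assoc, ← Matrix.mul_assoc (B p), hBp', Matrix.one_mul]
  -- the transpose of `G`
  have hGt : Gᵀ * B p = (-1 : ℂ) ^ (α p - α t) • (B t * F) := by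
    have h1 := congrArg Matrix.transpose hBG
    rw [Matrix.transpose_mul, Matrix.transpose_mul, Matrix.transpose_transpose, hB p, hB t,
      Matrix.mul_smul, Matrix.smul_mul] at h1
    have h2 : Gᵀ * B p = (-1 : ℂ) ^ (α p + 1) • ((-1 : ℂ) ^ (α p + 1) • (Gᵀ * B p)) := by
      rw [smul_smul, ← mul_pow]; simp
    rw [h2, h1, smul_smul, ← pow_add,
      show α p + 1 + (α t + 1) = (α p - α t) + 2 * (α t + 1) by omega, pow_add, pow_mul]
    simp
  have hFt : Fᵀ * (Gᵀ * B p) = (-1 : ℂ) ^ (α p - α t) • (B p * (G * F)) := by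
    rw [hGt, Matrix.mul_smul, ← Matrix.mul_assoc, ← hBG, Matrix.mul_assoc]
  have hsd : (-1 : ℂ) ^ d * (-1) ^ (α p - α t) = 1 := by
    rw [← pow_add, hd, show 2 * k + (α p - α t) + (α p - α t) = 2 * (k + (α p - α t)) by ring,
      pow_mul]
    simp
  have hYpt : (-1 : ℂ) ^ d • (Ypᵀ * B p) = B p * Yp := by
    rw [hYp, Matrix.transpose_smul, Matrix.transpose_mul, Matrix.smul_mul, Matrix.mul_smul,
      smul_comm, Matrix.mul_assoc, hFt, smul_smul ((-1 : ℂ) ^ d), hsd, one_smul]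
  have hYtt : (-1 : ℂ) ^ d • (Ytᵀ * B t) = B t * Yt := by
    rw [hYt, Matrix.transpose_smul, Matrix.transpose_mul, Matrix.smul_mul, Matrix.mul_smul,
      smul_comm, Matrix.mul_assoc, ← hBG, ← Matrix.mul_assoc, hGt, Matrix.smul_mul,
      smul_smul ((-1 : ℂ) ^ d), hsd, one_smul, Matrix.mul_assoc]
  have hselfp : ∀ q, q < α p → ∑ l ∈ Finset.range (α p), formTerm α B A p p q p l =
      B p * (if q = 0 then 1 else if q = d then -Yp else 0) := by
    intro q hq
    rw [sum_formTerm_self _ _ hq, ← sum_sparse_mul hd0 hVp hVp0, Finset.mul_sum]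
    refine Finset.sum_congr rfl fun l _ => ?_
    rw [sparse_transpose_mul hVp hVp0 hYpt, Matrix.mul_assoc]
  have hselft : ∀ q, q < α t → ∑ l ∈ Finset.range (α t), formTerm α B A t t q t l =
      B t * (if q = 0 then 1 else if q = d then -Yt else 0) := by
    intro q hq
    rw [sum_formTerm_self _ _ hq, ← sum_sparse_mul hd0 hVt hVt0, Finset.mul_sum]
    refine Finset.sum_congr rfl fun l _ => ?_
    rw [sparse_transpose_mul hVt hVt0 hYtt, Matrix.mul_assoc]
  have hsum2 : ∀ r s q, (r = p ∨ r = t) → formCoeff α B A r s q =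
      ∑ l ∈ Finset.range (α p), formTerm α B A r s q p l +
        ∑ l ∈ Finset.range (α t), formTerm α B A r s q t l := by
    intro r s q hr
    rw [formCoeff]
    refine Finset.sum_eq_add p t hne (fun k' _ hk' => ?_) (by simp) (by simp)
    refine Finset.sum_eq_zero fun l _ => formTerm_eq_zero_left (fun j => ?_) _ _
    refine h.off k' r ?_ ?_ j
    · rintro ⟨h1 | h1, -⟩
      · exact hk'.1 h1
      · exact hk'.2 h1
    · rintro rfl; rcases hr with h1 | h1
      · exact hk'.1 h1
      · exact hk'.2 h1
  -- contribution of block `t` to the `(p, p)` entry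
  have hpp : ∀ q, ∑ l ∈ Finset.range (α t), formTerm α B A p p q t l =
      if q = d then B p * Yp else 0 := by
    intro q
    rw [Finset.sum_eq_single k]
    · simp only [formTerm, show α t - α p = 0 by omega, Nat.zero_le, if_true, Nat.sub_zero,
        h.below]
      by_cases hq : q = d
      · rw [if_pos hq, if_pos (by omega), if_pos (by omega), ← hBG, hYp, Matrix.mul_smul,
          Matrix.mul_assoc]
      · rw [if_neg hq]
        by_cases hq' : k + (α p - α t) ≤ q
        · rw [if_pos hq', if_neg (by omega)]; simp
        · rw [if_neg hq']; simp
    · intro l _ hl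
      simp only [formTerm, show α t - α p = 0 by omega, Nat.zero_le, if_true, Nat.sub_zero,
        h.below, if_neg hl]
      simp
    · intro hk; simp at hk; omega
  -- contribution of block `p` to the `(t, t)` entry
  have htt : ∀ q, ∑ l ∈ Finset.range (α p), formTerm α B A t t q p l =
      if q = d then B t * Yt else 0 := by
    intro q
    rw [Finset.sum_eq_single (k + (α p - α t))]
    · simp only [formTerm, show α t - α p = 0 by omega, add_zero, Nat.add_sub_cancel, h.above]
      rw [if_pos (by omega), if_pos trivial]
      by_cases hq : q = d
      · rw [if_pos hq, if_pos (by omega), if_pos (by omega), ← hG, Matrix.transpose_smul,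
          Matrix.smul_mul, Matrix.smul_mul, Matrix.mul_smul, hGt, Matrix.smul_mul, hYt,
          Matrix.mul_smul, smul_smul, smul_smul, smul_smul, Matrix.mul_assoc]
        congr 1
        rw [← pow_add, ← pow_add, ← pow_add,
          show k + (α p - α t) + (k + 1) + (k + 1) + (α p - α t) =
            k + 2 * (k + 1 + (α p - α t)) by ring, pow_add, pow_mul]
        simp
      · rw [if_neg hq]
        by_cases hq' : k + (α p - α t) ≤ q
        · rw [if_pos hq', if_neg (by omega)]; simp
        · rw [if_neg hq']; simp
    · intro l _ hl
      simp only [formTerm, h.above]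
      by_cases hl' : α p - α t ≤ l
      · rw [if_pos hl', if_neg (by omega)]; simp
      · rw [if_neg hl']; simp
    · intro hk; simp at hk; omega
  -- `(G F)^i G = G (F G)^i`.
  have hinter : ∀ u, A p p u * G = G * A t t u := by
    intro u
    by_cases hu : d ∣ u
    · obtain ⟨i, rfl⟩ := hu
      rw [mul_comm d i, hVp, hVt, Matrix.smul_mul, Matrix.mul_smul]
      congr 1
      induction i with
      | zero => simp
      | succ i ih =>
        have h1 : Yp * G = G * Yt := by
          rw [hYp, hYt, Matrix.smul_mul, Matrix.mul_smul, Matrix.mul_assoc]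
        rw [pow_succ, pow_succ, Matrix.mul_assoc, h1, ← Matrix.mul_assoc, ih, Matrix.mul_assoc]
    · rw [hVp0 u hu, hVt0 u hu, Matrix.zero_mul, Matrix.mul_zero]
  have hpt : ∀ q, q < α t → formCoeff α B A p t q = 0 := by
    intro q hq
    rw [hsum2 p t q (Or.inl rfl)]
    by_cases hkq : k ≤ q
    · have e1 : ∑ l ∈ Finset.range (α p), formTerm α B A p t q p l =
          (-1 : ℂ) ^ (k + 1) • (B p * A p p (q - k) * G) := by
        rw [Finset.sum_eq_single (q - k)]
        · simp only [formTerm, Nat.sub_self, Nat.zero_le, if_true, Nat.sub_zero,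
            show α t - α p = 0 by omega, add_zero, h.above]
          rw [if_pos (by omega), if_pos (by omega), ← hG, ← Matrix.smul_mul,
            sparse_transpose_mul hVp hVp0 hYpt, Matrix.mul_smul]
        · intro l _ hl
          simp only [formTerm, show α t - α p = 0 by omega, Nat.sub_self, Nat.zero_le, if_true,
            Nat.sub_zero, add_zero, h.above]
          by_cases hl' : l ≤ q
          · rw [if_pos hl', if_neg (by omega)]; simp
          · rw [if_neg hl']; simp
        · intro hk; simp at hk; omega
      have e2 : ∑ l ∈ Finset.range (α t), formTerm α B A p t q t l =
          (-1 : ℂ) ^ k • (B p * G * A t t (q - k)) := by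
        rw [Finset.sum_eq_single k]
        · simp only [formTerm, Nat.sub_self, Nat.zero_le, if_true, Nat.sub_zero,
            show α t - α p = 0 by omega, add_zero, h.below]
          rw [if_pos hkq, hBG]
        · intro l _ hl
          simp only [formTerm, show α t - α p = 0 by omega, Nat.zero_le, if_true, Nat.sub_zero,
            h.below, if_neg hl]
          simp
        · intro hk; simp at hk; omega
      rw [e1, e2, Matrix.mul_assoc, hinter, ← Matrix.mul_assoc, pow_succ, mul_neg_one, neg_smul,
        neg_add_cancel]
    · rw [Finset.sum_eq_zero, Finset.sum_eq_zero, add_zero]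
      · intro l _
        simp only [formTerm, show α t - α p = 0 by omega, Nat.zero_le, if_true, Nat.sub_zero,
          Nat.sub_self, add_zero, h.below]
        by_cases hl : l = k
        · rw [if_neg (show ¬ l ≤ q by omega)]; simp
        · rw [if_neg hl]; simp
      · intro l _
        simp only [formTerm, show α t - α p = 0 by omega, Nat.sub_self, Nat.zero_le, if_true,
          Nat.sub_zero, add_zero, h.above]
        by_cases hl' : l ≤ q
        · rw [if_pos hl', if_neg (by omega)]; simp
        · rw [if_neg hl']; simp
  have hself : ∀ r, r ≠ p → r ≠ t → ∀ q, q < α r → formCoeff α B A r r q =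
      if q = 0 then B r else 0 := by
    intro r hrp hrt q hq
    obtain ⟨h1, h2⟩ := h.other r hrp hrt
    rw [formCoeff, Finset.sum_eq_single r]
    · rw [sum_formTerm_self _ _ hq, Finset.sum_eq_single 0]
      · by_cases hq0 : q = 0
        · simp [hq0, h1]
        · rw [if_neg hq0, Nat.sub_zero, h2 q (by omega), Matrix.mul_zero]
      · intro l _ hl
        rw [h2 l (by omega)]; simp
      · simp
    · intro k' _ hk'
      refine Finset.sum_eq_zero fun l _ => formTerm_eq_zero_left (fun j => ?_) _ _
      refine h.off k' r ?_ hk' j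
      rintro ⟨-, h1 | h1⟩
      · exact hrp h1
      · exact hrt h1
    · simp
  have hdiag : ∀ r q, q < α r → formCoeff α B A r r q = if q = 0 then B r else 0 := by
    intro r q hq
    by_cases hrp : r = p
    · subst hrp
      rw [hsum2 r r q (Or.inl rfl), hselfp q hq, hpp]
      by_cases hq0 : q = 0
      · rw [if_pos hq0, if_pos hq0, if_neg (by omega)]; simp
      · rw [if_neg hq0, if_neg hq0]
        split_ifs <;> simp
    by_cases hrt : r = t
    · subst hrt
      rw [hsum2 r r q (Or.inr rfl), hselft q hq, htt]
      by_cases hq0 : q = 0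
      · rw [if_pos hq0, if_pos hq0, if_neg (by omega)]; simp
      · rw [if_neg hq0, if_neg hq0]
        split_ifs <;> simp
    exact hself r hrp hrt q hq
  rw [blockToeplitz_form_eq_iff B hpos hB]
  refine ⟨fun r => by simpa using hdiag r 0 (hpos r), fun r q hq hqr => by
    simpa [hq.ne'] using hdiag r q hqr, fun r s hrs q hq => ?_⟩
  by_cases hcase : r = p ∧ s = t
  · obtain ⟨rfl, rfl⟩ := hcase
    exact hpt q hq
  · refine Finset.sum_eq_zero fun k' _ => Finset.sum_eq_zero fun l _ => ?_
    have hnot : ¬ ((r = p ∨ r = t) ∧ (s = p ∨ s = t)) := by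
      have := h.lt
      rintro ⟨rfl | rfl, rfl | rfl⟩
      · exact lt_irrefl _ hrs
      · exact hcase ⟨rfl, rfl⟩
      · exact absurd (hrs.trans this) (lt_irrefl _)
      · exact lt_irrefl _ hrs
    by_cases h1 : k' = r
    · subst h1
      exact formTerm_eq_zero_right (fun j => h.off k' s hnot hrs.ne j) _ _
    by_cases h2 : k' = s
    · subst h2
      exact formTerm_eq_zero_left (fun j => h.off k' r (fun hh => hnot hh.symm) h1 j) _ _
    by_cases h3 : (k' = p ∨ k' = t) ∧ (r = p ∨ r = t)
    · refine formTerm_eq_zero_right (fun j => h.off k' s ?_ h2 j) _ _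
      exact fun hh => hnot ⟨h3.2, hh.2⟩
    · exact formTerm_eq_zero_left (fun j => h.off k' r h3 h1 j) _ _

end generators

/-! ### The linearized form condition -/

section lie

variable {N : ℕ} {α m : Fin N → ℕ} (B : (r : Fin N) → Matrix (Fin (m r)) (Fin (m r)) ℂ)

theorem exists_mem_autGroup (hBu : ∀ r, IsUnit (B r)) {A : Coeffs m}
    (h : (blockToeplitz α A)ᵀ * formMat α B * blockToeplitz α A = formMat α B) :
    ∃ X ∈ autGroup (blockShift α m) (formMat α B),
      (X : Matrix (BlockIdx α m) (BlockIdx α m) ℂ) = blockToeplitz α A := by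
  have hu : IsUnit (blockToeplitz α A) := by
    obtain ⟨G, hG⟩ := (isUnit_formMat (α := α) B hBu).exists_left_inv
    refine (isUnit_iff_exists_inv'.mpr ⟨G * ((blockToeplitz α A)ᵀ * formMat α B), ?_⟩)
    rw [Matrix.mul_assoc, h, hG]
  exact ⟨hu.unit, ⟨blockToeplitz_commute_blockShift A, h⟩, rfl⟩

/-- The last rows of the infinitesimal form condition. -/
theorem lie_apply (hB : ∀ r, (B r)ᵀ = (-1 : ℂ) ^ (α r + 1) • B r) (A : Coeffs m) {r s : Fin N}
    (hrs : α s ≤ α r) (hr : 0 < α r) (q : Fin (α s)) (a : Fin (m r)) (b : Fin (m s)) :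
    ((blockToeplitz α A)ᵀ * formMat α B + formMat α B * blockToeplitz α A)
      ⟨r, ⟨α r - 1, by omega⟩, a⟩ ⟨s, q, b⟩ =
      (B r * A r s q + (-1 : ℂ) ^ q.val • ((A s r q)ᵀ * B s)) a b := by
  have hq := q.2
  have e1 : (blockToeplitz α A)ᵀ * formMat α B = (formMat α B * blockToeplitz α A)ᵀ := by
    rw [Matrix.transpose_mul, formMat_transpose B hB]
  have e2 : (A s r q)ᵀ * B s = (-1 : ℂ) ^ (α s + 1) • (B s * A s r q)ᵀ := by
    rw [Matrix.transpose_mul, hB, Matrix.mul_smul, smul_smul, ← mul_pow]; simp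
  rw [Matrix.add_apply, e1, Matrix.transpose_apply, formMat_mul_apply, formMat_mul_apply, e2,
    Matrix.add_apply, Matrix.smul_apply, Matrix.smul_apply, Matrix.transpose_apply, add_comm,
    Matrix.mul_apply, Matrix.mul_apply]
  simp only [Fin.val_rev, smul_eq_mul, ← mul_assoc, ← pow_add]
  congr 1
  · rw [show α r - (α r - 1 + 1) = 0 by omega, pow_zero, one_mul]
    refine Finset.sum_congr rfl fun c _ => ?_
    rw [blockToeplitz_apply, if_pos]
    · simp only [Fin.val_rev]; congr 2; omega
    · simp only [Fin.val_rev]; omega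
  · congr 1
    · rw [show q.val + (α s + 1) = (α s - (q.val + 1)) + 2 * (q.val + 1) by omega, pow_add _ _ (2 * _),
        pow_mul]
      simp
    · refine Finset.sum_congr rfl fun c _ => ?_
      rw [blockToeplitz_apply, if_pos]
      · simp only [Fin.val_rev]; congr 2; omega
      · simp only [Fin.val_rev]; omega

/-- The reduction to last rows with `r ≤ s` works as for the group: the linearized defect is again
symmetric and anti-intertwines the shift. -/
theorem blockToeplitz_lie_iff (hα : StrictAnti α) (hpos : ∀ r, 0 < α r)
    (hB : ∀ r, (B r)ᵀ = (-1 : ℂ) ^ (α r + 1) • B r) (A : Coeffs m) :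
    (blockToeplitz α A)ᵀ * formMat α B + formMat α B * blockToeplitz α A = 0 ↔
      ∀ r s, r ≤ s → ∀ q, q < α s → B r * A r s q + (-1 : ℂ) ^ q • ((A s r q)ᵀ * B s) = 0 := by
  constructor
  · intro h r s hrs q hq
    ext a b
    rw [← lie_apply B hB A (hα.antitone hrs) (hpos r) ⟨q, hq⟩, h]; rfl
  · intro h
    set Δ := (blockToeplitz α A)ᵀ * formMat α B + formMat α B * blockToeplitz α A with hΔ
    have hsymm : Δᵀ = Δ := by
      rw [hΔ, Matrix.transpose_add, Matrix.transpose_mul, Matrix.transpose_mul,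
        formMat_transpose B hB, Matrix.transpose_transpose, add_comm]
    have hanti : (blockShift α m)ᵀ * Δ = -(Δ * blockShift α m) := by
      have hc := blockToeplitz_commute_blockShift (α := α) A
      have hc' : (blockShift α m)ᵀ * (blockToeplitz α A)ᵀ =
          (blockToeplitz α A)ᵀ * (blockShift α m)ᵀ := by
        rw [← Matrix.transpose_mul, hc, Matrix.transpose_mul]
      have hJ := blockShift_transpose_mul_formMat (α := α) B
      rw [hΔ, Matrix.mul_add, Matrix.add_mul, ← Matrix.mul_assoc, hc', Matrix.mul_assoc, hJ,
        ← Matrix.mul_assoc, hJ, Matrix.neg_mul, Matrix.mul_neg, Matrix.mul_assoc _ _ (blockToeplitz α A),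
        ← hc, Matrix.mul_assoc, Matrix.mul_assoc, neg_add]
    have hle : ∀ r s : Fin N, r ≤ s → ∀ i j a b, Δ ⟨r, i, a⟩ ⟨s, j, b⟩ = 0 := by
      intro r s hrs i j a b
      refine block_eq_zero_of_anti hanti r s ?_ i j a b
      intro hr q a b
      rw [hΔ, lie_apply B hB A (hα.antitone hrs) hr, h r s hrs q q.2]; rfl
    ext ⟨r, i, a⟩ ⟨s, j, b⟩
    rcases le_total r s with hrs | hrs
    · exact hle r s hrs i j a b
    · rw [← hsymm, Matrix.transpose_apply]
      exact hle s r hrs j i b a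

/-- The lowest degree coefficients of a unipotent automorphism satisfy the infinitesimal form
condition. -/
theorem leading_lie_eq (hα : StrictAnti α) (hpos : ∀ r, 0 < α r)
    (hB : ∀ r, (B r)ᵀ = (-1 : ℂ) ^ (α r + 1) • B r) {A : Coeffs m} {d : ℤ} (hd : 1 ≤ d)
    (hdeg : HasDegree d (blockToeplitz α A))
    (h : (1 + blockToeplitz α A)ᵀ * formMat α B * (1 + blockToeplitz α A) = formMat α B)
    {r s : Fin N} (hrs : r ≤ s) {q : ℕ} (hq : q < α s) (hqd : coeffDegree α r s q = d) :
    B r * A r s q + (-1 : ℂ) ^ q • ((A s r q)ᵀ * B s) = 0 := by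
  set Y := blockToeplitz α A with hY
  have h1 : Yᵀ * formMat α B + formMat α B * Y + Yᵀ * (formMat α B * Y) = 0 := by
    rw [Matrix.transpose_add, Matrix.transpose_one, Matrix.add_mul, Matrix.one_mul,
      Matrix.mul_add, Matrix.mul_one, Matrix.add_mul, Matrix.mul_assoc] at h
    rw [← sub_eq_zero] at h
    rw [← h]; abel
  have hrα := hα.antitone hrs
  ext a b
  rw [← lie_apply B hB A hrα (hpos r) ⟨q, hq⟩, ← hY]
  have h2 := congrFun (congrFun h1 ⟨r, ⟨α r - 1, Nat.sub_lt (hpos r) one_pos⟩, a⟩) ⟨s, ⟨q, hq⟩, b⟩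
  rw [Matrix.add_apply] at h2
  -- The quadratic term has degree at least `2d`, so by comparison of weights it does not reach an
  -- entry of degree `d ≥ 1`.
  suffices hz : (Yᵀ * (formMat α B * Y)) ⟨r, ⟨α r - 1, Nat.sub_lt (hpos r) one_pos⟩, a⟩
      ⟨s, ⟨q, hq⟩, b⟩ = 0 by
    rw [hz, add_zero] at h2
    exact h2
  rw [Matrix.mul_apply]
  refine Finset.sum_eq_zero ?_
  rintro ⟨k, l, c⟩ -
  rw [formMat_mul_apply]
  by_contra hne
  have hl := hdeg ⟨k, l, c⟩ ⟨r, ⟨α r - 1, Nat.sub_lt (hpos r) one_pos⟩, a⟩ (left_ne_zero_of_mul hne)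
  obtain ⟨e, -, he⟩ := Finset.exists_ne_zero_of_sum_ne_zero
    (right_ne_zero_of_mul (right_ne_zero_of_mul hne))
  have hr := hdeg ⟨k, l.rev, e⟩ ⟨s, ⟨q, hq⟩, b⟩ (right_ne_zero_of_mul he)
  simp only [blockWeight, Fin.val_rev, coeffDegree] at hl hr hqd
  rw [abs_of_nonneg (by omega)] at hqd
  have := l.2
  have := hpos r
  omega

end lie

/-! ### Leading parts and generation of the unipotent subgroup -/

section lead

variable {N : ℕ} {α m : Fin N → ℕ}

/-- `M` is the leading part, in degree `d`, of an element of `V`. -/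
def IsLeadingPart (V : Subgroup (GL (BlockIdx α m) ℂ)) (d : ℤ)
    (M : Matrix (BlockIdx α m) (BlockIdx α m) ℂ) : Prop :=
  HasDegree d M ∧ ∃ g ∈ V, HasDegree (d + 1) ((g : Matrix (BlockIdx α m) (BlockIdx α m) ℂ) - 1 - M)

variable {V : Subgroup (GL (BlockIdx α m) ℂ)} {d : ℤ}

theorem IsLeadingPart.zero : IsLeadingPart V d 0 :=
  ⟨HasDegree.zero, 1, V.one_mem, by simpa using HasDegree.zero⟩

/-- Multiplication of group elements is addition of leading parts: the cross term `(g - 1)(g' - 1)`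
has degree `2d ≥ d + 1`. -/
theorem IsLeadingPart.add (hd : 1 ≤ d) {M M' : Matrix (BlockIdx α m) (BlockIdx α m) ℂ}
    (h : IsLeadingPart V d M) (h' : IsLeadingPart V d M') : IsLeadingPart V d (M + M') := by
  obtain ⟨h1, g, hg, h2⟩ := h
  obtain ⟨h1', g', hg', h2'⟩ := h'
  refine ⟨h1.add h1', g * g', V.mul_mem hg hg', ?_⟩
  have e : ((g * g' : GL (BlockIdx α m) ℂ) : Matrix (BlockIdx α m) (BlockIdx α m) ℂ) - 1 - (M + M') =
      ((g : Matrix (BlockIdx α m) (BlockIdx α m) ℂ) - 1) * ((g' : Matrix _ _ ℂ) - 1) +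
        ((g : Matrix _ _ ℂ) - 1 - M) + ((g' : Matrix _ _ ℂ) - 1 - M') := by
    rw [Units.val_mul]; noncomm_ring
  rw [e]
  have k1 : HasDegree d ((g : Matrix (BlockIdx α m) (BlockIdx α m) ℂ) - 1) := by
    have := (h2.mono (show d ≤ d + 1 by omega)).add h1
    simpa using this
  have k2 : HasDegree d ((g' : Matrix (BlockIdx α m) (BlockIdx α m) ℂ) - 1) := by
    have := (h2'.mono (show d ≤ d + 1 by omega)).add h1'
    simpa using this
  exact (((k1.mul k2).mono (by omega)).add h2).add h2'

theorem IsLeadingPart.sum (hd : 1 ≤ d) {ι : Type*} (S : Finset ι)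
    (M : ι → Matrix (BlockIdx α m) (BlockIdx α m) ℂ) (h : ∀ i ∈ S, IsLeadingPart V d (M i)) :
    IsLeadingPart V d (∑ i ∈ S, M i) := by
  classical
  induction S using Finset.induction_on with
  | empty => simpa using zero
  | insert a S ha ih =>
    rw [Finset.sum_insert ha]
    exact add hd (h a (Finset.mem_insert_self _ _))
      (ih fun i hi => h i (Finset.mem_insert_of_mem hi))

end lead

section generation

variable {N : ℕ} {α m : Fin N → ℕ} {B : (r : Fin N) → Matrix (Fin (m r)) (Fin (m r)) ℂ}

/-- The recursion for the coefficients of a diagonal generator. -/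
def diagonalSeq {n : ℕ} (B : Matrix (Fin n) (Fin n) ℂ) (Z : ℕ → Matrix (Fin n) (Fin n) ℂ) :
    ℕ → Matrix (Fin n) (Fin n) ℂ
  | 0 => 1
  | j + 1 => B⁻¹ * (Z (j + 1) - (1 / 2 : ℂ) •
      ∑ k : Fin j, (-1 : ℂ) ^ (k.val + 1) •
        ((diagonalSeq B Z (k.val + 1))ᵀ * B * diagonalSeq B Z (j - k.val)))
  termination_by j => j
  decreasing_by all_goals omega

theorem diagonalSeq_eq {n : ℕ} (B : Matrix (Fin n) (Fin n) ℂ)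
    (Z : ℕ → Matrix (Fin n) (Fin n) ℂ) {j : ℕ} (hj : 1 ≤ j) :
    diagonalSeq B Z j = B⁻¹ * (Z j - (1 / 2 : ℂ) • ∑ k ∈ Finset.Ico 1 j, (-1 : ℂ) ^ k •
      ((diagonalSeq B Z k)ᵀ * B * diagonalSeq B Z (j - k))) := by
  obtain ⟨j, rfl⟩ : ∃ i, j = i + 1 := ⟨j - 1, by omega⟩
  rw [diagonalSeq, Finset.sum_Ico_eq_sum_range, Finset.sum_range]
  congr 3
  refine Finset.sum_congr rfl fun k _ => ?_
  rw [add_comm 1 k.val, show j + 1 - (k.val + 1) = j - k.val by omega]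

theorem diagonalSeq_zero {n : ℕ} (B : Matrix (Fin n) (Fin n) ℂ)
    (Z : ℕ → Matrix (Fin n) (Fin n) ℂ) : diagonalSeq B Z 0 = 1 := by rw [diagonalSeq]

theorem diagonalSeq_of_lt {n : ℕ} (B : Matrix (Fin n) (Fin n) ℂ)
    {Z : ℕ → Matrix (Fin n) (Fin n) ℂ} {j₀ : ℕ} (hZ : ∀ j, 1 ≤ j → j < j₀ → Z j = 0) (j : ℕ)
    (hj : 1 ≤ j) (hj' : j < j₀) : diagonalSeq B Z j = 0 := by
  induction j using Nat.strong_induction_on with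
  | _ j ih =>
    rw [diagonalSeq_eq B Z hj, hZ j hj hj', Finset.sum_eq_zero]
    · simp
    · intro k hk
      rw [Finset.mem_Ico] at hk
      rw [ih k hk.2 hk.1 (by omega)]; simp

theorem diagonalSeq_self {n : ℕ} (B : Matrix (Fin n) (Fin n) ℂ)
    {Z : ℕ → Matrix (Fin n) (Fin n) ℂ} {j₀ : ℕ} (hj₀ : 1 ≤ j₀)
    (hZ : ∀ j, 1 ≤ j → j < j₀ → Z j = 0) : diagonalSeq B Z j₀ = B⁻¹ * Z j₀ := by
  rw [diagonalSeq_eq B Z hj₀, Finset.sum_eq_zero]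
  · simp
  · intro k hk
    rw [Finset.mem_Ico] at hk
    rw [diagonalSeq_of_lt B hZ k hk.1 hk.2]; simp

variable (α) in
/-- The coefficients of the off-diagonal generator determined by the coefficients of `A` in the
positions `(t, p)` and `(p, t)`. -/
def pairCoeffs (A : Coeffs m) (p t : Fin N) (k : ℕ) : Coeffs m := fun r s j =>
  diagCoeffs (fun r j => if r = p ∨ r = t then
      (if (2 * k + (α p - α t)) ∣ j then sqrtSeries (j / (2 * k + (α p - α t))) •
        (-(if r = p then A r t k * A t r k else A r p k * A p r k)) ^
          (j / (2 * k + (α p - α t))) else 0)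
      else if j = 0 then 1 else 0) r s j +
    if (r = t ∧ s = p ∨ r = p ∧ s = t) ∧ j = k then A r s j else 0

theorem isOffDiagonal_pairCoeffs (hα : StrictAnti α) {A : Coeffs m} {p t : Fin N} {k : ℕ}
    (hpt : p < t) (hk : k < α t)
    (hA : A p t k = (-1 : ℂ) ^ (k + 1) • ((B p)⁻¹ * (A t p k)ᵀ * B t)) :
    IsOffDiagonal α B p t k (A t p k) (pairCoeffs α A p t k) := by
  have hαpt := hα hpt
  have hne := hpt.ne
  have hd : 0 < 2 * k + (α p - α t) := by omega
  refine ⟨hpt, hk, ?_, ?_, ?_, ?_, ?_, ?_, ?_⟩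
  · intro r s hrs hne j
    simp only [pairCoeffs]
    rw [diagCoeffs_ne _ hne, if_neg, add_zero]
    rintro ⟨⟨rfl, rfl⟩ | ⟨rfl, rfl⟩, -⟩ <;> simp at hrs
  · intro r hrp hrt
    simp only [pairCoeffs, diagCoeffs_self, hrp, hrt]
    refine ⟨by simp, fun j hj => ?_⟩
    simp [show j ≠ 0 by omega]
  · intro j
    simp only [pairCoeffs]
    rw [diagCoeffs_ne _ hne.symm]
    by_cases hj : j = k
    · subst hj; simp
    · simp [hj]
  · intro j
    simp only [pairCoeffs]
    rw [diagCoeffs_ne _ hne]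
    by_cases hj : j = k
    · subst hj; simp [hA]
    · simp [hj]
  · intro i
    simp only [pairCoeffs, diagCoeffs_self]
    simp only [true_or, if_true, Nat.mul_div_cancel _ hd, hne, false_and, and_false, or_self,
      if_false, add_zero, hA]
    rw [if_pos (Dvd.intro_left i rfl)]
    congr 2
    rw [pow_succ, mul_neg_one, neg_smul, Matrix.neg_mul, neg_neg, Matrix.smul_mul]
  · intro i
    simp only [pairCoeffs, diagCoeffs_self]
    simp only [or_true, if_true, Nat.mul_div_cancel _ hd, hne.symm, false_and, and_false, or_self,
      if_false, add_zero, hA]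
    rw [if_pos (Dvd.intro_left i rfl)]
    congr 2
    rw [pow_succ, mul_neg_one, neg_smul, Matrix.mul_neg, neg_neg, Matrix.mul_smul]
    simp only [Matrix.mul_assoc]
  · intro j hj
    simp [pairCoeffs, diagCoeffs_self, hj, hne, hne.symm]

/-- The diagonal corrections of the off-diagonal generator start at index `2k + (α p - α t)`, hence
in twice the degree of the off-diagonal entries, and do not affect the leading part. -/
theorem isLeadingPart_pair (hα : StrictAnti α) (hpos : ∀ r, 0 < α r)
    (hBu : ∀ r, IsUnit (B r)) (hB : ∀ r, (B r)ᵀ = (-1 : ℂ) ^ (α r + 1) • B r)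
    {A : Coeffs m} {p t : Fin N} {k : ℕ} (hpt : p < t) (hk : k < α t)
    (hA : A p t k = (-1 : ℂ) ^ (k + 1) • ((B p)⁻¹ * (A t p k)ᵀ * B t)) :
    IsLeadingPart (Subgroup.closure (diagonalGenerators α B ∪ offDiagonalGenerators α B))
      (coeffDegree α p t k) (blockToeplitz α fun r s j =>
        if (r = t ∧ s = p ∨ r = p ∧ s = t) ∧ j = k then A r s j else 0) := by
  have hoff := isOffDiagonal_pairCoeffs (B := B) hα hpt hk hA
  obtain ⟨X, -, hX⟩ := exists_mem_autGroup B hBu (hoff.form_eq hα hpos hBu hB)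
  have hαpt := hα hpt
  have hdeg : coeffDegree α p t k = ((2 * k + (α p - α t) : ℕ) : ℤ) := by
    rw [coeffDegree, abs_of_nonneg (by omega)]; omega
  refine ⟨?_, X, Subgroup.subset_closure (Or.inr ?_), ?_⟩
  · refine hasDegree_blockToeplitz fun r s j _ _ hj => if_neg ?_
    rintro ⟨⟨rfl, rfl⟩ | ⟨rfl, rfl⟩, rfl⟩
    · simp only [coeffDegree] at hj
      rw [abs_sub_comm] at hj; exact lt_irrefl _ hj
    · exact lt_irrefl _ hj
  · rw [mem_offDiagonalGenerators_iff hBu]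
    exact ⟨p, t, k, _, _, hoff, hX⟩
  · rw [hX, ← blockToeplitz_diagCoeffs_one, ← blockToeplitz_sub, ← blockToeplitz_sub]
    refine hasDegree_blockToeplitz fun r s j _ _ hj => ?_
    simp only [Pi.sub_apply, pairCoeffs]
    by_cases hrs : r = s
    · subst hrs
      rw [diagCoeffs_self, diagCoeffs_self, add_sub_right_comm, add_sub_cancel_right]
      rw [hdeg, coeffDegree, sub_self, abs_zero, add_zero] at hj
      have hj' : j < 2 * k + (α p - α t) := by omega
      by_cases hr : r = p ∨ r = t
      · rw [if_pos hr]
        by_cases hj0 : j = 0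
        · subst hj0; simp [sqrtSeries]
        · rw [if_neg (fun h => hj0 (Nat.eq_zero_of_dvd_of_lt h hj')), if_neg hj0, sub_zero]
      · rw [if_neg hr, sub_self]
    · rw [diagCoeffs_ne _ hrs, diagCoeffs_ne _ hrs]; simp

/-- Take a diagonal generator whose only nonzero parameter is `Z_{j₀} = B A_{j₀}`: then `W_j = 0`
for `1 ≤ j < j₀` and `W_{j₀} = A_{j₀}`, while later terms have higher degree. -/
theorem isLeadingPart_diag (hpos : ∀ r, 0 < α r)
    (hBu : ∀ r, IsUnit (B r)) (hB : ∀ r, (B r)ᵀ = (-1 : ℂ) ^ (α r + 1) • B r)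
    {A : Coeffs m} {j₀ : ℕ} (hj₀ : 1 ≤ j₀)
    (hA : ∀ r, j₀ < α r → B r * A r r j₀ + (-1 : ℂ) ^ j₀ • ((A r r j₀)ᵀ * B r) = 0) :
    IsLeadingPart (Subgroup.closure (diagonalGenerators α B ∪ offDiagonalGenerators α B))
      (2 * (j₀ : ℤ)) (blockToeplitz α fun r s j => if r = s ∧ j = j₀ then A r s j else 0) := by
  set Z : (r : Fin N) → ℕ → Matrix (Fin (m r)) (Fin (m r)) ℂ := fun r j =>
    if j = j₀ then B r * A r r j₀ else 0 with hZdef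
  set W : (r : Fin N) → ℕ → Matrix (Fin (m r)) (Fin (m r)) ℂ := fun r => diagonalSeq (B r) (Z r)
    with hWdef
  have hZ : ∀ r j, 1 ≤ j → j < α r → Z r j = (-1 : ℂ) ^ (α r + j) • (Z r j)ᵀ := by
    intro r j _ hj
    simp only [hZdef]
    split_ifs with h
    · subst h
      have h1 := eq_neg_of_add_eq_zero_left (hA r hj)
      conv_lhs => rw [h1]
      rw [Matrix.transpose_mul, hB, Matrix.mul_smul, smul_smul, ← pow_add,
        show α r + j + (α r + 1) = j + 1 + 2 * α r by ring, pow_add, pow_succ, pow_mul]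
      simp
    · simp
  have hW0 : ∀ r, W r 0 = 1 := fun r => diagonalSeq_zero _ _
  have hW : ∀ r j, 1 ≤ j → j < α r →
      W r j = (B r)⁻¹ * (Z r j - (1 / 2 : ℂ) •
        ∑ k ∈ Finset.Ico 1 j, (-1 : ℂ) ^ k • ((W r k)ᵀ * B r * W r (j - k))) :=
    fun r j hj _ => diagonalSeq_eq _ _ hj
  have hZlt : ∀ r j, 1 ≤ j → j < j₀ → Z r j = 0 := fun r j _ hj => if_neg hj.ne
  obtain ⟨X, -, hX⟩ := exists_mem_autGroup B hBu (diagonalGenerator_form hpos hBu hB hZ hW0 hW)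
  refine ⟨?_, X, Subgroup.subset_closure (Or.inl ⟨Z, W, hZ, hW0, hW, ?_⟩), ?_⟩
  · refine hasDegree_blockToeplitz fun r s j _ _ hj => if_neg ?_
    rintro ⟨rfl, rfl⟩
    simp [coeffDegree] at hj
  · rw [hX, blockToeplitz_diagCoeffs]
  · rw [hX, ← blockToeplitz_diagCoeffs_one, ← blockToeplitz_sub, ← blockToeplitz_sub]
    refine hasDegree_blockToeplitz fun r s j _ _ hj => ?_
    simp only [Pi.sub_apply]
    by_cases hrs : r = s
    · subst hrs
      rw [diagCoeffs_self, diagCoeffs_self]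
      rw [coeffDegree, sub_self, abs_zero, add_zero] at hj
      by_cases hj0 : j = 0
      · subst hj0; simp [hW0, show (0 : ℕ) ≠ j₀ by omega]
      · rw [if_neg hj0, sub_zero]
        by_cases hjj : j = j₀
        · subst hjj
          simp only [hWdef]
          rw [diagonalSeq_self _ hj₀ (hZlt r)]
          simp only [hZdef, if_true, and_self]
          rw [← Matrix.mul_assoc,
            Matrix.nonsing_inv_mul _ ((Matrix.isUnit_iff_isUnit_det _).mp (hBu r)), Matrix.one_mul,
            sub_self]
        · simp only [hWdef]
          rw [diagonalSeq_of_lt _ (hZlt r) j (by omega) (by omega)]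
          simp [hjj]
    · rw [diagCoeffs_ne _ hrs, diagCoeffs_ne _ hrs]; simp [hrs]

theorem closure_generators_le (hα : StrictAnti α) (hpos : ∀ r, 0 < α r)
    (hBu : ∀ r, IsUnit (B r)) (hB : ∀ r, (B r)ᵀ = (-1 : ℂ) ^ (α r + 1) • B r) 
    {X : GL (BlockIdx α m) ℂ} (hX : X ∈ diagonalGenerators α B ∪ offDiagonalGenerators α B) :
    X ∈ autGroup (blockShift α m) (formMat α B) ∧
      HasDegree 1 ((X : Matrix (BlockIdx α m) (BlockIdx α m) ℂ) - 1) := by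
  suffices h : ∃ A : Coeffs m, (X : Matrix (BlockIdx α m) (BlockIdx α m) ℂ) = blockToeplitz α A ∧
      (blockToeplitz α A)ᵀ * formMat α B * blockToeplitz α A = formMat α B ∧ ∀ r, A r r 0 = 1 by
    obtain ⟨A, hXA, hA, hA0⟩ := h
    refine ⟨⟨?_, ?_⟩, ?_⟩
    · rw [hXA]; exact blockToeplitz_commute_blockShift A
    · rw [hXA]; exact hA
    · rw [hXA, ← blockToeplitz_diagCoeffs_one, ← blockToeplitz_sub]
      refine hasDegree_one_blockToeplitz hα fun r => ?_
      simp [hA0]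
  rcases hX with ⟨Z, W, hZ, hW0, hW, hX⟩ | hX
  · exact ⟨diagCoeffs W, by rw [hX, blockToeplitz_diagCoeffs],
      diagonalGenerator_form hpos hBu hB hZ hW0 hW, fun r => by simp [hW0]⟩
  · rw [mem_offDiagonalGenerators_iff hBu] at hX
    obtain ⟨p, t, k, F, A, hA, hXA⟩ := hX
    refine ⟨A, hXA, hA.form_eq hα hpos hBu hB, fun r => ?_⟩
    by_cases hrp : r = p
    · subst hrp; simpa [sqrtSeries] using hA.pp 0
    by_cases hrt : r = t
    · subst hrt; simpa [sqrtSeries] using hA.tt 0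
    exact (hA.other r hrp hrt).1

theorem hasDegree_zero_of_mem_autGroup {G : Matrix (BlockIdx α m) (BlockIdx α m) ℂ}
    {X : GL (BlockIdx α m) ℂ} (hX : X ∈ autGroup (blockShift α m) G) :
    HasDegree 0 (X : Matrix (BlockIdx α m) (BlockIdx α m) ℂ) := by
  rw [eq_blockToeplitz_coeffsOf hX.1]; exact hasDegree_zero_blockToeplitz _

variable (α B) in
/-- The subgroup of the automorphisms whose diagonal coefficients `A_0^{rr}` are the identity. -/
def unipotentSubgroup : Subgroup (GL (BlockIdx α m) ℂ) where
  carrier := {X | X ∈ autGroup (blockShift α m) (formMat α B) ∧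
    HasDegree 1 ((X : Matrix (BlockIdx α m) (BlockIdx α m) ℂ) - 1)}
  one_mem' := ⟨Subgroup.one_mem _, by simpa using HasDegree.zero⟩
  mul_mem' := by
    rintro X Y ⟨hX, hX'⟩ ⟨hY, hY'⟩
    refine ⟨Subgroup.mul_mem _ hX hY, ?_⟩
    have e : ((X * Y : GL (BlockIdx α m) ℂ) : Matrix (BlockIdx α m) (BlockIdx α m) ℂ) - 1 =
        ((X : Matrix (BlockIdx α m) (BlockIdx α m) ℂ) - 1) * (Y : Matrix _ _ ℂ) +
          ((Y : Matrix _ _ ℂ) - 1) := by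
      rw [Units.val_mul]; noncomm_ring
    rw [e]
    exact ((hX'.mul (hasDegree_zero_of_mem_autGroup hY)).mono (by simp)).add hY'
  inv_mem' := by
    rintro X ⟨hX, hX'⟩
    refine ⟨Subgroup.inv_mem _ hX, ?_⟩
    have e : ((X⁻¹ : GL (BlockIdx α m) ℂ) : Matrix (BlockIdx α m) (BlockIdx α m) ℂ) - 1 =
        -(((X⁻¹ : GL (BlockIdx α m) ℂ) : Matrix (BlockIdx α m) (BlockIdx α m) ℂ) *
          ((X : Matrix (BlockIdx α m) (BlockIdx α m) ℂ) - 1)) := by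
      rw [Matrix.mul_sub, X.inv_mul, Matrix.mul_one, neg_sub]
    rw [e]
    exact (((hasDegree_zero_of_mem_autGroup (Subgroup.inv_mem _ hX)).mul hX').mono (by simp)).neg

/-- The degree `d` part of `X - 1` solves the linearized equation, which couples only the
coefficients at `(r, s, q)` and `(s, r, q)`. It therefore splits into a diagonal part and one part
for each pair `p < t`, all of which are leading parts of generators. -/
theorem isLeadingPart_of_mem (hα : StrictAnti α) (hpos : ∀ r, 0 < α r)
    (hBu : ∀ r, IsUnit (B r)) (hB : ∀ r, (B r)ᵀ = (-1 : ℂ) ^ (α r + 1) • B r)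
    {X : GL (BlockIdx α m) ℂ} (hX : X ∈ autGroup (blockShift α m) (formMat α B)) {d : ℤ}
    (hd : 1 ≤ d) (hdeg : HasDegree d ((X : Matrix (BlockIdx α m) (BlockIdx α m) ℂ) - 1)) :
    ∃ M, IsLeadingPart (Subgroup.closure (diagonalGenerators α B ∪ offDiagonalGenerators α B)) d M ∧
      HasDegree (d + 1) ((X : Matrix (BlockIdx α m) (BlockIdx α m) ℂ) - 1 - M) := by
  set A := coeffsOf (X : Matrix (BlockIdx α m) (BlockIdx α m) ℂ) -
    diagCoeffs fun r j => if j = 0 then 1 else 0 with hA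
  have hXA : (X : Matrix (BlockIdx α m) (BlockIdx α m) ℂ) - 1 = blockToeplitz α A := by
    rw [hA, blockToeplitz_sub, ← eq_blockToeplitz_coeffsOf hX.1, blockToeplitz_diagCoeffs_one]
  have hX1 : (X : Matrix (BlockIdx α m) (BlockIdx α m) ℂ) = 1 + blockToeplitz α A := by
    rw [← hXA]; abel
  rw [hXA] at hdeg ⊢
  have hlie : ∀ {r s : Fin N}, r ≤ s → ∀ {q : ℕ}, q < α s → coeffDegree α r s q = d →
      B r * A r s q + (-1 : ℂ) ^ q • ((A s r q)ᵀ * B s) = 0 := by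
    intro r s hrs q hq hqd
    exact leading_lie_eq B hα hpos hB hd hdeg (by rw [← hX1]; exact hX.2) hrs hq hqd
  set P : Fin N → Fin N → Coeffs m := fun p t r s j =>
    if p < t ∧ (r = t ∧ s = p ∨ r = p ∧ s = t) ∧ coeffDegree α r s j = d then A r s j else 0 with hP
  set D : Coeffs m := fun r s j => if r = s ∧ coeffDegree α r s j = d then A r s j else 0 with hD
  have hPlead : ∀ p t, IsLeadingPart
      (Subgroup.closure (diagonalGenerators α B ∪ offDiagonalGenerators α B)) d
      (blockToeplitz α (P p t)) := by
    intro p t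
    -- For a given pair at most one index `k` has degree `d`; without such an index the part is zero
    -- as a matrix.
    by_cases hex : p < t ∧ ∃ k, k < α t ∧ coeffDegree α p t k = d
    · obtain ⟨hpt, k, hk, hkd⟩ := hex
      have hAk : A p t k = (-1 : ℂ) ^ (k + 1) • ((B p)⁻¹ * (A t p k)ᵀ * B t) := by
        have h1 := eq_neg_of_add_eq_zero_left (hlie hpt.le hk hkd)
        calc A p t k = (B p)⁻¹ * (B p * A p t k) := by
              rw [← Matrix.mul_assoc,
                Matrix.nonsing_inv_mul _ ((Matrix.isUnit_iff_isUnit_det _).mp (hBu p)),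
                Matrix.one_mul]
          _ = _ := by
              rw [h1, pow_succ, mul_neg_one, neg_smul, Matrix.mul_neg, Matrix.mul_smul,
                Matrix.mul_assoc]
      have := isLeadingPart_pair hα hpos hBu hB hpt hk hAk
      rw [hkd] at this
      have e : P p t = fun r s j =>
          if (r = t ∧ s = p ∨ r = p ∧ s = t) ∧ j = k then A r s j else 0 := by
        funext r s j
        simp only [hP]
        congr 1
        apply propext
        constructor
        · rintro ⟨-, h1, h2⟩
          refine ⟨h1, ?_⟩
          rw [← hkd] at h2
          rcases h1 with ⟨rfl, rfl⟩ | ⟨rfl, rfl⟩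
          · simp only [coeffDegree] at h2
            rw [abs_sub_comm] at h2; omega
          · simp only [coeffDegree] at h2; omega
        · rintro ⟨h1, rfl⟩
          refine ⟨hpt, h1, ?_⟩
          rcases h1 with ⟨rfl, rfl⟩ | ⟨rfl, rfl⟩
          · rw [← hkd]; simp only [coeffDegree]; rw [abs_sub_comm]
          · exact hkd
      rw [e]; exact this
    · have e : blockToeplitz α (P p t) = blockToeplitz α (0 : Coeffs m) := by
        rw [blockToeplitz_eq_iff hpos]
        intro r s j hr hs
        refine if_neg ?_
        rintro ⟨hpt, h1, h2⟩
        refine hex ⟨hpt, j, ?_, ?_⟩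
        · rcases h1 with ⟨rfl, rfl⟩ | ⟨rfl, rfl⟩ <;> assumption
        · rcases h1 with ⟨rfl, rfl⟩ | ⟨rfl, rfl⟩
          · rw [← h2]; simp only [coeffDegree]; rw [abs_sub_comm]
          · exact h2
      rw [e, blockToeplitz_zero]
      exact IsLeadingPart.zero
  have hDlead : IsLeadingPart
      (Subgroup.closure (diagonalGenerators α B ∪ offDiagonalGenerators α B)) d
      (blockToeplitz α D) := by
    have hself : ∀ r j, coeffDegree α r r j = 2 * (j : ℤ) := by
      intro r j; simp [coeffDegree]
    by_cases hex : ∃ j : ℕ, d = 2 * (j : ℤ)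
    · obtain ⟨j₀, hj₀⟩ := hex
      have e : D = fun r s j => if r = s ∧ j = j₀ then A r s j else 0 := by
        funext r s j
        simp only [hD]
        congr 1
        apply propext
        refine and_congr_right ?_
        rintro rfl
        rw [hself, hj₀]; omega
      rw [e]
      rw [hj₀]
      exact isLeadingPart_diag hpos hBu hB (by omega) fun r hr =>
        hlie le_rfl hr (by rw [hself, hj₀])
    · have e : D = 0 := by
        funext r s j
        refine if_neg ?_
        rintro ⟨rfl, h⟩
        exact hex ⟨j, by rw [← h, hself]⟩
      rw [e, blockToeplitz_zero]
      exact IsLeadingPart.zero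
  refine ⟨∑ p, ∑ t, blockToeplitz α (P p t) + blockToeplitz α D,
    IsLeadingPart.add hd (IsLeadingPart.sum hd _ _ fun p _ => IsLeadingPart.sum hd _ _
      fun t _ => hPlead p t) hDlead, ?_⟩
  have e : ∑ p, ∑ t, blockToeplitz α (P p t) = blockToeplitz α (∑ p, ∑ t, P p t) := by
    rw [blockToeplitz_sum]
    exact Finset.sum_congr rfl fun p _ => (blockToeplitz_sum _ _).symm
  rw [e, ← blockToeplitz_add, ← blockToeplitz_sub]
  refine hasDegree_blockToeplitz fun r s j hr hs hlt => ?_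
  simp only [Pi.sub_apply, Pi.add_apply, Finset.sum_apply]
  rcases (Int.lt_add_one_iff.mp hlt).lt_or_eq with h | h
  · rw [hdeg.coeff_eq_zero r s j hr hs h, Finset.sum_eq_zero]
    · simp [hD, h.ne]
    · intro p _
      exact Finset.sum_eq_zero fun t _ => by simp [hP, h.ne]
  · rcases lt_trichotomy r s with hrs | hrs | hrs
    · rw [Finset.sum_eq_single r, Finset.sum_eq_single s]
      · simp [hP, hD, h, hrs, hrs.ne]
      · intro t _ ht
        refine if_neg ?_
        rintro ⟨h1, ⟨h2, h3⟩ | ⟨h2, h3⟩, -⟩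
        · exact hrs.ne h3.symm
        · exact ht h3.symm
      · simp
      · intro p _ hp
        refine Finset.sum_eq_zero fun t _ => if_neg ?_
        rintro ⟨h1, ⟨h2, h3⟩ | ⟨h2, h3⟩, -⟩
        · rw [← h2, ← h3] at h1; exact lt_asymm h1 hrs
        · exact hp h2.symm
      · simp
    · subst hrs
      rw [Finset.sum_eq_zero]
      · simp [hD, h]
      · intro p _
        refine Finset.sum_eq_zero fun t _ => if_neg ?_
        rintro ⟨h1, ⟨h2, h3⟩ | ⟨h2, h3⟩, -⟩
        · exact h1.ne (h3.symm.trans h2)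
        · exact h1.ne (h2.symm.trans h3)
    · rw [Finset.sum_eq_single s, Finset.sum_eq_single r]
      · simp [hP, hD, h, hrs, hrs.ne']
      · intro t _ ht
        refine if_neg ?_
        rintro ⟨h1, ⟨h2, h3⟩ | ⟨h2, h3⟩, -⟩
        · exact ht h2.symm
        · exact hrs.ne' h2
      · simp
      · intro p _ hp
        refine Finset.sum_eq_zero fun t _ => if_neg ?_
        rintro ⟨h1, ⟨h2, h3⟩ | ⟨h2, h3⟩, -⟩
        · exact hp h3.symm
        · rw [← h2, ← h3] at h1; exact lt_asymm h1 hrs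
      · simp

/-- Dividing `X` by an element of the closure with the same leading part raises the degree of `X -
1` by one; beyond the degree bound only `X = 1` is left. -/
theorem unipotentSubgroup_eq_closure (hα : StrictAnti α) (hpos : ∀ r, 0 < α r)
    (hBu : ∀ r, IsUnit (B r)) (hB : ∀ r, (B r)ᵀ = (-1 : ℂ) ^ (α r + 1) • B r) :
    unipotentSubgroup α B =
      Subgroup.closure (diagonalGenerators α B ∪ offDiagonalGenerators α B) := by
  have hle : Subgroup.closure (diagonalGenerators α B ∪ offDiagonalGenerators α B) ≤
      unipotentSubgroup α B := by
    rw [Subgroup.closure_le]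
    exact fun X hX => closure_generators_le hα hpos hBu hB hX
  refine le_antisymm ?_ hle
  obtain ⟨n, hn⟩ := HasDegree.exists_eq_zero α m
  have key : ∀ (e : ℕ) (d : ℤ), 1 ≤ d → (n : ℤ) ≤ d + e → ∀ X : GL (BlockIdx α m) ℂ,
      X ∈ autGroup (blockShift α m) (formMat α B) →
      HasDegree d ((X : Matrix (BlockIdx α m) (BlockIdx α m) ℂ) - 1) →
      X ∈ Subgroup.closure (diagonalGenerators α B ∪ offDiagonalGenerators α B) := by
    intro e
    induction e with
    | zero =>
      intro d hd hnd X hX hdeg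
      have h1 := hn _ (hdeg.mono (by simpa using hnd))
      have h2 : X = 1 := Units.ext (sub_eq_zero.mp h1)
      rw [h2]; exact Subgroup.one_mem _
    | succ e ih =>
      intro d hd hnd X hX hdeg
      obtain ⟨M, ⟨-, g, hg, hgM⟩, hXM⟩ := isLeadingPart_of_mem hα hpos hBu hB hX hd hdeg
      have hgaut := (hle hg).1
      have h1 : g⁻¹ * X ∈ Subgroup.closure
          (diagonalGenerators α B ∪ offDiagonalGenerators α B) := by
        refine ih (d + 1) (by omega) (by push_cast at hnd; omega) _
          (Subgroup.mul_mem _ (Subgroup.inv_mem _ hgaut) hX) ?_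
        have e1 : ((g⁻¹ * X : GL (BlockIdx α m) ℂ) : Matrix (BlockIdx α m) (BlockIdx α m) ℂ) - 1 =
            ((g⁻¹ : GL (BlockIdx α m) ℂ) : Matrix (BlockIdx α m) (BlockIdx α m) ℂ) *
              (((X : Matrix (BlockIdx α m) (BlockIdx α m) ℂ) - 1 - M) -
                ((g : Matrix (BlockIdx α m) (BlockIdx α m) ℂ) - 1 - M)) := by
          rw [sub_sub_sub_cancel_right, sub_sub_sub_cancel_right, Matrix.mul_sub, g.inv_mul,
            Units.val_mul]
        rw [e1]
        exact ((hasDegree_zero_of_mem_autGroup (Subgroup.inv_mem _ hgaut)).mul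
          (hXM.sub hgM)).mono (by simp)
      have h2 : X = g * (g⁻¹ * X) := by group
      rw [h2]
      exact Subgroup.mul_mem _ hg h1
  exact fun X hX => key n 1 le_rfl (by omega) X hX.1 hX.2

end generation

/-! ### The semidirect decomposition -/

section semidirect

variable {N : ℕ} {α m : Fin N → ℕ} {B : (r : Fin N) → Matrix (Fin (m r)) (Fin (m r)) ℂ}

theorem blockKron_one_mul_one (Q Q' : (r : Fin N) → Matrix (Fin (m r)) (Fin (m r)) ℂ) :
    blockKron (fun r => (1 : Matrix (Fin (α r)) (Fin (α r)) ℂ)) Q * blockKron (fun _ => 1) Q' =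
      blockKron (fun r => (1 : Matrix (Fin (α r)) (Fin (α r)) ℂ)) fun r => Q r * Q' r := by
  rw [blockKron_mul]; simp

theorem coeff_zero_form (hα : StrictAnti α) (hpos : ∀ r, 0 < α r)
    (hB : ∀ r, (B r)ᵀ = (-1 : ℂ) ^ (α r + 1) • B r) {X : GL (BlockIdx α m) ℂ}
    (hX : X ∈ autGroup (blockShift α m) (formMat α B)) (r : Fin N) :
    (coeffsOf (X : Matrix (BlockIdx α m) (BlockIdx α m) ℂ) r r 0)ᵀ * B r *
      coeffsOf (X : Matrix (BlockIdx α m) (BlockIdx α m) ℂ) r r 0 = B r := by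
  have h := hX.2
  rw [eq_blockToeplitz_coeffsOf hX.1, blockToeplitz_form_eq_iff B hpos hB] at h
  rw [← formCoeff_diag_zero B _ hα hpos]
  exact h.1 r

theorem isUnit_of_form_eq {n : ℕ} {G Q : Matrix (Fin n) (Fin n) ℂ} (hG : IsUnit G)
    (h : Qᵀ * G * Q = G) : IsUnit Q := by
  obtain ⟨G', hG'⟩ := hG.exists_left_inv
  exact isUnit_iff_exists_inv'.mpr ⟨G' * (Qᵀ * G), by rw [Matrix.mul_assoc, h, hG']⟩

theorem autGroup_subset_toeplitzSet (hα : StrictAnti α) (hpos : ∀ r, 0 < α r)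
    (hBu : ∀ r, IsUnit (B r)) (hB : ∀ r, (B r)ᵀ = (-1 : ℂ) ^ (α r + 1) • B r) :
    (autGroup (blockShift α m) (formMat α B) : Set (GL (BlockIdx α m) ℂ)) ⊆ toeplitzSet α m :=
  fun X hX => ⟨coeffsOf (X : Matrix (BlockIdx α m) (BlockIdx α m) ℂ),
    fun r => isUnit_of_form_eq (hBu r) (coeff_zero_form hα hpos hB hX r),
    eq_blockToeplitz_coeffsOf hX.1⟩

variable (α) in
/-- The group of the block diagonal matrices `⊕_r (Q_r ⊕ ⋯ ⊕ Q_r)`. -/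
def pseudoOrthogonalGroup (hBu : ∀ r, IsUnit (B r)) : Subgroup (GL (BlockIdx α m) ℂ) where
  carrier := pseudoOrthogonalSet α B
  one_mem' := ⟨fun r => 1, by simp, blockKron_one.symm⟩
  mul_mem' := by
    rintro X Y ⟨Q, hQ, hX⟩ ⟨Q', hQ', hY⟩
    refine ⟨fun r => Q r * Q' r, fun r => ?_, ?_⟩
    · calc (Q r * Q' r)ᵀ * B r * (Q r * Q' r) = (Q' r)ᵀ * ((Q r)ᵀ * B r * Q r) * Q' r := by
            rw [Matrix.transpose_mul]; simp only [Matrix.mul_assoc]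
        _ = B r := by rw [hQ, hQ']
    · rw [Units.val_mul, hX, hY]
      exact blockKron_one_mul_one Q Q'
  inv_mem' := by
    rintro X ⟨Q, hQ, hX⟩
    have hQu : ∀ r, IsUnit (Q r).det := fun r =>
      (Matrix.isUnit_iff_isUnit_det _).mp (isUnit_of_form_eq (hBu r) (hQ r))
    refine ⟨fun r => (Q r)⁻¹, fun r => ?_, ?_⟩
    · have h1 := Matrix.mul_nonsing_inv _ (hQu r)
      have h2 : ((Q r)⁻¹)ᵀ * (Q r)ᵀ = 1 := by rw [← Matrix.transpose_mul, h1, Matrix.transpose_one]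
      calc ((Q r)⁻¹)ᵀ * B r * (Q r)⁻¹ = (((Q r)⁻¹)ᵀ * (Q r)ᵀ) * B r * (Q r * (Q r)⁻¹) := by
            conv_lhs => rw [← hQ r]
            simp only [Matrix.mul_assoc]
        _ = B r := by rw [h1, h2, Matrix.one_mul, Matrix.mul_one]
    · have h1 : (X : Matrix (BlockIdx α m) (BlockIdx α m) ℂ) *
          blockKron (fun r => (1 : Matrix (Fin (α r)) (Fin (α r)) ℂ)) (fun r => (Q r)⁻¹) = 1 := by
        rw [hX]
        refine (blockKron_one_mul_one Q _).trans ?_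
        simp only [fun r => Matrix.mul_nonsing_inv _ (hQu r)]
        exact blockKron_one
      calc ((X⁻¹ : GL (BlockIdx α m) ℂ) : Matrix (BlockIdx α m) (BlockIdx α m) ℂ)
          = ((X⁻¹ : GL (BlockIdx α m) ℂ) : Matrix (BlockIdx α m) (BlockIdx α m) ℂ) * (X *
              blockKron (fun r => (1 : Matrix (Fin (α r)) (Fin (α r)) ℂ)) (fun r => (Q r)⁻¹)) := by
            rw [h1, Matrix.mul_one]
        _ = _ := by rw [← Matrix.mul_assoc, X.inv_mul, Matrix.one_mul]; rfl

theorem mem_autGroup_of_mem_pseudoOrthogonalSet {X : GL (BlockIdx α m) ℂ}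
    (hX : X ∈ pseudoOrthogonalSet α B) : X ∈ autGroup (blockShift α m) (formMat α B) := by
  obtain ⟨Q, hQ, hX⟩ := hX
  constructor
  · rw [hX, ← blockToeplitz_diagCoeffs_const]
    exact blockToeplitz_commute_blockShift _
  · have hX' : (X : Matrix (BlockIdx α m) (BlockIdx α m) ℂ) = blockKron (fun r => 1) Q := hX
    rw [hX', blockKron_transpose, formMat, blockKron_mul, blockKron_mul]
    congr 1
    · funext r; simp
    · funext r; exact hQ r

/-- Automorphisms have degree zero, so conjugation preserves the condition that `V - 1` has degree
one. The complement is found by reading off the `A_0^{rr}`, which are `B_r`-orthogonal by the `q =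
0` equations: the block diagonal matrix built from them differs from `X` in degree one only. -/
theorem isInternalSemidirect_autGroup (hα : StrictAnti α) (hpos : ∀ r, 0 < α r)
    (hBu : ∀ r, IsUnit (B r)) (hB : ∀ r, (B r)ᵀ = (-1 : ℂ) ^ (α r + 1) • B r) :
    IsInternalSemidirect (autGroup (blockShift α m) (formMat α B)) (pseudoOrthogonalGroup α hBu)
      (unipotentSubgroup α B) := by
  have hO : pseudoOrthogonalGroup α hBu ≤ autGroup (blockShift α m) (formMat α B) :=
    fun X hX => mem_autGroup_of_mem_pseudoOrthogonalSet hX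
  have hV : unipotentSubgroup α B ≤ autGroup (blockShift α m) (formMat α B) := fun X hX => hX.1
  refine ⟨hO, hV, ⟨?_⟩, Subgroup.isComplement'_of_disjoint_and_mul_eq_univ ?_ ?_⟩
  · rintro ⟨V, hVaut⟩ hVu ⟨X, hX⟩
    rw [Subgroup.mem_subgroupOf] at hVu ⊢
    refine ⟨Subgroup.mul_mem _ (Subgroup.mul_mem _ hX hVaut) (Subgroup.inv_mem _ hX), ?_⟩
    have e : ((X * V * X⁻¹ : GL (BlockIdx α m) ℂ) : Matrix (BlockIdx α m) (BlockIdx α m) ℂ) - 1 =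
        (X : Matrix (BlockIdx α m) (BlockIdx α m) ℂ) *
          ((V : Matrix (BlockIdx α m) (BlockIdx α m) ℂ) - 1) *
          ((X⁻¹ : GL (BlockIdx α m) ℂ) : Matrix (BlockIdx α m) (BlockIdx α m) ℂ) := by
      rw [Matrix.mul_sub, Matrix.sub_mul, Matrix.mul_one, X.mul_inv, Units.val_mul, Units.val_mul]
    exact e ▸ (((hasDegree_zero_of_mem_autGroup hX).mul hVu.2).mul
      (hasDegree_zero_of_mem_autGroup (Subgroup.inv_mem _ hX))).mono (by simp)
  · rw [Subgroup.disjoint_def]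
    rintro ⟨X, hX⟩ hXO hXV
    rw [Subgroup.mem_subgroupOf] at hXO hXV
    obtain ⟨Q, hQ, hXQ⟩ := hXO
    have h1 := hXV.2
    simp only at hXQ h1
    rw [hXQ, ← blockToeplitz_diagCoeffs_const, ← blockToeplitz_diagCoeffs_one,
      ← blockToeplitz_sub] at h1
    have h2 : ∀ r, Q r = 1 := by
      intro r
      have := h1.coeff_eq_zero r r 0 (hpos r) (hpos r) (by simp [coeffDegree])
      simpa [sub_eq_zero] using this
    have h3 : X = 1 := by
      apply Units.ext
      rw [hXQ]
      simp only [h2]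
      exact blockKron_one
    exact Subtype.ext h3
  · rw [Set.eq_univ_iff_forall]
    rintro ⟨X, hX⟩
    set Q : (r : Fin N) → Matrix (Fin (m r)) (Fin (m r)) ℂ := fun r =>
      coeffsOf (X : Matrix (BlockIdx α m) (BlockIdx α m) ℂ) r r 0 with hQ
    have hQB : ∀ r, (Q r)ᵀ * B r * Q r = B r := fun r => coeff_zero_form hα hpos hB hX r
    have hform : (blockToeplitz α (diagCoeffs fun r j => if j = 0 then Q r else 0))ᵀ *
        formMat α B * blockToeplitz α (diagCoeffs fun r j => if j = 0 then Q r else 0) =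
        formMat α B := by
      rw [blockToeplitz_diagCoeffs_const]
      change (blockKron (fun r => 1) Q)ᵀ * formMat α B * blockKron (fun r => 1) Q = _
      rw [blockKron_transpose, formMat, blockKron_mul, blockKron_mul]
      congr 1
      · funext r; simp
      · funext r; exact hQB r
    obtain ⟨O, hO', hOQ⟩ := exists_mem_autGroup B hBu hform
    have hOmem : O ∈ pseudoOrthogonalGroup α hBu :=
      ⟨Q, hQB, by rw [hOQ, blockToeplitz_diagCoeffs_const]⟩
    have hVmem : O⁻¹ * X ∈ unipotentSubgroup α B := by
      refine ⟨Subgroup.mul_mem _ (Subgroup.inv_mem _ hO') hX, ?_⟩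
      have e : ((O⁻¹ * X : GL (BlockIdx α m) ℂ) : Matrix (BlockIdx α m) (BlockIdx α m) ℂ) - 1 =
          ((O⁻¹ : GL (BlockIdx α m) ℂ) : Matrix (BlockIdx α m) (BlockIdx α m) ℂ) *
            ((X : Matrix (BlockIdx α m) (BlockIdx α m) ℂ) -
              (O : Matrix (BlockIdx α m) (BlockIdx α m) ℂ)) := by
        rw [Matrix.mul_sub, O.inv_mul, Units.val_mul]
      have h1 : HasDegree 1 ((X : Matrix (BlockIdx α m) (BlockIdx α m) ℂ) -
              (O : Matrix (BlockIdx α m) (BlockIdx α m) ℂ)) := by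
        rw [hOQ, eq_blockToeplitz_coeffsOf hX.1, ← blockToeplitz_sub]
        exact hasDegree_one_blockToeplitz hα fun r => by simp [hQ]
      rw [e]
      exact ((hasDegree_zero_of_mem_autGroup (Subgroup.inv_mem _ hO')).mul h1).mono (by simp)
    refine Set.mem_mul.mpr ⟨⟨O, hO'⟩, ?_, ⟨O⁻¹ * X, hVmem.1⟩, ?_, ?_⟩
    · exact Subgroup.mem_subgroupOf.mpr hOmem
    · exact Subgroup.mem_subgroupOf.mpr hVmem
    · apply Subtype.ext
      simp

end semidirect

/-! ### Exponentials of nilpotent matrices and Sylvester's theorem -/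

section exp

variable {I J : Type*} [Fintype I] [DecidableEq I] [Fintype J] [DecidableEq J]

/-- Put `u = x p(x)` with `p(0) = 1`. Then `x^j = u^j - x^(j+1) q(x)` for a polynomial `q`, so
descending induction from `x^k = 0` shows that `y` commutes with every `x^j`, `j ≥ 1`. -/
theorem commute_of_commute_aeval {R : Type*} [Ring R] [Algebra ℂ R] {x y : R} (hx : IsNilpotent x)
    (p : Polynomial ℂ) (hp : p.coeff 0 = 1) (h : Commute y (Polynomial.aeval x (Polynomial.X * p))) :
    Commute y x := by
  obtain ⟨k, hk⟩ := hx
  have key : ∀ e j : ℕ, 1 ≤ j → k ≤ j + e → Commute y (x ^ j) := by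
    intro e
    induction e with
    | zero =>
      intro j _ hj
      rw [pow_eq_zero_of_le (by omega) hk]
      exact Commute.zero_right y
    | succ e ih =>
      intro j hj hke
      obtain ⟨q, hq⟩ : Polynomial.X ∣ p ^ j - 1 := by
        rw [Polynomial.X_dvd_iff, Polynomial.coeff_sub, Polynomial.coeff_zero_eq_eval_zero,
          Polynomial.eval_pow, ← Polynomial.coeff_zero_eq_eval_zero, hp]
        simp
      have h1 : x ^ j = Polynomial.aeval x (Polynomial.X * p) ^ j -
          x ^ (j + 1) * Polynomial.aeval x q := by
        rw [← map_pow, mul_pow, sub_eq_iff_eq_add.mp hq]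
        simp only [map_mul, map_pow, map_add, map_one, Polynomial.aeval_X]
        rw [pow_succ, mul_add, mul_assoc]; simp
      rw [h1]
      refine (h.pow_right j).sub_right ?_
      rw [Polynomial.aeval_eq_sum_range, Finset.mul_sum]
      refine Commute.sum_right _ _ _ fun i _ => ?_
      rw [mul_smul_comm, ← pow_add]
      exact (ih _ (by omega) (by omega)).smul_right _
  simpa using key k 1 le_rfl (by omega)

theorem exp_of_isNilpotent {M : Matrix I I ℂ} (hM : IsNilpotent M) :
    ∃ p : Polynomial ℂ, p.coeff 0 = 1 ∧
      NormedSpace.exp M = 1 + Polynomial.aeval M (Polynomial.X * p) := by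
  obtain ⟨k, hk⟩ := hM
  refine ⟨∑ i ∈ Finset.range (k + 1), Polynomial.C (((i + 1).factorial : ℂ)⁻¹) * Polynomial.X ^ i,
    ?_, ?_⟩
  · rw [Polynomial.finsetSum_coeff, Finset.sum_eq_single 0]
    · simp
    · intro i _ hi
      simp [Polynomial.coeff_X_pow, hi.symm]
    · simp
  · rw [NormedSpace.exp_eq_tsum ℂ]
    change ∑' n : ℕ, ((n.factorial : ℂ)⁻¹) • M ^ n = _
    rw [tsum_eq_sum (s := Finset.range (k + 2)), Finset.sum_range_succ', map_mul, map_sum,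
      Polynomial.aeval_X, Finset.mul_sum, add_comm]
    · congr 1
      · simp
      · refine Finset.sum_congr rfl fun i _ => ?_
        rw [map_mul, Polynomial.aeval_C, map_pow, Polynomial.aeval_X, pow_succ',
          Algebra.algebraMap_eq_smul_one, Matrix.smul_mul, Matrix.one_mul, Matrix.mul_smul]
    · intro n hn
      rw [pow_eq_zero_of_le _ hk, smul_zero]
      simp at hn; omega

theorem commute_of_commute_exp {M Y : Matrix I I ℂ} (hM : IsNilpotent M)
    (h : Y * NormedSpace.exp M = NormedSpace.exp M * Y) : Y * M = M * Y := by
  obtain ⟨p, hp, hexp⟩ := exp_of_isNilpotent hM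
  refine commute_of_commute_aeval hM p hp ?_
  rw [hexp, Matrix.mul_add, Matrix.add_mul, Matrix.mul_one, Matrix.one_mul] at h
  exact add_left_cancel h

theorem isNilpotent_exp_sub_one {M : Matrix I I ℂ} (hM : IsNilpotent M) :
    IsNilpotent (NormedSpace.exp M - 1) := by
  obtain ⟨p, hp, hexp⟩ := exp_of_isNilpotent hM
  rw [hexp, add_sub_cancel_left, map_mul, Polynomial.aeval_X]
  refine Commute.isNilpotent_mul_right ?_ hM
  have := (Commute.all (Polynomial.X : Polynomial ℂ) p).map (Polynomial.aeval M)
  rwa [Polynomial.aeval_X] at this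

/-- Sylvester's theorem for matrices with one eigenvalue. -/
theorem eq_zero_of_mul_eq_mul {A : Matrix I I ℂ} {B : Matrix J J ℂ} {Y : Matrix I J ℂ} {a b : ℂ}
    (hA : IsNilpotent (A - a • (1 : Matrix I I ℂ))) (hB : IsNilpotent (B - b • (1 : Matrix J J ℂ)))
    (hab : a ≠ b) (h : A * Y = Y * B) : Y = 0 := by
  have h1 : ∀ k : ℕ, (A - a • (1 : Matrix I I ℂ)) ^ k * Y = Y * (B - a • (1 : Matrix J J ℂ)) ^ k := by
    intro k
    induction k with
    | zero => simp
    | succ k ih =>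
      rw [pow_succ, pow_succ', Matrix.mul_assoc, Matrix.sub_mul, h, Matrix.smul_mul, Matrix.one_mul,
        ← Matrix.mul_assoc, Matrix.mul_sub Y, Matrix.mul_smul, Matrix.mul_one]
      have : Y * B - a • Y = Y * (B - a • (1 : Matrix J J ℂ)) := by
        rw [Matrix.mul_sub, Matrix.mul_smul, Matrix.mul_one]
      rw [this, ← Matrix.mul_assoc, ih, Matrix.mul_assoc, Matrix.mul_assoc, ← pow_succ, ← pow_succ']
  -- This is the nonzero scalar `b - a` plus a commuting nilpotent matrix.
  have h2 : IsUnit (B - a • (1 : Matrix J J ℂ)) := by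
    have e : B - a • (1 : Matrix J J ℂ) = (b - a) • (1 : Matrix J J ℂ) +
        (B - b • (1 : Matrix J J ℂ)) := by
      rw [sub_smul]; abel
    rw [e]
    refine hB.isUnit_add_left_of_commute ?_ ?_
    · rw [← Algebra.algebraMap_eq_smul_one]
      exact (IsUnit.mk0 _ (sub_ne_zero.mpr hab.symm)).map _
    · exact (Commute.one_right _).smul_right _
  obtain ⟨k, hk⟩ := hA
  have h3 := h1 k
  rw [hk, Matrix.zero_mul] at h3
  obtain ⟨C, hC⟩ := (h2.pow k).exists_right_inv
  calc Y = Y * (B - a • (1 : Matrix J J ℂ)) ^ k * C := by rw [Matrix.mul_assoc, hC, Matrix.mul_one]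
    _ = 0 := by rw [← h3, Matrix.zero_mul]

open scoped Matrix.Norms.Operator in
theorem exp_hasSum (A : Matrix I I ℂ) :
    HasSum (fun n : ℕ => ((n.factorial : ℂ)⁻¹) • A ^ n) (NormedSpace.exp A) :=
  NormedSpace.exp_series_hasSum_exp' A

/-- Termwise in the power series; `Y` is rectangular because it is applied to the inclusion of an
invariant subspace. -/
theorem exp_mul_eq_mul_exp {A : Matrix I I ℂ} {B : Matrix J J ℂ} {Y : Matrix I J ℂ}
    (h : A * Y = Y * B) : NormedSpace.exp A * Y = Y * NormedSpace.exp B := by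
  have hpow : ∀ n : ℕ, A ^ n * Y = Y * B ^ n := by
    intro n
    induction n with
    | zero => simp
    | succ n ih => rw [pow_succ, Matrix.mul_assoc, h, ← Matrix.mul_assoc, ih, Matrix.mul_assoc,
        ← pow_succ]
  have h1 := (exp_hasSum A).map (Matrix.addMonoidHomMulRight Y)
    (continuous_id.matrix_mul continuous_const)
  have h2 := (exp_hasSum B).map (Matrix.addMonoidHomMulLeft Y)
    (continuous_const.matrix_mul continuous_id)
  have e : (Matrix.addMonoidHomMulRight Y) ∘ (fun n : ℕ => ((n.factorial : ℂ)⁻¹) • A ^ n) =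
      (Matrix.addMonoidHomMulLeft Y) ∘ (fun n : ℕ => ((n.factorial : ℂ)⁻¹) • B ^ n) := by
    funext n
    change (((n.factorial : ℂ)⁻¹) • A ^ n) * Y = Y * (((n.factorial : ℂ)⁻¹) • B ^ n)
    rw [Matrix.smul_mul, hpow, Matrix.mul_smul]
  rw [e] at h1
  exact h1.unique h2

open scoped Matrix.Norms.Operator in
theorem hasDerivAt_exp_transpose_mul (A M : Matrix I I ℂ) :
    HasDerivAt (fun t : ℝ => NormedSpace.exp (t • Aᵀ) * M * NormedSpace.exp (t • A))
      (Aᵀ * M + M * A) 0 := by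
  have h1 := ((hasDerivAt_exp_smul_const (𝕂 := ℝ) Aᵀ 0).mul_const M).mul
    (hasDerivAt_exp_smul_const (𝕂 := ℝ) A 0)
  refine h1.congr_deriv ?_
  simp [NormedSpace.exp_zero]

end exp

/-! ### Isotropy groups and their Lie algebras -/

section isotropy

variable {I J : Type*} [Fintype I] [DecidableEq I] [Fintype J] [DecidableEq J]

theorem mem_isotropyGroup {M : Matrix I I ℂ} {Q : GL I ℂ} : Q ∈ isotropyGroup M ↔
    (Q : Matrix I I ℂ)ᵀ * (Q : Matrix I I ℂ) = 1 ∧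
      (Q : Matrix I I ℂ) * M = M * (Q : Matrix I I ℂ) := by
  change _ ∧ _ ↔ _
  refine and_congr_right fun h => ?_
  have h' : (Q : Matrix I I ℂ) * (Q : Matrix I I ℂ)ᵀ = 1 := mul_eq_one_comm.mp h
  constructor
  · intro h1
    calc (Q : Matrix I I ℂ) * M = (Q : Matrix I I ℂ) * ((Q : Matrix I I ℂ)ᵀ * M * Q) := by rw [h1]
      _ = ((Q : Matrix I I ℂ) * (Q : Matrix I I ℂ)ᵀ) * M * Q := by simp only [Matrix.mul_assoc]
      _ = _ := by rw [h', Matrix.one_mul]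
  · intro h1
    rw [Matrix.mul_assoc, ← h1, ← Matrix.mul_assoc, h, Matrix.one_mul]

theorem isotropyGroup_le_exp (M : Matrix I I ℂ) (c : ℂ) :
    isotropyGroup M ≤ isotropyGroup (c • NormedSpace.exp M) := by
  intro Q hQ
  rw [mem_isotropyGroup] at hQ ⊢
  refine ⟨hQ.1, ?_⟩
  have : Commute (Q : Matrix I I ℂ) M := hQ.2
  rw [Matrix.mul_smul, Matrix.smul_mul]
  exact congrArg _ this.exp_right

theorem isotropyGroup_smul_exp_of_isNilpotent {M : Matrix I I ℂ} (hM : IsNilpotent M) {c : ℂ}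
    (hc : c ≠ 0) : isotropyGroup (c • NormedSpace.exp M) = isotropyGroup M := by
  refine le_antisymm (fun Q hQ => ?_) (isotropyGroup_le_exp M c)
  rw [mem_isotropyGroup] at hQ ⊢
  refine ⟨hQ.1, commute_of_commute_exp hM ?_⟩
  have h := hQ.2
  rw [Matrix.mul_smul, Matrix.smul_mul] at h
  exact smul_right_injective _ hc h

theorem isClosed_isotropyGroup (M : Matrix I I ℂ) :
    IsClosed (isotropyGroup M : Set (GL I ℂ)) := by
  have hc : Continuous fun Q : GL I ℂ => (Q : Matrix I I ℂ) := Units.continuous_val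
  exact (isClosed_eq (hc.matrix_transpose.matrix_mul hc) continuous_const).inter
    (isClosed_eq ((hc.matrix_transpose.matrix_mul continuous_const).matrix_mul hc)
      continuous_const)

/-- The Lie algebra of the isotropy group. -/
def isotropyLie (M : Matrix I I ℂ) : Submodule ℂ (Matrix I I ℂ) where
  carrier := {A | Aᵀ + A = 0 ∧ A * M = M * A}
  add_mem' := by
    rintro A A' ⟨h1, h2⟩ ⟨h1', h2'⟩
    refine ⟨?_, by rw [Matrix.add_mul, Matrix.mul_add, h2, h2']⟩
    rw [Matrix.transpose_add, add_add_add_comm, h1, h1', add_zero]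
  zero_mem' := by simp
  smul_mem' := by
    rintro c A ⟨h1, h2⟩
    refine ⟨?_, by rw [Matrix.smul_mul, Matrix.mul_smul, h2]⟩
    rw [Matrix.transpose_smul, ← smul_add, h1, smul_zero]

theorem mem_isotropyLie {M A : Matrix I I ℂ} :
    A ∈ isotropyLie M ↔ Aᵀ + A = 0 ∧ A * M = M * A := Iff.rfl

open scoped Matrix.Norms.Operator in
theorem transpose_mul_add_mul_eq_zero {M A : Matrix I I ℂ}
    (h : ∀ t : ℝ, (NormedSpace.exp ((t : ℂ) • A))ᵀ * M * NormedSpace.exp ((t : ℂ) • A) = M) :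
    Aᵀ * M + M * A = 0 := by
  have h1 := hasDerivAt_exp_transpose_mul A M
  have h2 : (fun t : ℝ => NormedSpace.exp (t • Aᵀ) * M * NormedSpace.exp (t • A)) = fun _ => M := by
    funext t
    have := h t
    rw [← Matrix.exp_transpose, Matrix.transpose_smul] at this
    exact this
  rw [h2] at h1
  exact h1.unique (hasDerivAt_const _ _)

/-- A skew matrix commuting with `M` exponentiates into the group. Conversely, the two defining
equations along `exp (t A)` are differentiated at `t = 0`. -/
theorem hasComplexLieDim_isotropyGroup (M : Matrix I I ℂ) :
    HasComplexLieDim (isotropyGroup M) (Module.finrank ℂ (isotropyLie M)) := by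
  refine ⟨isClosed_isotropyGroup M, isotropyLie M, fun A => ?_, rfl⟩
  constructor
  · rintro ⟨h1, h2⟩ t
    set T := (t : ℂ) • A with hT
    have hTt : Tᵀ = -T := by
      rw [hT, Matrix.transpose_smul, eq_neg_of_add_eq_zero_left h1, smul_neg]
    have hinv : NormedSpace.exp (-T) * NormedSpace.exp T = 1 := by
      rw [← Matrix.exp_add_of_commute _ _ (Commute.neg_left (Commute.refl T)), neg_add_cancel,
        NormedSpace.exp_zero]
    have hinv' := mul_eq_one_comm.mp hinv
    refine ⟨⟨NormedSpace.exp T, NormedSpace.exp (-T), hinv', hinv⟩, ?_, rfl⟩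
    rw [mem_isotropyGroup]
    refine ⟨?_, ?_⟩
    · change (NormedSpace.exp T)ᵀ * NormedSpace.exp T = 1
      rw [← Matrix.exp_transpose, hTt, hinv]
    · have : Commute T M := by
        change T * M = M * T
        rw [hT, Matrix.smul_mul, Matrix.mul_smul, h2]
      exact this.exp_left
  · intro h
    have hQ : ∀ t : ℝ, (NormedSpace.exp ((t : ℂ) • A))ᵀ * NormedSpace.exp ((t : ℂ) • A) = 1 ∧
        (NormedSpace.exp ((t : ℂ) • A))ᵀ * M * NormedSpace.exp ((t : ℂ) • A) = M := by
      intro t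
      obtain ⟨Q, hQ, hQe⟩ := h t
      rw [← hQe]
      exact hQ
    have h1 : Aᵀ * 1 + 1 * A = 0 := transpose_mul_add_mul_eq_zero fun t => by
      rw [Matrix.mul_one]; exact (hQ t).1
    have h2 := transpose_mul_add_mul_eq_zero fun t => (hQ t).2
    rw [Matrix.mul_one, Matrix.one_mul] at h1
    refine ⟨h1, ?_⟩
    rw [eq_neg_of_add_eq_zero_left h1, Matrix.neg_mul] at h2
    exact (neg_add_eq_zero.mp h2)

end isotropy

/-! ### Transport to an adapted basis -/

section gram

variable {I J : Type*} [Fintype I] [DecidableEq I] [Fintype J] [DecidableEq J]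

/-- The columns of `P` are a basis in which `K` is represented by `L` and the standard bilinear form
by `G`. -/
structure IsAdaptedBasis (K : Matrix I I ℂ) (L G : Matrix J J ℂ) (P : Matrix I J ℂ)
    (P' : Matrix J I ℂ) : Prop where
  mul_inv : P * P' = 1
  inv_mul : P' * P = 1
  intertwine : K * P = P * L
  gram : Pᵀ * P = G

variable {K : Matrix I I ℂ} {L G : Matrix J J ℂ} {P : Matrix I J ℂ} {P' : Matrix J I ℂ}

namespace IsAdaptedBasis

theorem conj_eq (h : IsAdaptedBasis K L G P P') (A : Matrix I I ℂ) : P * (P' * A * P) * P' = A := by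
  calc P * (P' * A * P) * P' = (P * P') * A * (P * P') := by simp only [Matrix.mul_assoc]
    _ = A := by rw [h.mul_inv, Matrix.one_mul, Matrix.mul_one]

theorem conj_eq' (h : IsAdaptedBasis K L G P P') (Y : Matrix J J ℂ) : P' * (P * Y * P') * P = Y := by
  calc P' * (P * Y * P') * P = (P' * P) * Y * (P' * P) := by simp only [Matrix.mul_assoc]
    _ = Y := by rw [h.inv_mul, Matrix.one_mul, Matrix.mul_one]

theorem intertwine' (h : IsAdaptedBasis K L G P P') : P' * K = L * P' := by
  calc P' * K = P' * (K * P) * P' := by rw [Matrix.mul_assoc, Matrix.mul_assoc, h.mul_inv,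
        Matrix.mul_one]
    _ = (P' * P) * L * P' := by rw [h.intertwine]; simp only [Matrix.mul_assoc]
    _ = L * P' := by rw [h.inv_mul, Matrix.one_mul]

theorem commute_iff (h : IsAdaptedBasis K L G P P') (Y : Matrix J J ℂ) :
    (P * Y * P') * K = K * (P * Y * P') ↔ Y * L = L * Y := by
  have e1 : (P * Y * P') * K = P * (Y * L) * P' := by
    rw [Matrix.mul_assoc, h.intertwine']; simp only [Matrix.mul_assoc]
  have e2 : K * (P * Y * P') = P * (L * Y) * P' := by
    rw [← Matrix.mul_assoc, ← Matrix.mul_assoc, h.intertwine]; simp only [Matrix.mul_assoc]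
  rw [e1, e2]
  constructor
  · intro h1
    rw [← h.conj_eq' (Y * L), h1, h.conj_eq']
  · intro h1; rw [h1]

theorem transpose_mul_eq_iff (h : IsAdaptedBasis K L G P P') (M M' : Matrix I I ℂ) :
    Pᵀ * M * P = Pᵀ * M' * P ↔ M = M' := by
  constructor
  · intro h1
    have h2 : P'ᵀ * Pᵀ = 1 := by rw [← Matrix.transpose_mul, h.mul_inv, Matrix.transpose_one]
    have e : ∀ M : Matrix I I ℂ, P'ᵀ * (Pᵀ * M * P) * P' = M := by
      intro M
      calc P'ᵀ * (Pᵀ * M * P) * P' = (P'ᵀ * Pᵀ) * M * (P * P') := by simp only [Matrix.mul_assoc]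
        _ = M := by rw [h2, h.mul_inv, Matrix.one_mul, Matrix.mul_one]
    rw [← e M, h1, e]
  · intro h1; rw [h1]

theorem conj_mul_P (h : IsAdaptedBasis K L G P P') (Y : Matrix J J ℂ) :
    (P * Y * P') * P = P * Y := by rw [Matrix.mul_assoc, h.inv_mul, Matrix.mul_one]

theorem orthogonal_iff (h : IsAdaptedBasis K L G P P') (Y : Matrix J J ℂ) :
    (P * Y * P')ᵀ * (P * Y * P') = 1 ↔ Yᵀ * G * Y = G := by
  rw [← h.transpose_mul_eq_iff]
  have e : Pᵀ * ((P * Y * P')ᵀ * (P * Y * P')) * P = Yᵀ * G * Y := by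
    calc Pᵀ * ((P * Y * P')ᵀ * (P * Y * P')) * P
        = ((P * Y * P') * P)ᵀ * ((P * Y * P') * P) := by
          rw [Matrix.transpose_mul _ P]; simp only [Matrix.mul_assoc]
      _ = Yᵀ * (Pᵀ * P) * Y := by
          rw [h.conj_mul_P, Matrix.transpose_mul]; simp only [Matrix.mul_assoc]
      _ = _ := by rw [h.gram]
  rw [e, Matrix.mul_one, h.gram]

theorem skew_iff (h : IsAdaptedBasis K L G P P') (Y : Matrix J J ℂ) :
    (P * Y * P')ᵀ + P * Y * P' = 0 ↔ Yᵀ * G + G * Y = 0 := by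
  rw [← h.transpose_mul_eq_iff]
  have e : Pᵀ * ((P * Y * P')ᵀ + P * Y * P') * P = Yᵀ * G + G * Y := by
    calc Pᵀ * ((P * Y * P')ᵀ + P * Y * P') * P
        = ((P * Y * P') * P)ᵀ * P + Pᵀ * ((P * Y * P') * P) := by
          rw [Matrix.transpose_mul _ P, Matrix.mul_add, Matrix.add_mul]
          simp only [Matrix.mul_assoc]
      _ = Yᵀ * (Pᵀ * P) + (Pᵀ * P) * Y := by
          rw [h.conj_mul_P, Matrix.transpose_mul]; simp only [Matrix.mul_assoc]
      _ = _ := by rw [h.gram]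
  rw [e, Matrix.mul_zero, Matrix.zero_mul]

theorem areConjugate (h : IsAdaptedBasis K L G P P') :
    AreConjugate (isotropyGroup K : Set (GL I ℂ)) (autGroup L G : Set (GL J ℂ)) := by
  refine ⟨P, P', h.mul_inv, h.inv_mul, fun Q => ?_⟩
  constructor
  · intro hQ
    have hQ' := mem_isotropyGroup.mp hQ
    have hY := h.conj_eq (Q : Matrix I I ℂ)
    rw [← hY, h.orthogonal_iff, h.commute_iff] at hQ'
    refine ⟨⟨P' * (Q : Matrix I I ℂ) * P, P' * ((Q⁻¹ : GL I ℂ) : Matrix I I ℂ) * P, ?_, ?_⟩, ?_, hY.symm⟩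
    · calc P' * (Q : Matrix I I ℂ) * P * (P' * ((Q⁻¹ : GL I ℂ) : Matrix I I ℂ) * P)
          = P' * (Q : Matrix I I ℂ) * (P * P') * ((Q⁻¹ : GL I ℂ) : Matrix I I ℂ) * P := by
            simp only [Matrix.mul_assoc]
        _ = P' * ((Q : Matrix I I ℂ) * ((Q⁻¹ : GL I ℂ) : Matrix I I ℂ)) * P := by
            rw [h.mul_inv, Matrix.mul_one]; simp only [Matrix.mul_assoc]
        _ = 1 := by rw [Q.mul_inv, Matrix.mul_one, h.inv_mul]
    · calc P' * ((Q⁻¹ : GL I ℂ) : Matrix I I ℂ) * P * (P' * (Q : Matrix I I ℂ) * P)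
          = P' * ((Q⁻¹ : GL I ℂ) : Matrix I I ℂ) * (P * P') * (Q : Matrix I I ℂ) * P := by
            simp only [Matrix.mul_assoc]
        _ = P' * (((Q⁻¹ : GL I ℂ) : Matrix I I ℂ) * (Q : Matrix I I ℂ)) * P := by
            rw [h.mul_inv, Matrix.mul_one]; simp only [Matrix.mul_assoc]
        _ = 1 := by rw [Q.inv_mul, Matrix.mul_one, h.inv_mul]
    · exact ⟨hQ'.2, hQ'.1⟩
  · rintro ⟨Y, ⟨hY1, hY2⟩, hQ⟩
    change Q ∈ isotropyGroup K
    rw [mem_isotropyGroup, hQ, h.orthogonal_iff, h.commute_iff]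
    exact ⟨hY2, hY1⟩

theorem isNilpotent (h : IsAdaptedBasis K L G P P') (hL : IsNilpotent L) : IsNilpotent K := by
  obtain ⟨k, hk⟩ := hL
  refine ⟨k, ?_⟩
  have h1 : ∀ n : ℕ, K ^ n * P = P * L ^ n := by
    intro n
    induction n with
    | zero => simp
    | succ n ih => rw [pow_succ, Matrix.mul_assoc, h.intertwine, ← Matrix.mul_assoc, ih,
        Matrix.mul_assoc, ← pow_succ]
  calc K ^ k = K ^ k * P * P' := by rw [Matrix.mul_assoc, h.mul_inv, Matrix.mul_one]
    _ = 0 := by rw [h1, hk, Matrix.mul_zero, Matrix.zero_mul]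

end IsAdaptedBasis

/-- The Lie algebra of `autGroup L G`. -/
def autLie (L G : Matrix J J ℂ) : Submodule ℂ (Matrix J J ℂ) where
  carrier := {Y | Yᵀ * G + G * Y = 0 ∧ Y * L = L * Y}
  add_mem' := by
    rintro A A' ⟨h1, h2⟩ ⟨h1', h2'⟩
    refine ⟨?_, by rw [Matrix.add_mul, Matrix.mul_add, h2, h2']⟩
    rw [Matrix.transpose_add, Matrix.add_mul, Matrix.mul_add, add_add_add_comm, h1, h1', add_zero]
  zero_mem' := by simp
  smul_mem' := by
    rintro c A ⟨h1, h2⟩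
    refine ⟨?_, by rw [Matrix.smul_mul, Matrix.mul_smul, h2]⟩
    rw [Matrix.transpose_smul, Matrix.smul_mul, Matrix.mul_smul, ← smul_add, h1, smul_zero]

theorem IsAdaptedBasis.finrank_isotropyLie (h : IsAdaptedBasis K L G P P') :
    Module.finrank ℂ (isotropyLie K) = Module.finrank ℂ (autLie L G) := by
  symm
  refine LinearEquiv.finrank_eq
    { toFun := fun Y => ⟨P * Y.1 * P', by
        rw [mem_isotropyLie, h.skew_iff, h.commute_iff]; exact Y.2⟩
      invFun := fun A => ⟨P' * A.1 * P, by
        have hA := A.2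
        rw [← h.conj_eq A.1, mem_isotropyLie, h.skew_iff, h.commute_iff] at hA
        exact hA⟩
      map_add' := fun Y Y' => Subtype.ext (by simp [Matrix.mul_add, Matrix.add_mul])
      map_smul' := fun c Y => Subtype.ext (by simp)
      left_inv := fun Y => Subtype.ext (h.conj_eq' Y.1)
      right_inv := fun A => Subtype.ext (h.conj_eq A.1) }

end gram

/-! ### Nonzero eigenvalue: dual isotropic eigenspaces -/

section blocks

/-- The permutation matrix which reverses the order. -/
def flipMat (a : ℕ) : Matrix (Fin a) (Fin a) ℂ := Matrix.of fun i j => if j = i.rev then 1 else 0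

theorem flipMat_mul {I : Type*} {a : ℕ} (X : Matrix (Fin a) I ℂ) :
    flipMat a * X = X.submatrix Fin.rev id := by
  ext i j
  simp [Matrix.mul_apply, flipMat]

theorem mul_flipMat {I : Type*} {a : ℕ} (X : Matrix I (Fin a) ℂ) :
    X * flipMat a = X.submatrix id Fin.rev := by
  ext i j
  simp only [Matrix.mul_apply, flipMat, Matrix.of_apply, mul_ite, mul_one, mul_zero,
    Matrix.submatrix_apply, id]
  rw [Finset.sum_eq_single j.rev]
  · simp
  · intro l _ hl
    rw [if_neg]
    rintro rfl; simp at hl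
  · simp

theorem flipMat_transpose (a : ℕ) : (flipMat a)ᵀ = flipMat a := by
  ext i j
  simp only [flipMat, Matrix.transpose_apply, Matrix.of_apply, Fin.ext_iff, Fin.val_rev]
  congr 1; simp; omega

theorem flipMat_mul_self (a : ℕ) : flipMat a * flipMat a = 1 := by
  rw [flipMat_mul]
  ext i j
  simp [flipMat, Matrix.one_apply, eq_comm]

/-- Reversing the columns turns the anti-diagonals of `N` into diagonals. The entries below the
diagonal cancel against those of `M`, the ones above add up to `1`, and the middle gives `z`. -/
theorem blockM_sub (a : ℕ) (z : ℂ) :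
    blockM a - Complex.I • (blockN a z * flipMat a) = z • 1 + shiftMat a := by
  rw [mul_flipMat]
  ext i j
  have hI : Complex.I * Complex.I = -1 := Complex.I_mul_I
  simp only [blockM, blockN, shiftMat, Matrix.sub_apply, Matrix.smul_apply, Matrix.submatrix_apply,
    Matrix.of_apply, id, Matrix.add_apply, Matrix.one_apply, smul_eq_mul, Fin.val_rev, Fin.ext_iff]
  have := j.2
  have := i.2
  rcases lt_trichotomy (i : ℕ) j with h | h | h
  · by_cases h1 : (i : ℕ) + 1 = j
    · rw [if_pos h1, if_neg (by omega), if_pos (by omega), if_neg (by omega), if_pos h1]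
      linear_combination (-1/2 : ℂ) * hI
    · rw [if_neg h1, if_neg (by omega), if_neg (by omega), if_neg (by omega), if_neg (by omega),
        if_neg h1]
      ring
  · rw [if_neg (by omega), if_neg (by omega), if_pos (by omega), if_pos h, if_neg (by omega)]
    linear_combination (-z) * hI
  · by_cases h1 : (j : ℕ) + 1 = i
    · rw [if_neg (by omega), if_pos h1, if_neg (by omega), if_pos (by omega), if_neg (by omega),
        if_neg (by omega)]
      linear_combination (-1/2 : ℂ) * hI
    · rw [if_neg (by omega), if_neg h1, if_neg (by omega), if_neg (by omega), if_neg (by omega),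
        if_neg (by omega)]
      ring

theorem blockM_transpose (a : ℕ) : (blockM a)ᵀ = -blockM a := by
  ext i j
  simp only [blockM, Matrix.transpose_apply, Matrix.of_apply, Matrix.neg_apply]
  split_ifs <;> first | omega | ring

theorem flipMat_mul_blockM (a : ℕ) : flipMat a * blockM a * flipMat a = -blockM a := by
  rw [flipMat_mul, mul_flipMat]
  ext i j
  have := j.2
  have := i.2
  simp only [blockM, Matrix.submatrix_apply, Matrix.of_apply, Matrix.neg_apply, id, Fin.val_rev]
  split_ifs <;> first | omega | ring

theorem blockN_transpose (a : ℕ) (z : ℂ) : (blockN a z)ᵀ = blockN a z := by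
  ext i j
  simp only [blockN, Matrix.transpose_apply, Matrix.of_apply]
  simp only [add_comm (j : ℕ) (i : ℕ)]

theorem flipMat_mul_blockN (a : ℕ) (z : ℂ) : flipMat a * blockN a z * flipMat a = blockN a z := by
  rw [flipMat_mul, mul_flipMat]
  ext i j
  have := j.2
  have := i.2
  simp only [blockN, Matrix.submatrix_apply, Matrix.of_apply, id, Fin.val_rev]
  split_ifs <;> first | omega | rfl

theorem blockM_add (a : ℕ) (z : ℂ) :
    blockM a + Complex.I • (blockN a z * flipMat a) = -(z • 1 + shiftMat a)ᵀ := by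
  have h : flipMat a * blockN a z = blockN a z * flipMat a := by
    conv_rhs => rw [← flipMat_mul_blockN]
    rw [Matrix.mul_assoc, flipMat_mul_self, Matrix.mul_one]
  rw [← blockM_sub, Matrix.transpose_sub, blockM_transpose, Matrix.transpose_smul,
    Matrix.transpose_mul, blockN_transpose, flipMat_transpose, h]
  abel

end blocks

section isotropicPair

variable {I J : Type*} [Fintype I] [DecidableEq I] [Fintype J] [DecidableEq J]

/-- The columns of `P` and `R` are dual bases of complementary isotropic subspaces on which `K` acts
by `L` and `-Lᵀ`. -/
structure IsIsotropicPair (K : Matrix I I ℂ) (L : Matrix J J ℂ) (P R : Matrix I J ℂ) : Prop where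
  mul_left : K * P = P * L
  mul_right : K * R = -(R * Lᵀ)
  left_left : Pᵀ * P = 0
  right_right : Rᵀ * R = 0
  right_left : Rᵀ * P = 1
  sum_eq_one : P * Rᵀ + R * Pᵀ = 1

/-- With `F = i E`, `E` the flip, one has `Fᵀ = F` and `F² = -1`, so the columns of `(1, -F)` and of
`(1, F)` span isotropic subspaces. They are invariant by `blockM_sub` and `blockM_add`, and the
factor `1/2` makes the bases dual. -/
theorem isIsotropicPair_blockK (a : ℕ) (z : ℂ) :
    IsIsotropicPair (blockK a z) (z • 1 + shiftMat a)
      (Matrix.fromRows 1 (-(Complex.I • flipMat a)))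
      ((1 / 2 : ℂ) • Matrix.fromRows 1 (Complex.I • flipMat a)) := by
  have hE := flipMat_mul_self a
  have hM : flipMat a * blockM a = -(blockM a * flipMat a) := by
    rw [← Matrix.neg_mul, ← flipMat_mul_blockM, Matrix.mul_assoc, hE, Matrix.mul_one]
  have hN : flipMat a * blockN a z = blockN a z * flipMat a := by
    conv_rhs => rw [← flipMat_mul_blockN]
    rw [Matrix.mul_assoc, hE, Matrix.mul_one]
  have hL := blockM_sub a z
  have hL' := blockM_add a z
  rw [← Matrix.mul_smul] at hL hL'
  obtain ⟨F, hF⟩ : ∃ F, F = Complex.I • flipMat a := ⟨_, rfl⟩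
  have hFF : F * F = -1 := by rw [hF]; simp [smul_smul, hE]
  have hFt : Fᵀ = F := by rw [hF, Matrix.transpose_smul, flipMat_transpose]
  have hFM : F * blockM a = -(blockM a * F) := by simp [hF, hM]
  have hFN : F * blockN a z = blockN a z * F := by simp [hF, hN]
  rw [← hF] at hL hL' ⊢
  refine ⟨?_, ?_, ?_, ?_, ?_, ?_⟩
  · rw [blockK, Matrix.fromBlocks_mul_fromRows, Matrix.fromRows_mul, ← hL]
    congr 1
    · simp [sub_eq_add_neg]
    · simp only [Matrix.mul_neg, Matrix.neg_mul, Matrix.mul_one, Matrix.mul_sub, hFM]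
      rw [← Matrix.mul_assoc, hFN, Matrix.mul_assoc, hFF]
      simp; abel
  · rw [Matrix.mul_smul, Matrix.smul_mul, ← smul_neg, ← Matrix.mul_neg, ← hL', blockK,
      Matrix.fromBlocks_mul_fromRows, Matrix.fromRows_mul]
    congr 2
    · simp
    · simp only [Matrix.neg_mul, Matrix.mul_one, Matrix.mul_add, hFM]
      rw [← Matrix.mul_assoc, hFN, Matrix.mul_assoc, hFF]
      simp; abel
  · rw [Matrix.transpose_fromRows, Matrix.fromCols_mul_fromRows]
    simp [hFt, hFF]
  · rw [Matrix.transpose_smul, Matrix.transpose_fromRows, Matrix.smul_mul, Matrix.mul_smul,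
      Matrix.fromCols_mul_fromRows]
    simp [hFt, hFF]
  · rw [Matrix.transpose_smul, Matrix.transpose_fromRows, Matrix.smul_mul,
      Matrix.fromCols_mul_fromRows]
    simp only [Matrix.transpose_one, Matrix.mul_one, hFt, Matrix.mul_neg, hFF, neg_neg]
    rw [← two_smul ℂ, smul_smul]; norm_num
  · rw [Matrix.transpose_smul, Matrix.mul_smul, Matrix.smul_mul, ← smul_add,
      Matrix.transpose_fromRows, Matrix.transpose_fromRows, Matrix.fromRows_mul_fromCols,
      Matrix.fromRows_mul_fromCols, Matrix.fromBlocks_add]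
    simp only [Matrix.transpose_one, Matrix.mul_one, hFt, Matrix.mul_neg, Matrix.neg_mul, hFF,
      neg_neg, Matrix.one_mul, Matrix.transpose_neg, add_neg_cancel, neg_add_cancel]
    rw [← two_smul ℂ (1 : Matrix (Fin a) (Fin a) ℂ), Matrix.fromBlocks_smul, smul_smul]
    norm_num

namespace IsIsotropicPair

variable {K : Matrix I I ℂ} {L : Matrix J J ℂ} {P R : Matrix I J ℂ}

theorem left_right (h : IsIsotropicPair K L P R) : Pᵀ * R = 1 := by
  rw [← Matrix.transpose_one, ← h.right_left, Matrix.transpose_mul, Matrix.transpose_transpose]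

theorem blockDiagonal (h : IsIsotropicPair K L P R) (S : Type*) [Fintype S] [DecidableEq S] :
    IsIsotropicPair (Matrix.blockDiagonal fun _ : S => K) (Matrix.blockDiagonal fun _ : S => L)
      (Matrix.blockDiagonal fun _ : S => P) (Matrix.blockDiagonal fun _ : S => R) := by
  have h1 : (1 : S → Matrix I I ℂ) = fun _ => 1 := rfl
  have h2 : (1 : S → Matrix J J ℂ) = fun _ => 1 := rfl
  have h0 : (0 : S → Matrix J J ℂ) = fun _ => 0 := rfl
  constructor <;>
    simp only [Matrix.blockDiagonal_transpose, ← Matrix.blockDiagonal_mul,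
      ← Matrix.blockDiagonal_neg, ← Matrix.blockDiagonal_add, ← Matrix.blockDiagonal_one,
      ← Matrix.blockDiagonal_zero, h1, h2, h0, h.mul_left, h.mul_right, h.left_left, h.right_right,
      h.right_left, Pi.neg_def, Pi.add_def, h.sum_eq_one]

theorem blockDiagonal' {S : Type*} [Fintype S] [DecidableEq S] {I J : S → Type*}
    [∀ s, Fintype (I s)] [∀ s, DecidableEq (I s)] [∀ s, Fintype (J s)] [∀ s, DecidableEq (J s)]
    {K : ∀ s, Matrix (I s) (I s) ℂ} {L : ∀ s, Matrix (J s) (J s) ℂ} {P R : ∀ s, Matrix (I s) (J s) ℂ}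
    (h : ∀ s, IsIsotropicPair (K s) (L s) (P s) (R s)) :
    IsIsotropicPair (Matrix.blockDiagonal' K) (Matrix.blockDiagonal' L)
      (Matrix.blockDiagonal' P) (Matrix.blockDiagonal' R) := by
  have h1 : (1 : ∀ s, Matrix (I s) (I s) ℂ) = fun _ => 1 := rfl
  have h2 : (1 : ∀ s, Matrix (J s) (J s) ℂ) = fun _ => 1 := rfl
  have h0 : (0 : ∀ s, Matrix (J s) (J s) ℂ) = fun _ => 0 := rfl
  constructor <;>
    simp only [Matrix.blockDiagonal'_transpose, ← Matrix.blockDiagonal'_mul,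
      ← Matrix.blockDiagonal'_neg, ← Matrix.blockDiagonal'_add, ← Matrix.blockDiagonal'_one,
      ← Matrix.blockDiagonal'_zero, h1, h2, h0, (h _).mul_left, (h _).mul_right, (h _).left_left,
      (h _).right_right, (h _).right_left, Pi.neg_def, Pi.add_def, (h _).sum_eq_one]

/-- Duality makes `Rᵀ` and `Pᵀ` the coordinate maps of the two subspaces, so they intertwine `E`
with `U` and `V`. When `U` and `V` have different eigenvalues, the first two relations will force
the mixed components to vanish. -/
theorem conj_eq_zero_of_commute (h : IsIsotropicPair K L P R) {U V : Matrix J J ℂ} {E : Matrix I I ℂ}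
    (hP : E * P = P * U) (hR : E * R = R * V) {A : Matrix I I ℂ} (hA : A * E = E * A) :
    U * (Rᵀ * A * R) = (Rᵀ * A * R) * V ∧ V * (Pᵀ * A * P) = (Pᵀ * A * P) * U ∧
      U * (Rᵀ * A * P) = (Rᵀ * A * P) * U := by
  have e : Rᵀ * E = U * Rᵀ := by
    calc Rᵀ * E = Rᵀ * E * (P * Rᵀ + R * Pᵀ) := by rw [h.sum_eq_one, Matrix.mul_one]
      _ = Rᵀ * (E * P) * Rᵀ + Rᵀ * (E * R) * Pᵀ := by
        rw [Matrix.mul_add]; simp only [Matrix.mul_assoc]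
      _ = (Rᵀ * P) * U * Rᵀ + (Rᵀ * R) * V * Pᵀ := by rw [hP, hR]; simp only [Matrix.mul_assoc]
      _ = _ := by simp [h.right_left, h.right_right]
  have e' : Pᵀ * E = V * Pᵀ := by
    calc Pᵀ * E = Pᵀ * E * (P * Rᵀ + R * Pᵀ) := by rw [h.sum_eq_one, Matrix.mul_one]
      _ = Pᵀ * (E * P) * Rᵀ + Pᵀ * (E * R) * Pᵀ := by
        rw [Matrix.mul_add]; simp only [Matrix.mul_assoc]
      _ = (Pᵀ * P) * U * Rᵀ + (Pᵀ * R) * V * Pᵀ := by rw [hP, hR]; simp only [Matrix.mul_assoc]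
      _ = _ := by simp [h.left_right, h.left_left]
  refine ⟨?_, ?_, ?_⟩
  · calc U * (Rᵀ * A * R) = (Rᵀ * E) * A * R := by rw [e]; simp only [Matrix.mul_assoc]
      _ = Rᵀ * A * (E * R) := by rw [Matrix.mul_assoc Rᵀ, ← hA]; simp only [Matrix.mul_assoc]
      _ = _ := by rw [hR]; simp only [Matrix.mul_assoc]
  · calc V * (Pᵀ * A * P) = (Pᵀ * E) * A * P := by rw [e']; simp only [Matrix.mul_assoc]
      _ = Pᵀ * A * (E * P) := by rw [Matrix.mul_assoc Pᵀ, ← hA]; simp only [Matrix.mul_assoc]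
      _ = _ := by rw [hP]; simp only [Matrix.mul_assoc]
  · calc U * (Rᵀ * A * P) = (Rᵀ * E) * A * P := by rw [e]; simp only [Matrix.mul_assoc]
      _ = Rᵀ * A * (E * P) := by rw [Matrix.mul_assoc Rᵀ, ← hA]; simp only [Matrix.mul_assoc]
      _ = _ := by rw [hP]; simp only [Matrix.mul_assoc]

/-- A matrix which commutes with the action preserves both isotropic subspaces. -/
theorem eq_of_off_diagonal_eq_zero (h : IsIsotropicPair K L P R) {A : Matrix I I ℂ}
    (h1 : Rᵀ * A * R = 0) (h2 : Pᵀ * A * P = 0) :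
    A = P * (Rᵀ * A * P) * Rᵀ + R * (Pᵀ * A * R) * Pᵀ := by
  calc A = (P * Rᵀ + R * Pᵀ) * A * (P * Rᵀ + R * Pᵀ) := by
        rw [h.sum_eq_one, Matrix.one_mul, Matrix.mul_one]
    _ = P * (Rᵀ * A * P) * Rᵀ + P * (Rᵀ * A * R) * Pᵀ + (R * (Pᵀ * A * P) * Rᵀ +
        R * (Pᵀ * A * R) * Pᵀ) := by
        simp only [Matrix.add_mul, Matrix.mul_add, Matrix.mul_assoc]; abel
    _ = _ := by rw [h1, h2]; simp

end IsIsotropicPair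

end isotropicPair

section exp

variable {I : Type*} [Fintype I] [DecidableEq I]

theorem exp_smul_one_add (z : ℂ) (M : Matrix I I ℂ) :
    NormedSpace.exp (z • (1 : Matrix I I ℂ) + M) = Complex.exp z • NormedSpace.exp M := by
  have h1 : NormedSpace.exp (z • (1 : Matrix I I ℂ)) = Complex.exp z • (1 : Matrix I I ℂ) := by
    rw [← Matrix.diagonal_one, ← Matrix.diagonal_smul, Matrix.exp_diagonal, ← Matrix.diagonal_smul]
    congr 1
    funext i
    rw [Pi.coe_exp, Complex.exp_eq_exp_ℂ]
    simp
  rw [Matrix.exp_add_of_commute _ _ ((Commute.one_left M).smul_left z), h1, Matrix.smul_mul,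
    Matrix.one_mul]

theorem isNilpotent_exp_smul_one_add_sub (z : ℂ) {M : Matrix I I ℂ} (hM : IsNilpotent M) :
    IsNilpotent (NormedSpace.exp (z • (1 : Matrix I I ℂ) + M) -
      Complex.exp z • (1 : Matrix I I ℂ)) := by
  rw [exp_smul_one_add, ← smul_sub]
  exact (isNilpotent_exp_sub_one hM).smul _

theorem isNilpotent_transpose {M : Matrix I I ℂ} (hM : IsNilpotent M) : IsNilpotent Mᵀ := by
  obtain ⟨k, hk⟩ := hM
  exact ⟨k, by rw [← Matrix.transpose_pow, hk, Matrix.transpose_zero]⟩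

end exp

namespace IsIsotropicPair

variable {I J : Type*} [Fintype I] [DecidableEq I] [Fintype J] [DecidableEq J]
  {K : Matrix I I ℂ} {L N : Matrix J J ℂ} {P R : Matrix I J ℂ} {z : ℂ}

theorem double_mul (h : IsIsotropicPair K L P R) (X X' Y Y' : Matrix J J ℂ) :
    (P * X * Rᵀ + R * Y * Pᵀ) * (P * X' * Rᵀ + R * Y' * Pᵀ) =
      P * (X * X') * Rᵀ + R * (Y * Y') * Pᵀ := by
  calc (P * X * Rᵀ + R * Y * Pᵀ) * (P * X' * Rᵀ + R * Y' * Pᵀ)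
      = P * X * (Rᵀ * P) * X' * Rᵀ + P * X * (Rᵀ * R) * Y' * Pᵀ +
          (R * Y * (Pᵀ * P) * X' * Rᵀ + R * Y * (Pᵀ * R) * Y' * Pᵀ) := by
        simp only [Matrix.add_mul, Matrix.mul_add, Matrix.mul_assoc]; abel
    _ = _ := by
        rw [h.right_left, h.right_right, h.left_left, h.left_right]
        simp [Matrix.mul_assoc]

theorem compress_double (h : IsIsotropicPair K L P R) (X Y : Matrix J J ℂ) :
    Rᵀ * (P * X * Rᵀ + R * Y * Pᵀ) * P = X := by
  calc Rᵀ * (P * X * Rᵀ + R * Y * Pᵀ) * P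
      = (Rᵀ * P) * X * (Rᵀ * P) + (Rᵀ * R) * Y * (Pᵀ * P) := by
        simp only [Matrix.add_mul, Matrix.mul_add, Matrix.mul_assoc]
    _ = X := by rw [h.right_left, h.right_right]; simp

/-- The embedding `X ↦ X ⊕ X⁻ᵀ` of the linear group into the orthogonal group. -/
def hom (h : IsIsotropicPair K L P R) : GL J ℂ →* GL I ℂ :=
  MonoidHom.toHomUnits
    { toFun := fun X => P * (X : Matrix J J ℂ) * Rᵀ + R * ((X⁻¹ : GL J ℂ) : Matrix J J ℂ)ᵀ * Pᵀ
      map_one' := by simp [h.sum_eq_one]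
      map_mul' := fun X Y => by
        rw [h.double_mul, ← Matrix.transpose_mul, _root_.mul_inv_rev, Units.val_mul, Units.val_mul] }

theorem coe_hom (h : IsIsotropicPair K L P R) (X : GL J ℂ) : (h.hom X : Matrix I I ℂ) =
    P * (X : Matrix J J ℂ) * Rᵀ + R * ((X⁻¹ : GL J ℂ) : Matrix J J ℂ)ᵀ * Pᵀ := rfl

theorem hom_injective (h : IsIsotropicPair K L P R) : Function.Injective h.hom := by
  intro X Y hXY
  have := congrArg (fun Q : GL I ℂ => Rᵀ * (Q : Matrix I I ℂ) * P) hXY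
  simp only [coe_hom, h.compress_double] at this
  exact Units.ext this

theorem action_eq (h : IsIsotropicPair K L P R) : K = P * L * Rᵀ + R * (-Lᵀ) * Pᵀ := by
  calc K = K * (P * Rᵀ + R * Pᵀ) := by rw [h.sum_eq_one, Matrix.mul_one]
    _ = (K * P) * Rᵀ + (K * R) * Pᵀ := by rw [Matrix.mul_add]; simp only [Matrix.mul_assoc]
    _ = _ := by rw [h.mul_left, h.mul_right, Matrix.mul_neg]

theorem hom_mem_isotropyGroup (h : IsIsotropicPair K L P R) {X : GL J ℂ}
    (hX : (X : Matrix J J ℂ) * L = L * X) : h.hom X ∈ isotropyGroup K := by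
  have hX' : ((X⁻¹ : GL J ℂ) : Matrix J J ℂ) * L = L * ((X⁻¹ : GL J ℂ) : Matrix J J ℂ) :=
    (Commute.units_inv_left (u := X) hX : Commute ((X⁻¹ : GL J ℂ) : Matrix J J ℂ) L)
  rw [mem_isotropyGroup]
  constructor
  · have : (h.hom X : Matrix I I ℂ)ᵀ = P * ((X⁻¹ : GL J ℂ) : Matrix J J ℂ) * Rᵀ +
        R * (X : Matrix J J ℂ)ᵀ * Pᵀ := by
      rw [coe_hom]
      simp only [Matrix.transpose_add, Matrix.transpose_mul, Matrix.transpose_transpose,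
        Matrix.mul_assoc]
      abel
    rw [this, coe_hom, h.double_mul, ← Matrix.transpose_mul, X.inv_mul, Matrix.transpose_one,
      Matrix.mul_one, Matrix.mul_one, h.sum_eq_one]
  · rw [coe_hom]
    conv_lhs => rw [h.action_eq]
    conv_rhs => rw [h.action_eq]
    rw [h.double_mul, h.double_mul, hX, Matrix.mul_neg, Matrix.neg_mul,
      ← Matrix.transpose_mul, ← Matrix.transpose_mul, hX']

/-- Stated for any `E` preserving the two subspaces, so that it covers both the normal form and its
exponential. Sylvester kills the mixed components, and orthogonality says that the two remaining
ones are inverse transposes of each other. -/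
theorem exists_hom_eq (h : IsIsotropicPair K L P R) {U V : Matrix J J ℂ} {E : Matrix I I ℂ}
    {u v : ℂ} (hP : E * P = P * U) (hR : E * R = R * V)
    (hU : IsNilpotent (U - u • (1 : Matrix J J ℂ))) (hV : IsNilpotent (V - v • (1 : Matrix J J ℂ)))
    (huv : u ≠ v) {Q : GL I ℂ} (hQ : Q ∈ isotropyGroup E) :
    ∃ X : GL J ℂ, (X : Matrix J J ℂ) * U = U * X ∧ h.hom X = Q := by
  rw [mem_isotropyGroup] at hQ
  obtain ⟨h1, h2, h3⟩ := h.conj_eq_zero_of_commute hP hR hQ.2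
  have hQ' := h.eq_of_off_diagonal_eq_zero (eq_zero_of_mul_eq_mul hU hV huv h1)
    (eq_zero_of_mul_eq_mul hV hU huv.symm h2)
  obtain ⟨X, hX⟩ : ∃ X, X = Rᵀ * (Q : Matrix I I ℂ) * P := ⟨_, rfl⟩
  obtain ⟨Y, hY⟩ : ∃ Y, Y = Pᵀ * (Q : Matrix I I ℂ) * R := ⟨_, rfl⟩
  rw [← hX, ← hY] at hQ'
  rw [← hX] at h3
  have hXY : Yᵀ * X = 1 := by
    have e1 : (Q : Matrix I I ℂ)ᵀ = P * Yᵀ * Rᵀ + R * Xᵀ * Pᵀ := by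
      rw [hQ']
      simp only [Matrix.transpose_add, Matrix.transpose_mul, Matrix.transpose_transpose,
        Matrix.mul_assoc]
      abel
    have e2 := h.compress_double (Yᵀ * X) (Xᵀ * Y)
    rw [← h.double_mul, ← e1, ← hQ', hQ.1, Matrix.mul_one, h.right_left] at e2
    exact e2.symm
  refine ⟨⟨X, Yᵀ, mul_eq_one_comm.mp hXY, hXY⟩, h3.symm, Units.ext ?_⟩
  rw [coe_hom, hQ']
  simp

variable (hN : IsNilpotent N)

include hN in
theorem map_autGroup_eq (h : IsIsotropicPair K (z • 1 + N) P R) (hz : z ≠ 0) :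
    (autGroup N 0).map h.hom = isotropyGroup K := by
  ext Q
  rw [Subgroup.mem_map]
  constructor
  · rintro ⟨X, hX, rfl⟩
    refine h.hom_mem_isotropyGroup ?_
    rw [Matrix.mul_add, Matrix.add_mul, hX.1]
    simp
  · intro hQ
    obtain ⟨X, hX, hXQ⟩ := h.exists_hom_eq (U := z • 1 + N) (V := -(z • 1 + N)ᵀ) (u := z) (v := -z)
      h.mul_left (by rw [h.mul_right, Matrix.mul_neg]) (by rwa [add_sub_cancel_left])
      (by
        have : -(z • 1 + N)ᵀ - (-z) • (1 : Matrix J J ℂ) = -Nᵀ := by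
          rw [Matrix.transpose_add, Matrix.transpose_smul, Matrix.transpose_one, neg_smul]; abel
        rw [this]; exact (isNilpotent_transpose hN).neg)
      (fun e => hz (self_eq_neg.mp e)) hQ
    refine ⟨X, ⟨?_, by simp⟩, hXQ⟩
    rw [Matrix.mul_add, Matrix.add_mul] at hX
    simpa using hX

-- The exponential has the single eigenvalues `exp z` and `exp (-z)` on the two subspaces; they
-- differ exactly when `z` is not an integral multiple of `π i`.
include hN in
theorem isotropyGroup_exp (h : IsIsotropicPair K (z • 1 + N) P R)
    (hz : ∀ k : ℤ, z ≠ (k : ℂ) * (Real.pi : ℂ) * Complex.I) :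
    isotropyGroup (NormedSpace.exp K) = isotropyGroup K := by
  refine le_antisymm (fun Q hQ => ?_) ?_
  · have hne : Complex.exp z ≠ Complex.exp (-z) := by
      intro e
      have : Complex.exp (z + z) = 1 := by
        rw [Complex.exp_add]; nth_rw 1 [e]; rw [← Complex.exp_add]; simp
      obtain ⟨n, hn⟩ := Complex.exp_eq_one_iff.mp this
      exact hz n (by linear_combination (1 / 2 : ℂ) * hn)
    have hV : -(z • 1 + N)ᵀ = (-z) • (1 : Matrix J J ℂ) + -Nᵀ := by
      rw [Matrix.transpose_add, Matrix.transpose_smul, Matrix.transpose_one, neg_smul]; abel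
    obtain ⟨X, hX, rfl⟩ := h.exists_hom_eq (exp_mul_eq_mul_exp h.mul_left)
      (exp_mul_eq_mul_exp (B := (-z) • (1 : Matrix J J ℂ) + -Nᵀ)
        (by rw [h.mul_right, ← hV, Matrix.mul_neg]))
      (isNilpotent_exp_smul_one_add_sub z hN)
      (isNilpotent_exp_smul_one_add_sub (-z) (isNilpotent_transpose hN).neg) hne hQ
    refine h.hom_mem_isotropyGroup ?_
    rw [exp_smul_one_add, Matrix.mul_smul, Matrix.smul_mul] at hX
    rw [Matrix.mul_add, Matrix.add_mul,
      commute_of_commute_exp hN (smul_right_injective _ (Complex.exp_ne_zero z) hX)]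
    simp
  · simpa using isotropyGroup_le_exp K 1

-- The infinitesimal version: skewness replaces the inverse transpose by the negative transpose.
include hN in
theorem finrank_isotropyLie (h : IsIsotropicPair K (z • 1 + N) P R) (hz : z ≠ 0) :
    Module.finrank ℂ (isotropyLie K) = Module.finrank ℂ (autLie N 0) := by
  have hmem : ∀ A ∈ isotropyLie K, Rᵀ * A * P ∈ autLie N 0 ∧
      P * (Rᵀ * A * P) * Rᵀ + R * (-(Rᵀ * A * P)ᵀ) * Pᵀ = A := by
    intro A hA
    obtain ⟨h1, h2, h3⟩ := h.conj_eq_zero_of_commute (U := z • 1 + N) (V := -(z • 1 + N)ᵀ)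
      h.mul_left (by rw [h.mul_right, Matrix.mul_neg]) hA.2
    have hV : IsNilpotent (-(z • 1 + N)ᵀ - (-z) • (1 : Matrix J J ℂ)) := by
      have : -(z • 1 + N)ᵀ - (-z) • (1 : Matrix J J ℂ) = -Nᵀ := by
        rw [Matrix.transpose_add, Matrix.transpose_smul, Matrix.transpose_one, neg_smul]; abel
      rw [this]; exact (isNilpotent_transpose hN).neg
    have hU : IsNilpotent (z • 1 + N - z • (1 : Matrix J J ℂ)) := by rwa [add_sub_cancel_left]
    have hne : z ≠ -z := fun e => hz (self_eq_neg.mp e)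
    have hA' := h.eq_of_off_diagonal_eq_zero (eq_zero_of_mul_eq_mul hU hV hne h1)
      (eq_zero_of_mul_eq_mul hV hU hne.symm h2)
    refine ⟨⟨by simp, ?_⟩, ?_⟩
    · rw [Matrix.mul_add, Matrix.add_mul] at h3
      simpa using h3.symm
    · have : -(Rᵀ * A * P)ᵀ = Pᵀ * A * R := by
        simp only [Matrix.transpose_mul, Matrix.transpose_transpose,
          eq_neg_of_add_eq_zero_left hA.1, Matrix.mul_neg, Matrix.neg_mul, neg_neg, Matrix.mul_assoc]
      rw [this]; exact hA'.symm
  refine LinearEquiv.finrank_eq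
    { toFun := fun A => ⟨Rᵀ * A.1 * P, (hmem A.1 A.2).1⟩
      invFun := fun X => ⟨P * X.1 * Rᵀ + R * (-X.1ᵀ) * Pᵀ, by
        have hX : X.1 * N = N * X.1 := X.2.2
        constructor
        · simp only [Matrix.transpose_add, Matrix.transpose_mul, Matrix.transpose_transpose,
            Matrix.transpose_neg, Matrix.mul_assoc, Matrix.neg_mul, Matrix.mul_neg]
          abel
        · have hX' : X.1 * (z • 1 + N) = (z • 1 + N) * X.1 := by
            rw [Matrix.mul_add, Matrix.add_mul, hX]; simp
          conv_lhs => rw [h.action_eq]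
          conv_rhs => rw [h.action_eq]
          rw [h.double_mul, h.double_mul, hX', neg_mul_neg, neg_mul_neg, ← Matrix.transpose_mul,
            ← Matrix.transpose_mul, hX']⟩
      map_add' := fun Y Y' => Subtype.ext (by simp [Matrix.mul_add, Matrix.add_mul])
      map_smul' := fun c Y => Subtype.ext (by simp)
      left_inv := fun A => Subtype.ext (hmem A.1 A.2).2
      right_inv := fun X => Subtype.ext (h.compress_double _ _) }

include hN in
theorem areConjugate (h : IsIsotropicPair K (z • 1 + N) P R) (hz : z ≠ 0) :
    AreConjugate (isotropyGroup K : Set (GL I ℂ))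
      {Y : GL (J ⊕ J) ℂ | ∃ X ∈ autGroup N 0, (Y : Matrix (J ⊕ J) (J ⊕ J) ℂ) =
        Matrix.fromBlocks (X : Matrix J J ℂ) 0 0 ((X⁻¹ : GL J ℂ) : Matrix J J ℂ)ᵀ} := by
  have key : ∀ X Y : Matrix J J ℂ, Matrix.fromCols P R * Matrix.fromBlocks X 0 0 Y *
      Matrix.fromRows Rᵀ Pᵀ = P * X * Rᵀ + R * Y * Pᵀ := by
    intro X Y
    rw [Matrix.fromCols_mul_fromBlocks, Matrix.fromCols_mul_fromRows]
    simp
  refine ⟨Matrix.fromCols P R, Matrix.fromRows Rᵀ Pᵀ, ?_, ?_, fun Q => ?_⟩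
  · rw [Matrix.fromCols_mul_fromRows, h.sum_eq_one]
  · rw [Matrix.fromRows_mul_fromCols, h.right_left, h.right_right, h.left_left, h.left_right,
      Matrix.fromBlocks_one]
  · rw [SetLike.mem_coe, ← h.map_autGroup_eq hN hz, Subgroup.mem_map]
    constructor
    · rintro ⟨X, hX, rfl⟩
      refine ⟨⟨Matrix.fromBlocks (X : Matrix J J ℂ) 0 0 ((X⁻¹ : GL J ℂ) : Matrix J J ℂ)ᵀ,
        Matrix.fromBlocks ((X⁻¹ : GL J ℂ) : Matrix J J ℂ) 0 0 (X : Matrix J J ℂ)ᵀ, ?_, ?_⟩,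
        ⟨X, hX, rfl⟩, (key _ _).symm⟩
      · rw [Matrix.fromBlocks_multiply, ← Matrix.transpose_mul, X.mul_inv]; simp
      · rw [Matrix.fromBlocks_multiply, ← Matrix.transpose_mul, X.inv_mul]; simp
    · rintro ⟨Y, ⟨X, hX, hY⟩, hQ⟩
      refine ⟨X, hX, Units.ext ?_⟩
      rw [hQ, hY, key]; rfl

end IsIsotropicPair

/-! ### Nonzero eigenvalue: the Toeplitz group -/

section nonzero

variable {N : ℕ} {α m : Fin N → ℕ}

theorem exists_isIsotropicPair_formK (α m : Fin N → ℕ) (z : ℂ) :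
    ∃ P R, IsIsotropicPair (formK α m z) (z • 1 + blockShift α m) P R := by
  have h := IsIsotropicPair.blockDiagonal' fun r : Fin N =>
    (isIsotropicPair_blockK (α r) z).blockDiagonal (Fin (m r))
  have e : (Matrix.blockDiagonal' fun r : Fin N => Matrix.blockDiagonal fun _ : Fin (m r) =>
      z • 1 + shiftMat (α r)) = z • 1 + blockShift α m := by
    ext ⟨r, i, c⟩ ⟨s, j, d⟩
    rw [Matrix.add_apply, Matrix.smul_apply, blockShift, blockKron]
    by_cases hrs : r = s
    · subst hrs
      rw [Matrix.blockDiagonal'_apply_eq, Matrix.blockDiagonal'_apply_eq, Matrix.blockDiagonal_apply]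
      simp only [Matrix.kronecker, Matrix.kroneckerMap_apply, Matrix.one_apply, Sigma.mk.injEq,
        heq_eq_eq, true_and, Prod.mk.injEq, Matrix.add_apply, Matrix.smul_apply]
      by_cases hcd : c = d <;> simp [hcd]
    · rw [Matrix.blockDiagonal'_apply_ne _ _ _ hrs, Matrix.blockDiagonal'_apply_ne _ _ _ hrs,
        Matrix.one_apply_ne (fun e => hrs (congrArg Sigma.fst e))]
      simp
  rw [e] at h
  exact ⟨_, _, h⟩

theorem isNilpotent_blockShift (α m : Fin N → ℕ) : IsNilpotent (blockShift α m) := by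
  have h : HasDegree 1 (blockShift α m) := by
    rintro ⟨r, i, c⟩ ⟨s, j, d⟩ hxy
    rw [blockShift, blockKron] at hxy
    by_cases hrs : r = s
    · subst hrs
      rw [Matrix.blockDiagonal'_apply_eq] at hxy
      simp only [Matrix.kronecker, Matrix.kroneckerMap_apply, shiftMat_apply] at hxy
      have h1 : i.val + 1 = j.val := by
        by_contra h; simp [h] at hxy
      simp only [blockWeight]
      omega
    · exact absurd (Matrix.blockDiagonal'_apply_ne _ _ _ hrs) hxy
  exact h.isNilpotent

theorem coeff_zero_mul (hα : StrictAnti α) (hpos : ∀ r, 0 < α r) (A A' : Coeffs m)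
    (h : blockToeplitz α A * blockToeplitz α A' = 1) (r : Fin N) : A r r 0 * A' r r 0 = 1 := by
  ext c d
  have h1 := congrFun (congrFun h ⟨r, ⟨0, hpos r⟩, c⟩) ⟨r, ⟨0, hpos r⟩, d⟩
  rw [Matrix.mul_apply, Fintype.sum_sigma, Finset.sum_eq_single r, Fintype.sum_prod_type,
    Finset.sum_eq_single ⟨0, hpos r⟩] at h1
  · simp only [blockToeplitz_apply] at h1
    simpa [Matrix.mul_apply, Matrix.one_apply] using h1
  · intro j _ hj
    refine Finset.sum_eq_zero fun e _ => ?_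
    rw [blockToeplitz_apply A', if_neg, mul_zero]
    intro hle
    exact hj (Fin.ext (by simpa using hle))
  · simp
  · intro s _ hs
    refine Finset.sum_eq_zero fun ⟨j, e⟩ _ => ?_
    rw [blockToeplitz_apply, blockToeplitz_apply]
    rcases lt_or_gt_of_ne hs with hlt | hlt
    · have := hα hlt
      split_ifs with h1 h2
      · simp only at h1 h2; omega
      all_goals simp
    · have := hα hlt
      split_ifs with h1 h2
      · simp only at h1 h2; omega
      all_goals simp
  · simp

/-- For the zero form the group is just the unit group of the commutant. The `A_0^{rr}` are
invertible because the inverse is block Toeplitz too and the `A_0^{rr}` multiply without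
contributions of other blocks. -/
theorem coe_autGroup_blockShift (hα : StrictAnti α) (hpos : ∀ r, 0 < α r) :
    (autGroup (blockShift α m) 0 : Set (GL (BlockIdx α m) ℂ)) = toeplitzSet α m := by
  ext X
  constructor
  · intro hX
    obtain ⟨A, hA⟩ := commute_blockShift_iff.mp hX.1
    obtain ⟨A', hA'⟩ := commute_blockShift_iff.mp ((autGroup (blockShift α m) 0).inv_mem hX).1
    refine ⟨A, fun r => ?_, hA⟩
    exact IsUnit.of_mul_eq_one _ (coeff_zero_mul hα hpos A A' (by rw [← hA, ← hA', X.mul_inv]) r)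
  · rintro ⟨A, -, hA⟩
    exact ⟨commute_blockShift_iff.mpr ⟨A, hA⟩, by simp⟩

end nonzero

/-! ### Zero eigenvalue: adapted bases of the normal form -/

section zero

theorem matB_transpose (a n : ℕ) : (matB a n)ᵀ = (-1 : ℂ) ^ (a + 1) • matB a n := by
  by_cases ha : Even a
  · rw [ha.add_one.neg_one_pow]
    ext i j
    simp only [matB, if_pos ha, Matrix.transpose_apply, Matrix.of_apply, Matrix.smul_apply,
      smul_eq_mul]
    split_ifs <;> first | omega | simp
  · rw [(Nat.not_even_iff_odd.mp ha).add_one.neg_one_pow, one_smul]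
    simp [matB, ha]

/-- The sizes `n` for which the form matrix of a block of size `a` is nonsingular. -/
theorem isUnit_matB {a n : ℕ} (h : Even a → Even n) : IsUnit (matB a n) := by
  by_cases ha : Even a
  · refine IsUnit.of_mul_eq_one (matB a n)ᵀ ?_
    have hn := h ha
    ext i j
    rw [Matrix.mul_apply]
    have hi := i.2
    have hj := j.2
    -- The partner of `i` in its 2-by-2 block; it exists since `n` is even.
    obtain ⟨k, hk⟩ : ∃ k : Fin n, (k : ℕ) = if Even (i : ℕ) then (i : ℕ) + 1 else i - 1 := by
      by_cases hi' : Even (i : ℕ)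
      · exact ⟨⟨i + 1, by grind⟩, by simp [hi']⟩
      · exact ⟨⟨i - 1, by omega⟩, by simp [hi']⟩
    rw [Finset.sum_eq_single k]
    · simp only [matB, if_pos ha, Matrix.transpose_apply, Matrix.of_apply, Matrix.one_apply,
        Fin.ext_iff]
      grind
    · intro l _ hl
      have hl' : (l : ℕ) ≠ k := fun e => hl (Fin.ext e)
      simp only [matB, if_pos ha, Matrix.of_apply]
      rw [if_neg, if_neg, zero_mul] <;> grind
    · simp
  · have : ((-1 : ℂ) ^ ((a - 1) / 2)) * (-1 : ℂ) ^ ((a - 1) / 2) = 1 := by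
      rw [← mul_pow]; simp
    refine IsUnit.of_mul_eq_one ((-1 : ℂ) ^ ((a - 1) / 2) • 1) ?_
    simp [matB, ha, smul_smul, this]

variable {I J : Type*} [Fintype I] [Fintype J]

/-- The columns of `P` are generators of an invariant subspace on which `K` acts by `L` and the
standard bilinear form is given by `G`. -/
structure IsAdaptedFamily (K : Matrix I I ℂ) (L G : Matrix J J ℂ) (P : Matrix I J ℂ) : Prop where
  intertwine : K * P = P * L
  gram : Pᵀ * P = G

namespace IsAdaptedFamily

variable {K : Matrix I I ℂ} {L G : Matrix J J ℂ} {P : Matrix I J ℂ}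

theorem blockDiagonal (h : IsAdaptedFamily K L G P) (S : Type*) [Fintype S] [DecidableEq S] :
    IsAdaptedFamily (Matrix.blockDiagonal fun _ : S => K) (Matrix.blockDiagonal fun _ : S => L)
      (Matrix.blockDiagonal fun _ : S => G) (Matrix.blockDiagonal fun _ : S => P) := by
  constructor <;>
    simp only [Matrix.blockDiagonal_transpose, ← Matrix.blockDiagonal_mul, h.intertwine, h.gram]

theorem blockDiagonal' {S : Type*} [Fintype S] [DecidableEq S] {I J : S → Type*}
    [∀ s, Fintype (I s)] [∀ s, Fintype (J s)]
    {K : ∀ s, Matrix (I s) (I s) ℂ} {L G : ∀ s, Matrix (J s) (J s) ℂ} {P : ∀ s, Matrix (I s) (J s) ℂ}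
    (h : ∀ s, IsAdaptedFamily (K s) (L s) (G s) (P s)) :
    IsAdaptedFamily (Matrix.blockDiagonal' K) (Matrix.blockDiagonal' L)
      (Matrix.blockDiagonal' G) (Matrix.blockDiagonal' P) := by
  constructor <;>
    simp only [Matrix.blockDiagonal'_transpose, ← Matrix.blockDiagonal'_mul, (h _).intertwine,
      (h _).gram]

theorem submatrix (h : IsAdaptedFamily K L G P) {I' J' : Type*} [Fintype I'] [Fintype J'] (e : I' ≃ I) (f : J' ≃ J) :
    IsAdaptedFamily (K.submatrix e e) (L.submatrix f f) (G.submatrix f f) (P.submatrix e f) := by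
  constructor
  · rw [Matrix.submatrix_mul_equiv, Matrix.submatrix_mul_equiv, h.intertwine]
  · rw [Matrix.transpose_submatrix, Matrix.submatrix_mul_equiv, h.gram]

theorem isAdaptedBasis [DecidableEq I] [DecidableEq J] (h : IsAdaptedFamily K L G P) (hcard : Fintype.card I = Fintype.card J)
    {G' : Matrix J J ℂ} (hG : G' * G = 1) : IsAdaptedBasis K L G P (G' * Pᵀ) := by
  have h1 : G' * Pᵀ * P = 1 := by rw [Matrix.mul_assoc, h.gram, hG]
  exact ⟨(Matrix.mul_eq_one_comm_of_card_eq _ _ _ hcard).mpr h1, h1, h.intertwine, h.gram⟩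

end IsAdaptedFamily

end zero

section evenBlocks

variable {I : Type*} {a : ℕ}

/-- The matrix whose columns are alternately those of `U` and those of `V`. -/
def interleave (U V : Matrix I (Fin a) ℂ) : Matrix I (Fin a × Fin 2) ℂ :=
  Matrix.of fun x y => if y.2 = 0 then U x y.1 else V x y.1

theorem mul_interleave [Fintype I] (K : Matrix I I ℂ) (U V : Matrix I (Fin a) ℂ) :
    K * interleave U V = interleave (K * U) (K * V) := by
  ext x ⟨j, w⟩
  fin_cases w <;> simp [interleave, Matrix.mul_apply]

theorem interleave_mul_kronecker (U V : Matrix I (Fin a) ℂ) (S : Matrix (Fin a) (Fin a) ℂ) :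
    interleave U V * Matrix.kronecker S (1 : Matrix (Fin 2) (Fin 2) ℂ) =
      interleave (U * S) (V * S) := by
  ext x ⟨j, w⟩
  fin_cases w <;> simp [interleave, Matrix.mul_apply, Fintype.sum_prod_type, Fin.sum_univ_two]

/-- On the dual basis `V` the block acts by `-Jᵀ`; the flip converts this into `J`. The two chains
`U` and `-V F` pair by `∓F`, which gives the rotation block `matB a 2`, as `F` is skew for even `a`.
-/
theorem isAdaptedFamily_blockK (ha : Even a) :
    ∃ P, IsAdaptedFamily (blockK a 0) (Matrix.kronecker (shiftMat a) (1 : Matrix (Fin 2) (Fin 2) ℂ))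
      (Matrix.kronecker (signedFlip a) (matB a 2)) P := by
  have h := isIsotropicPair_blockK a 0
  rw [zero_smul, zero_add] at h
  obtain ⟨U, V, h⟩ : ∃ U V, IsIsotropicPair (blockK a 0) (shiftMat a) U V := ⟨_, _, h⟩
  refine ⟨interleave U (-(V * signedFlip a)), ?_, ?_⟩
  · rw [mul_interleave, interleave_mul_kronecker, h.mul_left]
    congr 1
    rw [Matrix.mul_neg, ← Matrix.mul_assoc, h.mul_right, Matrix.neg_mul, Matrix.mul_assoc,
      shiftMat_transpose_mul_signedFlip, Matrix.neg_mul, Matrix.mul_neg, Matrix.mul_assoc, neg_neg]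
  · have h1 : Uᵀ * (-(V * signedFlip a)) = -signedFlip a := by
      rw [Matrix.mul_neg, ← Matrix.mul_assoc, h.left_right, Matrix.one_mul]
    have h2 : (-(V * signedFlip a))ᵀ * U = signedFlip a := by
      rw [Matrix.transpose_neg, Matrix.transpose_mul, Matrix.neg_mul, Matrix.mul_assoc,
        h.right_left, Matrix.mul_one, signedFlip_transpose, ha.add_one.neg_one_pow]
      simp
    have h3 : (-(V * signedFlip a))ᵀ * (-(V * signedFlip a)) = 0 := by
      rw [Matrix.transpose_neg, Matrix.neg_mul, Matrix.mul_neg, Matrix.transpose_mul, Matrix.mul_assoc,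
        ← Matrix.mul_assoc Vᵀ, h.right_right]
      simp
    ext ⟨i, v⟩ ⟨j, w⟩
    have e0 := congrFun (congrFun h.left_left i) j
    have e1 := congrFun (congrFun h1 i) j
    have e2 := congrFun (congrFun h2 i) j
    have e3 := congrFun (congrFun h3 i) j
    obtain ⟨V', hV'⟩ : ∃ V', V' = -(V * signedFlip a) := ⟨_, rfl⟩
    rw [← hV'] at e1 e2 e3 ⊢
    rw [Matrix.mul_apply] at e0 e1 e2 e3 ⊢
    simp only [Matrix.transpose_apply, Matrix.neg_apply, Matrix.zero_apply] at e0 e1 e2 e3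
    fin_cases v <;> fin_cases w <;>
      simp [interleave, matB, ha, Matrix.kroneckerMap_apply, e0, e1, e2, e3]

theorem isAdaptedFamily_blockKt_even (ha : Even a) (m n : ℕ) (hn : n = m * 2) :
    ∃ P, IsAdaptedFamily (Matrix.blockDiagonal fun _ : Fin m => blockKt a)
      (Matrix.kronecker (shiftMat a) (1 : Matrix (Fin n) (Fin n) ℂ))
      (Matrix.kronecker (signedFlip a) (matB a n)) P := by
  subst hn
  obtain ⟨P, hP⟩ := isAdaptedFamily_blockK ha
  let e₀ : Fin (sizeKt a) ≃ Fin a ⊕ Fin a := (finCongr (sizeKt_even ha)).trans finSumFinEquiv.symm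
  let e : Fin (sizeKt a) × Fin m ≃ (Fin a ⊕ Fin a) × Fin m := Equiv.prodCongr e₀ (Equiv.refl _)
  -- The inner index `t` encodes the copy `t / 2` and the chain `t % 2`.
  let f : Fin a × Fin (m * 2) ≃ (Fin a × Fin 2) × Fin m :=
    (Equiv.prodCongr (Equiv.refl _) (finProdFinEquiv.symm.trans (Equiv.prodComm _ _))).trans
      (Equiv.prodAssoc _ _ _).symm
  have h := (hP.blockDiagonal (Fin m)).submatrix e f
  have hf : ∀ i t, f (i, t) = ((i, t.modNat), t.divNat) := fun _ _ => rfl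
  have h1 : (Matrix.blockDiagonal fun _ : Fin m => blockK a 0).submatrix e e =
      Matrix.blockDiagonal fun _ : Fin m => blockKt a := by
    ext ⟨x, c⟩ ⟨y, d⟩
    simp only [Matrix.submatrix_apply, Matrix.blockDiagonal_apply, blockKt, dif_pos ha]
    rfl
  have h2 : (Matrix.blockDiagonal fun _ : Fin m =>
      Matrix.kronecker (shiftMat a) (1 : Matrix (Fin 2) (Fin 2) ℂ)).submatrix f f =
      Matrix.kronecker (shiftMat a) (1 : Matrix (Fin (m * 2)) (Fin (m * 2)) ℂ) := by
    ext ⟨i, s⟩ ⟨j, t⟩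
    simp only [Matrix.submatrix_apply, hf, Matrix.blockDiagonal_apply, Matrix.kronecker,
      Matrix.kroneckerMap_apply, Matrix.one_apply, Fin.ext_iff, Fin.coe_modNat, Fin.coe_divNat]
    split_ifs <;> first | omega | simp
  have h3 : (Matrix.blockDiagonal fun _ : Fin m =>
      Matrix.kronecker (signedFlip a) (matB a 2)).submatrix f f =
      Matrix.kronecker (signedFlip a) (matB a (m * 2)) := by
    have hmat : ∀ (n : ℕ) (s t : Fin n), matB a n s t = if s.val + 1 = t.val ∧ s.val % 2 = 0 then -1
        else if t.val + 1 = s.val ∧ t.val % 2 = 0 then 1 else 0 := by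
      intro n s t
      rw [matB, if_pos ha]
      simp only [Matrix.of_apply, Nat.even_iff]
    ext ⟨i, s⟩ ⟨j, t⟩
    simp only [Matrix.submatrix_apply, hf, Matrix.blockDiagonal_apply, Matrix.kronecker,
      Matrix.kroneckerMap_apply, hmat, Fin.ext_iff, Fin.coe_modNat, Fin.coe_divNat]
    by_cases hst : (s : ℕ) / 2 = t / 2
    · rw [if_pos hst]
      congr 1
      exact if_congr (by omega) rfl (if_congr (by omega) rfl rfl)
    · rw [if_neg hst, if_neg (by omega), if_neg (by omega), mul_zero]
  rw [h1, h2, h3] at h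
  exact ⟨_, h⟩

end evenBlocks

section oddBlocks

variable {a : ℕ}

/-- The shift with the signs of the entries changed in the second half. -/
def signedShift (a : ℕ) : Matrix (Fin a) (Fin a) ℂ :=
  Matrix.of fun i j => if i.val + 1 = j.val then (if i.val < a / 2 then 1 else -1) else 0

/-- The real part of `blockL`. -/
def blockLRe (a : ℕ) : Matrix (Fin a) (Fin a) ℂ :=
  Matrix.of fun i j => if i.val + 1 = j.val then (if i.val < a / 2 then 1 / 2 else -1 / 2)
      else if j.val + 1 = i.val then (if j.val < a / 2 then -1 / 2 else 1 / 2) else 0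

/-- The imaginary part of `blockL`. -/
def blockLIm (a : ℕ) : Matrix (Fin a) (Fin a) ℂ :=
  Matrix.of fun i j => if i.val + j.val + 2 = a ∨ i.val + j.val = a then
      (if i.val < j.val then 1 / 2 else -1 / 2) else 0

theorem blockL_eq (a : ℕ) : blockL a = blockLRe a + Complex.I • blockLIm a := rfl

theorem blockLRe_add (ha : Odd a) : blockLRe a + blockLIm a * flipMat a = signedShift a := by
  rw [mul_flipMat]
  ext i j
  have hi := i.2
  have hj := j.2
  obtain ⟨h, rfl⟩ := ha
  simp only [blockLRe, blockLIm, signedShift, Matrix.add_apply, Matrix.submatrix_apply,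
    Matrix.of_apply, id, Fin.val_rev]
  split_ifs <;> first | omega | norm_num

theorem blockLIm_sub (ha : Odd a) :
    blockLIm a - blockLRe a * flipMat a = -(flipMat a * signedShift a) := by
  rw [mul_flipMat, flipMat_mul]
  ext i j
  have hi := i.2
  have hj := j.2
  obtain ⟨h, rfl⟩ := ha
  simp only [blockLRe, blockLIm, signedShift, Matrix.sub_apply, Matrix.submatrix_apply,
    Matrix.neg_apply, Matrix.of_apply, id, Fin.val_rev]
  split_ifs <;> first | omega | norm_num

/-- The columns of `1 - iE` carry `L` to the shift with signs in its second half, and the diagonal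
sign matrix `S` removes these signs. Since `(1 - iE)² = -2iE`, the Gram matrix is a multiple of `S E
S`, the alternating flip up to sign. -/
theorem isAdaptedFamily_blockL (ha : Odd a) :
    ∃ P, IsAdaptedFamily (blockL a) (shiftMat a) ((-1 : ℂ) ^ ((a - 1) / 2) • signedFlip a) P := by
  have hI : Complex.I * Complex.I = -1 := Complex.I_mul_I
  have hE := flipMat_mul_self a
  obtain ⟨S, hS⟩ : ∃ S : Matrix (Fin a) (Fin a) ℂ, S = Matrix.diagonal fun i =>
    if i.val ≤ a / 2 then 1 else (-1) ^ (i.val - a / 2) := ⟨_, rfl⟩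
  have h1 : signedShift a * S = S * shiftMat a := by
    ext i j
    rw [hS, Matrix.mul_diagonal, Matrix.diagonal_mul]
    simp only [signedShift, shiftMat, Matrix.of_apply]
    by_cases hij : (i : ℕ) + 1 = j
    · rw [if_pos hij, if_pos hij, ← hij]
      rcases lt_trichotomy (i : ℕ) (a / 2) with h | h | h
      · rw [if_pos h, if_pos (by omega), if_pos (by omega)]
      · rw [if_neg (by omega), if_neg (by omega), if_pos (by omega),
          show (i : ℕ) + 1 - a / 2 = 1 by omega]
        norm_num
      · rw [if_neg (by omega), if_neg (by omega), if_neg (by omega),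
          show (i : ℕ) + 1 - a / 2 = (i - a / 2) + 1 by omega]
        ring
    · simp [hij]
  have h2 : S * flipMat a * S = (-1 : ℂ) ^ ((a - 1) / 2) • signedFlip a := by
    ext i j
    rw [hS, Matrix.mul_diagonal, Matrix.diagonal_mul]
    have hi := i.2
    have hj := j.2
    obtain ⟨h, rfl⟩ := ha
    simp only [flipMat, signedFlip, Matrix.of_apply, Matrix.smul_apply, smul_eq_mul, Fin.ext_iff,
      Fin.val_rev]
    rw [show (2 * h + 1) / 2 = h by omega, show (2 * h + 1 - 1) / 2 = h by omega]
    by_cases hij : (i : ℕ) + j + 1 = 2 * h + 1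
    · rw [if_pos (show (j : ℕ) = _ by omega), if_pos hij, mul_one, ← pow_add]
      by_cases hh : (i : ℕ) ≤ h
      · rw [if_pos hh, one_mul]
        by_cases hh' : (j : ℕ) ≤ h
        · rw [if_pos hh', show (j : ℕ) = h by omega, ← two_mul]; simp
        · rw [if_neg hh', show h + (j : ℕ) = (j - h) + 2 * h by omega, pow_add, pow_mul]; simp
      · rw [if_neg hh, if_pos (by omega), mul_one, show h + (j : ℕ) = (i - h) + 2 * j by omega,
          pow_add, pow_mul]
        simp
    · rw [if_neg (show ¬ (j : ℕ) = _ by omega), if_neg hij]; simp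
  have hSt : Sᵀ = S := by rw [hS, Matrix.diagonal_transpose]
  have h3 : blockL a * (1 - Complex.I • flipMat a) = (1 - Complex.I • flipMat a) * signedShift a := by
    have e1 := blockLRe_add ha
    have e2 := blockLIm_sub ha
    rw [blockL_eq]
    calc _ = (blockLRe a + blockLIm a * flipMat a) +
          Complex.I • (blockLIm a - blockLRe a * flipMat a) := by
          simp only [Matrix.mul_sub, Matrix.add_mul, Matrix.mul_one, Matrix.mul_smul,
            Matrix.smul_mul, smul_add, smul_smul, smul_sub, hI]
          simp only [neg_smul, one_smul]; abel
      _ = _ := by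
          rw [e1, e2, Matrix.sub_mul, Matrix.one_mul, Matrix.smul_mul, smul_neg, sub_eq_add_neg]
  -- The scalar is chosen so that its square `i / 2` cancels the factor `-2i`.
  refine ⟨((1 + Complex.I) / 2) • ((1 - Complex.I • flipMat a) * S), ?_, ?_⟩
  · rw [Matrix.mul_smul, Matrix.smul_mul, ← Matrix.mul_assoc, h3, Matrix.mul_assoc, h1,
      Matrix.mul_assoc]
  · rw [← h2, Matrix.transpose_smul, Matrix.smul_mul, Matrix.mul_smul, smul_smul,
      Matrix.transpose_mul, hSt, Matrix.transpose_sub, Matrix.transpose_smul, flipMat_transpose,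
      Matrix.transpose_one]
    have e : (1 - Complex.I • flipMat a) * (1 - Complex.I • flipMat a) =
        (-2 * Complex.I) • flipMat a := by
      rw [Matrix.mul_sub, Matrix.mul_one, Matrix.sub_mul, Matrix.one_mul, Matrix.smul_mul,
        Matrix.mul_smul, hE, smul_smul, hI, neg_smul, one_smul, mul_smul, neg_smul, two_smul]
      abel
    calc _ = (((1 + Complex.I) / 2) * ((1 + Complex.I) / 2)) • (S * ((1 - Complex.I • flipMat a) *
          (1 - Complex.I • flipMat a)) * S) := by simp only [Matrix.mul_assoc]
      _ = _ := by
        rw [e, Matrix.mul_smul, Matrix.smul_mul, smul_smul]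
        have : (1 + Complex.I) / 2 * ((1 + Complex.I) / 2) * (-2 * Complex.I) = 1 := by
          linear_combination (-(1 + Complex.I / 2)) * hI
        rw [this, one_smul]

theorem isAdaptedFamily_blockKt_odd (ha : ¬ Even a) (m : ℕ) :
    ∃ P, IsAdaptedFamily (Matrix.blockDiagonal fun _ : Fin m => blockKt a)
      (Matrix.kronecker (shiftMat a) (1 : Matrix (Fin m) (Fin m) ℂ))
      (Matrix.kronecker (signedFlip a) (matB a m)) P := by
  obtain ⟨P, hP⟩ := isAdaptedFamily_blockL (Nat.not_even_iff_odd.mp ha)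
  let e : Fin (sizeKt a) × Fin m ≃ Fin a × Fin m :=
    Equiv.prodCongr (finCongr (sizeKt_odd ha)) (Equiv.refl _)
  have h := (hP.blockDiagonal (Fin m)).submatrix e (Equiv.refl _)
  have h1 : (Matrix.blockDiagonal fun _ : Fin m => blockL a).submatrix e e =
      Matrix.blockDiagonal fun _ : Fin m => blockKt a := by
    ext ⟨x, c⟩ ⟨y, d⟩
    simp only [Matrix.submatrix_apply, Matrix.blockDiagonal_apply, blockKt, dif_neg ha]
    rfl
  rw [h1] at h
  refine ⟨(Matrix.blockDiagonal fun _ : Fin m => P).submatrix e (Equiv.refl _), ?_⟩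
  convert h using 1
  · ext ⟨x, c⟩ ⟨y, d⟩
    simp [Matrix.kroneckerMap_apply, Matrix.blockDiagonal_apply, Matrix.one_apply]
  · ext ⟨x, c⟩ ⟨y, d⟩
    simp [Matrix.kroneckerMap_apply, Matrix.blockDiagonal_apply, Matrix.one_apply, matB, ha,
      mul_comm]

end oddBlocks

section assembly

variable {N : ℕ} (α m : Fin N → ℕ)

theorem isUnit_matB_mTilde (r : Fin N) : IsUnit (matB (α r) (mTilde α m r)) :=
  isUnit_matB fun h => by simp [mTilde, h]

theorem exists_isAdaptedBasis_formKZero :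
    ∃ P P', IsAdaptedBasis (formKZero α m) (blockShift α (mTilde α m))
      (formMat α fun r => matB (α r) (mTilde α m r)) P P' := by
  have h : ∀ r, ∃ P, IsAdaptedFamily (Matrix.blockDiagonal fun _ : Fin (m r) => blockKt (α r))
      (Matrix.kronecker (shiftMat (α r)) (1 : Matrix (Fin (mTilde α m r)) (Fin (mTilde α m r)) ℂ))
      (Matrix.kronecker (signedFlip (α r)) (matB (α r) (mTilde α m r))) P := by
    intro r
    by_cases ha : Even (α r)
    · exact isAdaptedFamily_blockKt_even ha _ _ (by simp [mTilde, ha, mul_comm])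
    · have : mTilde α m r = m r := by simp [mTilde, ha]
      rw [this]
      exact isAdaptedFamily_blockKt_odd ha _
  choose P hP using h
  have hcard : Fintype.card (FormZeroIdx α m) = Fintype.card (BlockIdx α (mTilde α m)) := by
    simp only [Fintype.card_sigma, Fintype.card_prod, Fintype.card_fin]
    refine Finset.sum_congr rfl fun r _ => ?_
    by_cases ha : Even (α r)
    · simp only [sizeKt, mTilde, ha, if_true]; ring
    · simp [sizeKt, mTilde, ha]
  have hfam : IsAdaptedFamily (formKZero α m) (blockShift α (mTilde α m))
      (formMat α fun r => matB (α r) (mTilde α m r)) (Matrix.blockDiagonal' P) :=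
    IsAdaptedFamily.blockDiagonal' hP
  obtain ⟨G', hG'⟩ := (isUnit_formMat (α := α) _ (isUnit_matB_mTilde α m)).exists_left_inv
  exact ⟨_, _, hfam.isAdaptedBasis hcard hG'⟩

end assembly

/-! ### Dimensions -/

section symmetric

/-- The matrices with `Z = (-1)^k Zᵀ`. -/
def signSymmetric (n k : ℕ) : Submodule ℂ (Matrix (Fin n) (Fin n) ℂ) where
  carrier := {Z | Z = (-1 : ℂ) ^ k • Zᵀ}
  add_mem' := by
    intro Z Z' h h'
    change Z + Z' = _
    rw [Matrix.transpose_add, smul_add, ← h, ← h']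
  zero_mem' := by simp
  smul_mem' := by
    intro c Z h
    change c • Z = _
    rw [Matrix.transpose_smul, smul_comm, ← h]

theorem mem_signSymmetric {n k : ℕ} {Z : Matrix (Fin n) (Fin n) ℂ} :
    Z ∈ signSymmetric n k ↔ Z = (-1 : ℂ) ^ k • Zᵀ := Iff.rfl

theorem finrank_signSymmetric_even {n k : ℕ} (hk : Even k) :
    2 * (Module.finrank ℂ (signSymmetric n k) : ℚ) = n ^ 2 + n := by
  have h1 : ∀ Z ∈ signSymmetric n k, Zᵀ = Z := by
    intro Z hZ
    rw [mem_signSymmetric, hk.neg_one_pow, one_smul] at hZ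
    exact hZ.symm
  have e : signSymmetric n k ≃ₗ[ℂ] (Sym2 (Fin n) → ℂ) :=
    { toFun := fun Z => Sym2.lift ⟨fun i j => Z.1 i j, fun i j => by
        conv_rhs => rw [← h1 _ Z.2]
        rfl⟩
      invFun := fun f => ⟨Matrix.of fun i j => f s(i, j), by
        rw [mem_signSymmetric, hk.neg_one_pow, one_smul]
        ext i j
        simp [Sym2.eq_swap]⟩
      map_add' := fun Z Z' => by
        ext p; induction p with | _ i j => rfl
      map_smul' := fun c Z => by
        ext p; induction p with | _ i j => rfl
      left_inv := fun Z => by ext; rfl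
      right_inv := fun f => by
        ext p; induction p with | _ i j => rfl }
  rw [e.finrank_eq, Module.finrank_pi, Sym2.card, Fintype.card_fin, Nat.choose_two_right,
    Nat.add_sub_cancel]
  have := Nat.div_mul_cancel (Nat.even_mul_pred_self (n + 1)).two_dvd
  rw [Nat.add_sub_cancel] at this
  have h2 : ((((n + 1) * n / 2 : ℕ) : ℚ)) * 2 = (n + 1) * n := by exact_mod_cast this
  linarith

theorem finrank_signSymmetric_odd {n k : ℕ} (hk : Odd k) :
    2 * (Module.finrank ℂ (signSymmetric n k) : ℚ) = n ^ 2 - n := by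
  -- Rank–nullity for `Z ↦ Z + Zᵀ`: the kernel is the skew and the image the symmetric matrices.
  let f : Matrix (Fin n) (Fin n) ℂ →ₗ[ℂ] Matrix (Fin n) (Fin n) ℂ :=
    LinearMap.id + (Matrix.transposeLinearEquiv (Fin n) (Fin n) ℂ ℂ).toLinearMap
  have hf : ∀ Z, f Z = Z + Zᵀ := fun _ => rfl
  have h1 : LinearMap.ker f = signSymmetric n k := by
    ext Z
    rw [LinearMap.mem_ker, hf, mem_signSymmetric, hk.neg_one_pow, neg_smul, one_smul,
      add_eq_zero_iff_eq_neg]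
  have h2 : LinearMap.range f = signSymmetric n 0 := by
    ext Z
    rw [LinearMap.mem_range, mem_signSymmetric, pow_zero, one_smul]
    constructor
    · rintro ⟨Y, rfl⟩
      rw [hf, Matrix.transpose_add, Matrix.transpose_transpose, add_comm]
    · intro hZ
      refine ⟨(1 / 2 : ℂ) • Z, ?_⟩
      rw [hf, Matrix.transpose_smul, ← hZ, ← add_smul]; norm_num
  have h3 := LinearMap.finrank_range_add_finrank_ker f
  rw [h1, h2, Module.finrank_matrix, Module.finrank_self, Fintype.card_fin, mul_one] at h3
  have h4 : (Module.finrank ℂ (signSymmetric n 0) : ℚ) +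
    Module.finrank ℂ (signSymmetric n k) = n * n := by exact_mod_cast h3
  have h5 := finrank_signSymmetric_even (n := n) (k := 0) (by simp)
  linarith

theorem finrank_signSymmetric_congr {n k l : ℕ} (h : k % 2 = l % 2) :
    Module.finrank ℂ (signSymmetric n k) = Module.finrank ℂ (signSymmetric n l) := by
  have : signSymmetric n k = signSymmetric n l := by
    ext Z
    rw [mem_signSymmetric, mem_signSymmetric, neg_one_pow_eq_pow_mod_two (n := k),
      neg_one_pow_eq_pow_mod_two (n := l), h]
  rw [this]

/-- After reversing the order of summation the parities are `1, …, a`, so skew and symmetric spaces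
alternate, starting with a skew one. Consecutive pairs add up to `n²`; for odd `a` one skew space is
left over. -/
theorem sum_finrank_signSymmetric (a n : ℕ) :
    (∑ q : Fin a, (Module.finrank ℂ (signSymmetric n (a + q)) : ℚ)) =
      1 / 2 * (n : ℚ) ^ 2 * a - if Odd a then 1 / 2 * (n : ℚ) else 0 := by
  have h : ∀ a : ℕ, ∑ q ∈ Finset.range a, (Module.finrank ℂ (signSymmetric n (q + 1)) : ℚ) =
      1 / 2 * (n : ℚ) ^ 2 * a - if Odd a then 1 / 2 * (n : ℚ) else 0 := by
    intro a
    induction a with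
    | zero => simp
    | succ a ih =>
      rw [Finset.sum_range_succ, ih]
      by_cases ha : Odd a
      · have := finrank_signSymmetric_even (n := n) ha.add_one
        rw [if_pos ha, if_neg (Nat.not_odd_iff_even.mpr ha.add_one)]
        push_cast; linarith
      · have ha' : Odd (a + 1) := (Nat.not_odd_iff_even.mp ha).add_one
        have := finrank_signSymmetric_odd (n := n) ha'
        rw [if_neg ha, if_pos ha']
        push_cast; linarith
  rw [← h, Fin.sum_univ_eq_sum_range (fun q => (Module.finrank ℂ (signSymmetric n (a + q)) : ℚ)),
    ← Finset.sum_range_reflect]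
  refine Finset.sum_congr rfl fun q hq => ?_
  rw [Finset.mem_range] at hq
  rw [finrank_signSymmetric_congr]
  omega

end symmetric

section dimension

variable {N : ℕ} {α m : Fin N → ℕ}

theorem coeffsOf_add (X Y : Matrix (BlockIdx α m) (BlockIdx α m) ℂ) :
    coeffsOf (X + Y) = coeffsOf X + coeffsOf Y := by
  funext r s j
  ext c d
  simp only [coeffsOf, Matrix.of_apply, Pi.add_apply, Matrix.add_apply]
  split_ifs <;> simp

theorem coeffsOf_smul (a : ℂ) (X : Matrix (BlockIdx α m) (BlockIdx α m) ℂ) :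
    coeffsOf (a • X) = a • coeffsOf X := by
  funext r s j
  ext c d
  simp only [coeffsOf, Matrix.of_apply, Pi.smul_apply, Matrix.smul_apply]
  split_ifs <;> simp

theorem eq_zero_of_coeffsOf_eq_zero (hpos : ∀ r, 0 < α r)
    {X : Matrix (BlockIdx α m) (BlockIdx α m) ℂ} (hX : X * blockShift α m = blockShift α m * X)
    (h : ∀ r s j, j < α r → j < α s → coeffsOf X r s j = 0) : X = 0 := by
  rw [eq_blockToeplitz_coeffsOf hX, ← blockToeplitz_zero, blockToeplitz_eq_iff hpos]
  exact h

theorem finrank_autLie_zero (hpos : ∀ r, 0 < α r) :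
    Module.finrank ℂ (autLie (blockShift α m) 0) =
      ∑ r, ∑ s, min (α r) (α s) * (m r * m s) := by
  let f : autLie (blockShift α m) 0 →ₗ[ℂ]
      ((r s : Fin N) → Fin (min (α r) (α s)) → Matrix (Fin (m r)) (Fin (m s)) ℂ) :=
    { toFun := fun X r s j => coeffsOf X.1 r s j
      map_add' := fun X Y => by
        funext r s j
        exact congrFun (congrFun (congrFun (coeffsOf_add X.1 Y.1) r) s) j
      map_smul' := fun a X => by
        funext r s j
        exact congrFun (congrFun (congrFun (coeffsOf_smul a X.1) r) s) j }
  have hf : Function.Bijective f := by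
    constructor
    · rw [← LinearMap.ker_eq_bot, LinearMap.ker_eq_bot']
      intro X hX
      refine Subtype.ext (eq_zero_of_coeffsOf_eq_zero hpos X.2.2 fun r s j hr hs => ?_)
      exact congrFun (congrFun (congrFun hX r) s) ⟨j, lt_min hr hs⟩
    · intro A
      let A' : Coeffs m := fun r s j => if h : j < min (α r) (α s) then A r s ⟨j, h⟩ else 0
      refine ⟨⟨blockToeplitz α A', by simp, blockToeplitz_commute_blockShift A'⟩, ?_⟩
      funext r s j
      have hj := j.2
      change coeffsOf (blockToeplitz α A') r s j = _
      rw [coeffsOf_blockToeplitz _ hpos _ _ _ (lt_min_iff.mp hj).1 (lt_min_iff.mp hj).2]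
      simp [A', lt_min_iff.mp hj]
  rw [(LinearEquiv.ofBijective f hf).finrank_eq]
  simp [Module.finrank_pi_fintype, Module.finrank_matrix]

theorem sum_sum_eq_sum_lt {M : Type*} [AddCommMonoid M] (f : Fin N → Fin N → M) :
    ∑ r, ∑ s, f r s = ∑ r, (f r r + ∑ s ∈ Finset.univ.filter (fun s => s < r), (f r s + f s r)) := by
  have h1 : ∀ r, ∑ s, f r s = f r r + (∑ s ∈ Finset.univ.filter (fun s => s < r), f r s +
      ∑ s ∈ Finset.univ.filter (fun s => r < s), f r s) := by
    intro r
    rw [← Finset.add_sum_erase Finset.univ _ (Finset.mem_univ r), ← Finset.sum_union]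
    · congr 2
      ext s
      simp [lt_or_lt_iff_ne]
    · rw [Finset.disjoint_filter]
      intro s _ h1 h2
      exact lt_asymm h1 h2
  simp only [h1, Finset.sum_add_distrib]
  congr 2
  simp only [Finset.sum_filter]
  exact Finset.sum_comm

theorem sum_min_mul_eq (hα : StrictAnti α) :
    ∑ r, ∑ s, min (α r) (α s) * (m r * m s) = ∑ r, m r * (α r * m r +
      2 * ∑ s ∈ Finset.univ.filter (fun s => s < r), α r * m s) := by
  rw [sum_sum_eq_sum_lt]
  refine Finset.sum_congr rfl fun r _ => ?_
  rw [min_self, mul_add, Finset.mul_sum, Finset.mul_sum]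
  congr 1
  · ring
  · refine Finset.sum_congr rfl fun s hs => ?_
    have := hα (Finset.mem_filter.mp hs).2
    rw [min_eq_left this.le, min_eq_right this.le]
    ring

variable (B : (r : Fin N) → Matrix (Fin (m r)) (Fin (m r)) ℂ)

/-- Coordinates are the blocks below the diagonal, which are free, and the sign-symmetric matrices
`B_r A_q^{rr}`. The linearized equation for `r < s` determines the block above the diagonal from its
mirror image. -/
theorem finrank_autLie_formMat (hα : StrictAnti α) (hpos : ∀ r, 0 < α r)
    (hBu : ∀ r, IsUnit (B r)) (hB : ∀ r, (B r)ᵀ = (-1 : ℂ) ^ (α r + 1) • B r) :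
    Module.finrank ℂ (autLie (blockShift α m) (formMat α B)) =
      ∑ r, (∑ s ∈ Finset.univ.filter (fun s => s < r), α r * (m r * m s) +
        ∑ q : Fin (α r), Module.finrank ℂ (signSymmetric (m r) (α r + q))) := by
  have hlie : ∀ X ∈ autLie (blockShift α m) (formMat α B), ∀ r s, r ≤ s → ∀ q, q < α s →
      B r * coeffsOf X r s q + (-1 : ℂ) ^ q • ((coeffsOf X s r q)ᵀ * B s) = 0 := by
    intro X hX
    rw [← blockToeplitz_lie_iff B hα hpos hB, ← eq_blockToeplitz_coeffsOf hX.2]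
    exact hX.1
  have hsign : ∀ (r : Fin N) (q : ℕ) (A : Matrix (Fin (m r)) (Fin (m r)) ℂ),
      B r * A + (-1 : ℂ) ^ q • (Aᵀ * B r) = 0 ↔ B r * A ∈ signSymmetric (m r) (α r + q) := by
    intro r q A
    rw [mem_signSymmetric, Matrix.transpose_mul, hB, Matrix.mul_smul, smul_smul, ← pow_add,
      show α r + q + (α r + 1) = 2 * α r + (q + 1) by ring, pow_add, pow_mul, neg_one_sq, one_pow, one_mul, pow_succ,
      mul_neg_one, neg_smul, add_eq_zero_iff_eq_neg]
  let f : autLie (blockShift α m) (formMat α B) →ₗ[ℂ]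
      ((r : Fin N) → ((s : {s : Fin N // s < r}) → Fin (α r) → Matrix (Fin (m r)) (Fin (m s)) ℂ) ×
        ((q : Fin (α r)) → signSymmetric (m r) (α r + q))) :=
    { toFun := fun X r => (fun s q => coeffsOf X.1 r s q, fun q => ⟨B r * coeffsOf X.1 r r q,
        (hsign r q _).mp (hlie X.1 X.2 r r le_rfl q q.2)⟩)
      map_add' := fun X Y => by
        have e := coeffsOf_add X.1 Y.1
        funext r
        refine Prod.ext ?_ ?_
        · funext s q
          exact congrFun (congrFun (congrFun e r) s) q
        · funext q
          refine Subtype.ext ?_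
          change B r * coeffsOf (X.1 + Y.1) r r q = B r * _ + B r * _
          rw [e, ← Matrix.mul_add]; rfl
      map_smul' := fun a X => by
        have e := coeffsOf_smul a X.1
        funext r
        refine Prod.ext ?_ ?_
        · funext s q
          exact congrFun (congrFun (congrFun e r) s) q
        · funext q
          refine Subtype.ext ?_
          change B r * coeffsOf (a • X.1) r r q = a • (B r * _)
          rw [e, ← Matrix.mul_smul]; rfl }
  have hBi : ∀ r, B r * (B r)⁻¹ = 1 := fun r =>
    Matrix.mul_nonsing_inv _ ((Matrix.isUnit_iff_isUnit_det _).mp (hBu r))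
  have hcancel : ∀ (r : Fin N) {n : ℕ} (A : Matrix (Fin (m r)) (Fin n) ℂ), B r * A = 0 → A = 0 := by
    intro r n A h
    calc A = (B r)⁻¹ * (B r * A) := by
          rw [← Matrix.mul_assoc, mul_eq_one_comm.mp (hBi r), Matrix.one_mul]
      _ = 0 := by rw [h, Matrix.mul_zero]
  have hf : Function.Bijective f := by
    constructor
    · rw [← LinearMap.ker_eq_bot, LinearMap.ker_eq_bot']
      intro X hX
      have hbelow : ∀ r s q, s < r → q < α r → coeffsOf X.1 r s q = 0 := fun r s q hs hq =>
        congrFun (congrFun (congrArg Prod.fst (congrFun hX r)) ⟨s, hs⟩) ⟨q, hq⟩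
      refine Subtype.ext (eq_zero_of_coeffsOf_eq_zero hpos X.2.2 fun r s j hr hs => ?_)
      rcases lt_trichotomy s r with h | rfl | h
      · exact hbelow r s j h hr
      · exact hcancel _ _ (congrArg Subtype.val
          (congrFun (congrArg Prod.snd (congrFun hX s)) ⟨j, hr⟩))
      · have h1 := hlie X.1 X.2 r s h.le j hs
        rw [hbelow s r j h hs] at h1
        exact hcancel _ _ (by simpa using h1)
    · intro Y
      let L : Coeffs m := fun r s q =>
        if h : s < r ∧ q < α r then (Y r).1 ⟨s, h.1⟩ ⟨q, h.2⟩ else 0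
      let Z : (r : Fin N) → ℕ → Matrix (Fin (m r)) (Fin (m r)) ℂ := fun r q =>
        if h : q < α r then (B r)⁻¹ * ((Y r).2 ⟨q, h⟩).1 else 0
      let A : Coeffs m := fun r s q => if r < s then
        -((-1 : ℂ) ^ q • ((B r)⁻¹ * ((L s r q)ᵀ * B s))) else L r s q + diagCoeffs Z r s q
      have hAbelow : ∀ r s q (h : s < r), A r s q = L r s q := by
        intro r s q h
        simp only [A, if_neg h.not_gt, diagCoeffs_ne _ h.ne', add_zero]
      have hAdiag : ∀ r q, A r r q = Z r q := by
        intro r q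
        simp [A, L]
      have hZ : ∀ r q (h : q < α r), B r * Z r q = ((Y r).2 ⟨q, h⟩).1 := by
        intro r q h
        simp only [Z, dif_pos h]
        rw [← Matrix.mul_assoc, hBi, Matrix.one_mul]
      have hmem : blockToeplitz α A ∈ autLie (blockShift α m) (formMat α B) := by
        refine ⟨?_, blockToeplitz_commute_blockShift A⟩
        rw [blockToeplitz_lie_iff B hα hpos hB]
        intro r s hrs q hq
        rcases hrs.lt_or_eq with h | rfl
        · rw [hAbelow s r q h]
          simp only [A, if_pos h]
          rw [Matrix.mul_neg, Matrix.mul_smul, ← Matrix.mul_assoc (B r), hBi, Matrix.one_mul,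
            neg_add_cancel]
        · rw [hAdiag, hsign, hZ r q hq]
          exact ((Y r).2 ⟨q, hq⟩).2
      refine ⟨⟨_, hmem⟩, ?_⟩
      funext r
      refine Prod.ext ?_ ?_
      · funext ⟨s, hs⟩ q
        change coeffsOf (blockToeplitz α A) r s q = _
        rw [coeffsOf_blockToeplitz _ hpos _ _ _ q.2 (q.2.trans (hα hs)), hAbelow _ _ _ hs]
        simp [L, hs]
      · funext q
        refine Subtype.ext ?_
        change B r * coeffsOf (blockToeplitz α A) r r q = _
        rw [coeffsOf_blockToeplitz _ hpos _ _ _ q.2 q.2, hAdiag, hZ r q q.2]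
  rw [(LinearEquiv.ofBijective f hf).finrank_eq, Module.finrank_pi_fintype]
  refine Finset.sum_congr rfl fun r _ => ?_
  rw [Module.finrank_prod, Module.finrank_pi_fintype, Module.finrank_pi_fintype,
    Finset.sum_subtype (Finset.univ.filter fun s => s < r) (p := fun s => s < r) (by simp)]
  congr 1
  refine Finset.sum_congr rfl fun s _ => ?_
  simp [Module.finrank_pi_fintype, Module.finrank_matrix]

end dimension
end

/-! ### Assembly of the two cases -/

theorem theorem2p3 {N : ℕ} (α m : Fin N → ℕ) (hα : StrictAnti α) (hα_pos : ∀ r, 0 < α r) :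
    -- part (1)
    (∀ z : ℂ, z ≠ 0 →
      ((∀ k : ℤ, z ≠ (k : ℂ) * (Real.pi : ℂ) * Complex.I) →
        isotropyGroup (NormedSpace.exp (formK α m z)) = isotropyGroup (formK α m z)) ∧
      AreConjugate (isotropyGroup (formK α m z) : Set (GL (FormIdx α m) ℂ))
        (doubledToeplitzSet α m) ∧
      (∃ T : Subgroup (GL (BlockIdx α m) ℂ), (T : Set (GL (BlockIdx α m) ℂ)) = toeplitzSet α m ∧
        Nonempty (isotropyGroup (formK α m z) ≃* T)) ∧
      HasComplexLieDim (isotropyGroup (formK α m z))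
        (∑ r, m r * (α r * m r + 2 * ∑ s ∈ Finset.univ.filter (fun s => s < r), α r * m s))) ∧
    -- part (2)
    ((∀ ε : ℂ, ε = 1 ∨ ε = -1 →
        isotropyGroup (ε • NormedSpace.exp (formKZero α m)) = isotropyGroup (formKZero α m)) ∧
      (∃ d : ℕ, HasComplexLieDim (isotropyGroup (formKZero α m)) d ∧
        (d : ℚ) = ∑ r, ((1 / 2 : ℚ) * (mTilde α m r : ℚ) ^ 2 * (α r : ℚ) +
            ∑ s ∈ Finset.univ.filter (fun s => s < r),
              (α r : ℚ) * (mTilde α m r : ℚ) * (mTilde α m s : ℚ)) -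
          ∑ r ∈ Finset.univ.filter (fun r => Odd (α r)), (1 / 2 : ℚ) * (m r : ℚ)) ∧
      ∃ 𝕏 𝕆 𝕍 : Subgroup (GL (BlockIdx α (mTilde α m)) ℂ),
        (𝕏 : Set (GL (BlockIdx α (mTilde α m)) ℂ)) ⊆ toeplitzSet α (mTilde α m) ∧
        AreConjugate (isotropyGroup (formKZero α m) : Set (GL (FormZeroIdx α m) ℂ))
          (𝕏 : Set (GL (BlockIdx α (mTilde α m)) ℂ)) ∧
        SatisfiesConditions α (fun r => matB (α r) (mTilde α m r))
          (𝕏 : Set (GL (BlockIdx α (mTilde α m)) ℂ)) ∧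
        IsInternalSemidirect 𝕏 𝕆 𝕍 ∧
        (𝕆 : Set (GL (BlockIdx α (mTilde α m)) ℂ)) =
          pseudoOrthogonalSet α (fun r => matB (α r) (mTilde α m r)) ∧
        𝕍 = Subgroup.closure
          (diagonalGenerators α (fun r => matB (α r) (mTilde α m r)) ∪
            offDiagonalGenerators α (fun r => matB (α r) (mTilde α m r))) ∧
        ∀ V ∈ 𝕍, IsNilpotent
          ((V : Matrix (BlockIdx α (mTilde α m)) (BlockIdx α (mTilde α m)) ℂ) - 1)) := by
  refine ⟨fun z hz => ?_, ?_⟩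
  · obtain ⟨P, R, h⟩ := exists_isIsotropicPair_formK α m z
    have hN := isNilpotent_blockShift α m
    have hT := coe_autGroup_blockShift (m := m) hα hα_pos
    refine ⟨h.isotropyGroup_exp hN, ?_, ⟨autGroup (blockShift α m) 0, hT, ?_⟩, ?_⟩
    · have h1 := h.areConjugate hN hz
      simp only [← SetLike.mem_coe, hT] at h1
      exact h1
    · rw [← h.map_autGroup_eq hN hz]
      exact ⟨(Subgroup.equivMapOfInjective _ _ h.hom_injective).symm⟩
    · have h1 := hasComplexLieDim_isotropyGroup (formK α m z)
      rwa [h.finrank_isotropyLie hN hz, finrank_autLie_zero hα_pos, sum_min_mul_eq hα] at h1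
  · obtain ⟨P, P', h⟩ := exists_isAdaptedBasis_formKZero α m
    have hBu := isUnit_matB_mTilde α m
    have hB : ∀ r, (matB (α r) (mTilde α m r))ᵀ =
        (-1 : ℂ) ^ (α r + 1) • matB (α r) (mTilde α m r) := fun r => matB_transpose _ _
    refine ⟨fun ε hε => ?_, ⟨_, hasComplexLieDim_isotropyGroup _, ?_⟩, ?_⟩
    · refine isotropyGroup_smul_exp_of_isNilpotent (h.isNilpotent (isNilpotent_blockShift _ _)) ?_
      rcases hε with rfl | rfl <;> norm_num
    · rw [h.finrank_isotropyLie, finrank_autLie_formMat _ hα hα_pos hBu hB, Finset.sum_filter,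
        ← Finset.sum_sub_distrib]
      push_cast
      refine Finset.sum_congr rfl fun r _ => ?_
      rw [sum_finrank_signSymmetric]
      have h1 : (if Odd (α r) then 1 / 2 * (mTilde α m r : ℚ) else 0) =
          if Odd (α r) then 1 / 2 * (m r : ℚ) else 0 := by
        by_cases ha : Odd (α r)
        · simp [mTilde, Nat.not_even_iff_odd.mpr ha]
        · simp [ha]
      rw [h1]
      simp only [mul_assoc]
      ring
    · refine ⟨autGroup (blockShift α (mTilde α m)) (formMat α fun r => matB (α r) (mTilde α m r)),
        pseudoOrthogonalGroup α hBu, unipotentSubgroup α fun r => matB (α r) (mTilde α m r),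
        autGroup_subset_toeplitzSet hα hα_pos hBu hB, h.areConjugate,
        satisfiesConditions_autGroup _ hα hα_pos hBu hB,
        isInternalSemidirect_autGroup hα hα_pos hBu hB, rfl,
        unipotentSubgroup_eq_closure hα hα_pos hBu hB, fun V hV => hV.2.isNilpotent⟩
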